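/- Let $m\ge 1$ and let $\sigma_1,\dots,\sigma_m$ be finite Borel measures on $\mathbb{R}$, each of constant sign (positive or negative) and with compact support consisting of infinitely many points. Let $\Delta_j$ be the smallest interval containing $\operatorname{supp}\sigma_j$, and assume $\Delta_j\cap\Delta_{j+1}=\emptyset$ for $j=1,\dots,m-1$. For a measure $s$ write $\widehat{s}(z)=\int \frac{ds(x)}{z-x}$, and for two measures $\alpha,\beta$ put $d\langle\alpha,\beta\rangle(x)=\widehat{\beta}(x)\,d\alpha(x)$. Let $(s_{1,1},\dots,s_{1,m})=\mathcal{N}(\sigma_1,\dots,\sigma_m)$ be the Nikishin system generated by $(\sigma_1,\dots,\sigma_m)$, that is, $s_{1,1}=\sigma_1$ and $s_{1,k}=\langle\sigma_1,\langle\sigma_2,\dots,\sigma_k\rangle\rangle$ for $k=2,\dots,m$, where $\langle\sigma_k\rangle=\sigma_k$ and $\langle\sigma_j,\dots,\sigma_k\rangle=\langle\sigma_j,\langle\sigma_{j+1},\dots,\sigma_k\rangle\rangle$ for $j<k$. For a multi-index $\mathbf{n}=(n_0,\dots,n_m)$ of non-negative integers write $|\mathbf{n}|=n_0+\cdots+n_m$;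 the condition $\deg p\le -1$ means $p\equiv 0$. Then: 1. The system $(1,\widehat{s}_{1,1},\dots,\widehat{s}_{1,m})$ is an AT-system on every interval $\Delta\subset\mathbb{R}$ disjoint from $\Delta_1$. That is, these functions are continuous on $\Delta$ and, for every multi-index $\mathbf{n}\in\mathbb{Z}_+^{m+1}$ and all real polynomials $p_0,\dots,p_m$, not all identically zero, with $\deg p_k\le n_k-1$, the function $p_0+\sum_{k=1}^m p_k\widehat{s}_{1,k}$ has at most $|\mathbf{n}|-1$ zeros on $\Delta$. 2. Moreover, for every multi-index $\mathbf{n}\in\mathbb{Z}_+^{m+1}$ and all real polynomials $p_0,\dots,p_m$, not all identically zero, with $\deg p_k\le n_k-1$, the linear form $p_0+\sum_{k=1}^m p_k\widehat{s}_{1,k}$ is analytic in $\mathbb{C}\setminus\Delta_1$ and has at most $|\mathbf{n}|-1$ zeros there, counted with multiplicity. -/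

import Mathlib

open MeasureTheory Polynomial

noncomputable section

/-- The smallest interval containing the support of the measure `s`. -/
def suppHull (s : SignedMeasure ℝ) : Set ℝ :=
  convexHull ℝ s.variation.support

/-- Finite real Borel measures of constant sign on the line, whose support is compact and infinite.
(A `SignedMeasure` is automatically finite.) -/
structure IsMarkovMeasure (s : SignedMeasure ℝ) : Prop where
  constant_sign : 0 ≤ s ∨ s ≤ 0
  compact_support : IsCompact s.variation.support
  infinite_support : s.variation.support.Infinite

/-- The Cauchy transform `∫ ds(x) / (z - x)` at a complex point `z`. -/
def cauchyTransform (s : SignedMeasure ℝ) (z : ℂ) : ℂ :=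
  ∫ᵛ x : ℝ, (z - (x : ℂ))⁻¹ ∂<•s

/-- The Cauchy transform `∫ ds(x) / (y - x)` at a real point `y`, as a real number. -/
def realCauchyTransform (s : SignedMeasure ℝ) (y : ℝ) : ℝ :=
  ∫ᵛ x : ℝ, (y - x)⁻¹ ∂<•s

/-- The product measure `⟨α, β⟩` of a Nikishin system: the measure `α` multiplied by the weight
`y ↦ ∫ dβ(x) / (y - x)`. -/
def nikishinProduct (α β : SignedMeasure ℝ) : SignedMeasure ℝ :=
  α.withDensity (realCauchyTransform β) (ContinuousLinearMap.lsmul ℝ ℝ).flip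

/-- The hypotheses under which `σ` generates a Nikishin system. -/
structure GeneratesNikishin {m : ℕ} (σ : Fin m → SignedMeasure ℝ) : Prop where
  markov : ∀ j, IsMarkovMeasure (σ j)
  disjoint_consecutive : ∀ i j : Fin m, (j : ℕ) = i + 1 →
    Disjoint (suppHull (σ i)) (suppHull (σ j))

/-- The Nikishin system `(s₁, …, sₘ)` of measures generated by `(σ₁, …, σₘ)`: the first measure is
`σ₁`, and the others are `⟨σ₁, t⟩`, where `t` runs through the Nikishin system generated by
`(σ₂, …, σₘ)`. (Indices are shifted by one, so that they start at `0`.) -/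
def nikishinSystem : {m : ℕ} → (Fin m → SignedMeasure ℝ) → Fin m → SignedMeasure ℝ
  | 0, _ => fun k => k.elim0
  | _ + 1, σ =>
    Fin.cons (σ 0) (fun k => nikishinProduct (σ 0) (nikishinSystem (Fin.tail σ) k))

/-- `u` is an AT-system on `Δ` for the multi-index `n`: the functions are continuous on `Δ` and every
combination `∑ pₖ uₖ` with real polynomials `pₖ`, not all zero, with `deg pₖ ≤ nₖ - 1` (so that
`pₖ = 0` if `nₖ = 0`) has at most `|n| - 1` zeros on `Δ`. -/
def IsATSystemFor {ι : Type*} [Fintype ι] (u : ι → ℝ → ℝ) (Δ : Set ℝ) (n : ι → ℕ) : Prop :=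
  (∀ k, ContinuousOn (u k) Δ) ∧
  ∀ p : ι → ℝ[X], (∀ k, (p k).degree < n k) → p ≠ 0 →
    {x ∈ Δ | ∑ k, (p k).eval x * u k x = 0}.encard < ((∑ k, n k : ℕ) : ℕ∞)

/-- An AT-system on `Δ`: an AT-system for all multi-indices. -/
def IsATSystem {ι : Type*} [Fintype ι] (u : ι → ℝ → ℝ) (Δ : Set ℝ) : Prop :=
  ∀ n : ι → ℕ, IsATSystemFor u Δ n

/-- The linear form `p₀ + ∑ pₖ ŝₖ` on the complex plane. -/
def linearForm {m : ℕ} (s : Fin m → SignedMeasure ℝ) (p : Fin (m + 1) → ℝ[X]) (z : ℂ) : ℂ :=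
  aeval z (p 0) + ∑ k : Fin m, aeval z (p k.succ) * cauchyTransform (s k) z

/-- `f` is analytic at all points of `U` and the number of its zeros in `U`, counted with
multiplicity, is less than `N`. -/
def HasFewerZerosThan (f : ℂ → ℂ) (U : Set ℂ) (N : ℕ) : Prop :=
  AnalyticOnNhd ℂ f U ∧
  ∀ T : Finset ℂ, (T : Set ℂ) ⊆ U → ∑ z ∈ T, analyticOrderAt f z < (N : ℕ∞)

end

open scoped Topology
open Filter

/-! Up to nonzero real factors, which the polynomial coefficients absorb, the functions of the
system are `nikishinFun μ k` for positive measures μ₀, μ₁, … on compact intervals K₀, K₁, …,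
consecutive ones being disjoint. It remains to bound the zeros off K₀ of real polynomial
combinations of these functions.

The counting rests on orthogonality (`fewZeros_add_cauchy`). Let deg Q < n, let G have fewer than R
zeros, and let w be a real polynomial dividing Q + s ∫ G dμ/(z - x). A polynomial q of degree less
than R removes the sign changes of G on K. If deg w ≥ n + R, comparing polynomial parts at infinity
gives ∫ qG/w dμ = 0, which is absurd for a density of constant sign. A linear form is brought to
this shape by dividing it by one of its functions u_j (`fewZeros_step`): if every u_k/u_j is an
affine function plus the Cauchy transform of g_k dω, with ω independent of k, then G is a linear
form in the g_k with k ≠ j, and one function has disappeared.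

The choice of j depends on the degrees, so a class of functions closed under all such divisions is
needed. It consists of the minors, on the first q rows and any q columns, of the unitriangular
matrix whose row i holds the Nikishin system of μ_i, μ_{i+1}, …. By `regularSystem`, such a minor
continues analytically to the complement of K_{q-1}, has no zeros there and has a known order at
infinity. Moreover, the quotient of the minors on S ∪ {k} and S ∪ {j} is affine plus a Cauchy
transform whose density is the minor on S ∪ {j, k}. Hence `RegularSystem.atFamily` follows by
induction on the number of functions; S = ∅ is the required bound.

The regularity of the minors is proved by induction on the number of available columns, passing to
the chain without μ₀. Column 0 is a unit vector, so minors that use it are minors of the tail. For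
the others, Sylvester's identity and a divided difference computation with Fubini
(`exists_pair_formula`) express a minor as a tail minor times a constant plus a Cauchy transform.
That this factor has no real zeros off its cut follows from the zero bound, already known for the
tail, for two functions. The quotients require that 1/(c + μ̂) be affine minus the Cauchy transform
of a positive measure (`Carried.exists_inverse`); this measure comes from the spectral measure of a
rank one perturbation of multiplication by x. -/

/-- The complement in the complex plane of a set of real points. -/
def offCut (K : Set ℝ) : Set ℂ := (Complex.ofReal '' K)ᶜ

/-- `μ` is a finite measure that vanishes outside the compact set `K`. -/
structure SupportedOn (μ : Measure ℝ) (K : Set ℝ) : Prop where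
  compact : IsCompact K
  finite : IsFiniteMeasure μ
  null : μ Kᶜ = 0

/-- `μ` is a finite measure on the compact interval `K` that no finite set carries. -/
structure Carried (μ : Measure ℝ) (K : Set ℝ) : Prop extends SupportedOn μ K where
  ordConnected : K.OrdConnected
  infinite : ∀ s : Finset ℝ, μ (↑s)ᶜ ≠ 0

/-- The Cauchy transform of the complex measure with density `φ` with respect to `μ`. -/
noncomputable def cauchy (φ : ℝ → ℂ) (μ : Measure ℝ) (z : ℂ) : ℂ := ∫ x, φ x / (z - x) ∂μ

theorem mem_offCut_ofReal {K : Set ℝ} {x : ℝ} : (x : ℂ) ∈ offCut K ↔ x ∉ K := by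
  simp [offCut]

theorem mem_offCut_of_im_ne_zero {K : Set ℝ} {z : ℂ} (hz : z.im ≠ 0) : z ∈ offCut K := by
  rintro ⟨x, -, rfl⟩
  simp at hz

theorem sub_ne_zero_of_mem_offCut {K : Set ℝ} {z : ℂ} (hz : z ∈ offCut K) {x : ℝ} (hx : x ∈ K) :
    z - x ≠ 0 := by
  intro h
  exact hz ⟨x, hx, (sub_eq_zero.1 h).symm⟩

theorem conj_mem_offCut {K : Set ℝ} {z : ℂ} (hz : z ∈ offCut K) : (starRingEnd ℂ) z ∈ offCut K := by
  rintro ⟨x, hx, h⟩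
  refine hz ⟨x, hx, ?_⟩
  have := congrArg (starRingEnd ℂ) h
  simpa using this

theorem isOpen_offCut {K : Set ℝ} (hK : IsCompact K) : IsOpen (offCut K) :=
  (hK.image Complex.continuous_ofReal).isClosed.isOpen_compl

theorem offCut_mono {K L : Set ℝ} (h : K ⊆ L) : offCut L ⊆ offCut K :=
  Set.compl_subset_compl.2 (Set.image_mono h)

/-! ### Cauchy transforms of measures on compact sets -/

namespace SupportedOn

variable {μ ν : Measure ℝ} {K L : Set ℝ}

theorem restrict_eq (h : SupportedOn μ K) : μ.restrict K = μ :=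
  Measure.restrict_eq_self_of_ae_mem (by rw [ae_iff]; exact h.null)

theorem ae_mem (h : SupportedOn μ K) : ∀ᵐ x ∂μ, x ∈ K := by
  rw [ae_iff]; exact h.null

theorem integrable (h : SupportedOn μ K) {E : Type*} [NormedAddCommGroup E] {f : ℝ → E}
    (hf : ContinuousOn f K) : Integrable f μ := by
  have := h.finite
  have := hf.integrableOn_compact (μ := μ) h.compact
  rwa [IntegrableOn, h.restrict_eq] at this

theorem integral_congr (h : SupportedOn μ K) {E : Type*} [NormedAddCommGroup E] [NormedSpace ℝ E]
    {f g : ℝ → E} (hfg : ∀ x ∈ K, f x = g x) : ∫ x, f x ∂μ = ∫ x, g x ∂μ :=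
  integral_congr_ae (h.ae_mem.mono hfg)

theorem _root_.continuousOn_kernel {K : Set ℝ} {z : ℂ} (hz : z ∈ offCut K) {φ : ℝ → ℂ} (hφ : ContinuousOn φ K) :
    ContinuousOn (fun x : ℝ => φ x / (z - x)) K :=
  hφ.div (by fun_prop) fun _ hx => sub_ne_zero_of_mem_offCut hz hx

theorem exists_bound (h : SupportedOn μ K) {φ : ℝ → ℂ} (hφ : ContinuousOn φ K) :
    ∃ C, 0 ≤ C ∧ ∀ x ∈ K, ‖φ x‖ ≤ C := by
  obtain ⟨C, hC⟩ := h.compact.exists_bound_of_continuousOn hφ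
  exact ⟨max C 0, le_max_right _ _, fun x hx => (hC x hx).trans (le_max_left _ _)⟩

theorem differentiableAt_cauchy (h : SupportedOn μ K) {φ : ℝ → ℂ} (hφ : ContinuousOn φ K) {z : ℂ}
    (hz : z ∈ offCut K) : DifferentiableAt ℂ (cauchy φ μ) z := by
  obtain ⟨ε, hε, hball⟩ := Metric.isOpen_iff.1 (isOpen_offCut h.compact) z hz
  obtain ⟨C, hC0, hC⟩ := h.exists_bound hφ
  have := h.finite
  have hmeas : ∀ w ∈ offCut K, AEStronglyMeasurable (fun x : ℝ => φ x / (w - x)) μ := fun w hw =>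
    (h.integrable (continuousOn_kernel hw hφ)).aestronglyMeasurable
  have hdist : ∀ w ∈ Metric.ball z (ε / 2), ∀ x ∈ K, ε / 2 ≤ ‖w - (x : ℂ)‖ := by
    intro w hw x hx
    by_contra hlt
    push Not at hlt
    have : (x : ℂ) ∈ Metric.ball z ε := by
      rw [Metric.mem_ball, dist_eq_norm] at hw ⊢
      calc ‖(x : ℂ) - z‖ = ‖(w - z) - (w - x)‖ := by ring_nf
        _ ≤ ‖w - z‖ + ‖w - x‖ := norm_sub_le _ _
        _ < ε := by linarith
    exact hball this ⟨x, hx, rfl⟩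
  have key := hasDerivAt_integral_of_dominated_loc_of_deriv_le (μ := μ) (𝕜 := ℂ)
    (F := fun w x => φ x / (w - (x : ℂ))) (F' := fun w x => - φ x / (w - (x : ℂ)) ^ 2)
    (x₀ := z) (s := Metric.ball z (ε / 2)) (bound := fun _ => C / (ε / 2) ^ 2)
    (Metric.ball_mem_nhds z (by positivity)) ?_ (h.integrable (continuousOn_kernel hz hφ)) ?_ ?_ ?_ ?_
  · exact key.2.differentiableAt
  · filter_upwards [(isOpen_offCut h.compact).mem_nhds hz] with w hw using hmeas w hw
  · refine (h.integrable (?_ : ContinuousOn _ K)).aestronglyMeasurable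
    refine hφ.neg.div (by fun_prop) fun x hx => pow_ne_zero _ (sub_ne_zero_of_mem_offCut hz hx)
  · filter_upwards [h.ae_mem] with x hx w hw
    rw [norm_div, norm_neg, norm_pow]
    have := hdist w hw x hx
    gcongr
    exact hC x hx
  · exact integrable_const _
  · filter_upwards [h.ae_mem] with x hx w hw
    have hne : w - (x : ℂ) ≠ 0 := by
      intro h0
      have := hdist w hw x hx
      rw [h0, norm_zero] at this
      linarith
    have := (hasDerivAt_const w (φ x)).div ((hasDerivAt_id w).sub_const (x : ℂ)) hne
    refine HasDerivAt.congr_deriv this ?_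
    simp

theorem analyticOnNhd_cauchy (h : SupportedOn μ K) {φ : ℝ → ℂ} (hφ : ContinuousOn φ K) :
    AnalyticOnNhd ℂ (cauchy φ μ) (offCut K) := by
  refine DifferentiableOn.analyticOnNhd ?_ (isOpen_offCut h.compact)
  exact fun z hz => (h.differentiableAt_cauchy hφ hz).differentiableWithinAt

theorem continuousOn_cauchy (h : SupportedOn μ K) {φ : ℝ → ℂ} (hφ : ContinuousOn φ K) :
    ContinuousOn (cauchy φ μ) (offCut K) :=
  (h.analyticOnNhd_cauchy hφ).continuousOn

theorem cauchy_conj (h : SupportedOn μ K) {φ : ℝ → ℂ} (hφ : ∀ x ∈ K, (φ x).im = 0) (z : ℂ) :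
    cauchy φ μ ((starRingEnd ℂ) z) = (starRingEnd ℂ) (cauchy φ μ z) := by
  rw [cauchy, cauchy, ← integral_conj]
  refine h.integral_congr fun x hx => ?_
  rw [map_div₀, map_sub, Complex.conj_ofReal, Complex.conj_eq_iff_im.2 (hφ x hx)]

theorem cauchy_add (h : SupportedOn μ K) {φ ψ : ℝ → ℂ} (hφ : ContinuousOn φ K) (hψ : ContinuousOn ψ K)
    {z : ℂ} (hz : z ∈ offCut K) :
    cauchy (fun x => φ x + ψ x) μ z = cauchy φ μ z + cauchy ψ μ z := by
  simp only [cauchy]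
  rw [← integral_add (h.integrable (continuousOn_kernel hz hφ))
    (h.integrable (continuousOn_kernel hz hψ))]
  simp only [add_div]

theorem cauchy_congr (h : SupportedOn μ K) {φ ψ : ℝ → ℂ} (hφ : ∀ x ∈ K, φ x = ψ x) (z : ℂ) :
    cauchy φ μ z = cauchy ψ μ z :=
  h.integral_congr fun x hx => by rw [hφ x hx]

theorem _root_.cauchy_const_mul (φ : ℝ → ℂ) (μ : Measure ℝ) (c z : ℂ) :
    cauchy (fun x => c * φ x) μ z = c * cauchy φ μ z := by
  simp only [cauchy, mul_div_assoc]
  exact integral_const_mul c _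

/-- This is z/(z - x) = 1 + x/(z - x) under the integral. It yields both the expansion at infinity
and the division of Cauchy transforms by polynomials. -/
theorem mul_cauchy (h : SupportedOn μ K) {φ : ℝ → ℂ} (hφ : ContinuousOn φ K) {z : ℂ}
    (hz : z ∈ offCut K) :
    z * cauchy φ μ z = cauchy (fun x => x * φ x) μ z + ∫ x, φ x ∂μ := by
  have h1 : ContinuousOn (fun x : ℝ => (x : ℂ) * φ x) K :=
    Complex.continuous_ofReal.continuousOn.mul hφ
  simp only [cauchy]
  rw [← integral_add (h.integrable (continuousOn_kernel hz h1)) (h.integrable hφ),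
    ← integral_const_mul]
  refine h.integral_congr fun x hx => ?_
  have := sub_ne_zero_of_mem_offCut hz hx
  field_simp
  ring

theorem norm_cauchy_le (h : SupportedOn μ K) {φ : ℝ → ℂ} {B C : ℝ} (hC : ∀ x ∈ K, ‖φ x‖ ≤ C) (hC0 : 0 ≤ C)
    (hB : ∀ x ∈ K, |x| ≤ B) {z : ℂ} (hz : B < ‖z‖) :
    ‖cauchy φ μ z‖ ≤ C / (‖z‖ - B) * μ.real Set.univ := by
  have := h.finite
  refine norm_integral_le_of_norm_le_const ?_
  filter_upwards [h.ae_mem] with x hx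
  rw [norm_div]
  have : ‖z‖ - B ≤ ‖z - x‖ := by
    have h1 := norm_sub_norm_le z (x : ℂ)
    have h2 := hB x hx
    rw [Complex.norm_real, Real.norm_eq_abs] at h1
    linarith
  have h3 : 0 < ‖z‖ - B := by linarith
  gcongr
  exact hC x hx

theorem tendsto_cauchy (h : SupportedOn μ K) {φ : ℝ → ℂ} (hφ : ContinuousOn φ K) :
    Tendsto (cauchy φ μ) (Bornology.cobounded ℂ) (𝓝 0) := by
  obtain ⟨C, hC0, hC⟩ := h.exists_bound hφ
  obtain ⟨B, hB⟩ := h.compact.isBounded.exists_norm_le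
  rw [tendsto_zero_iff_norm_tendsto_zero]
  have h1 : Tendsto (fun z : ℂ => ‖z‖ - B) (Bornology.cobounded ℂ) atTop :=
    tendsto_atTop_add_const_right _ _ tendsto_norm_cobounded_atTop
  have h2 : Tendsto (fun z : ℂ => C / (‖z‖ - B) * μ.real Set.univ) (Bornology.cobounded ℂ) (𝓝 0) := by
    have := (h1.const_div_atTop C).mul_const (μ.real Set.univ)
    simpa using this
  refine squeeze_zero' (Eventually.of_forall fun _ => norm_nonneg _) ?_ h2
  filter_upwards [tendsto_norm_cobounded_atTop.eventually_gt_atTop B] with z hz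
  exact h.norm_cauchy_le hC hC0 (fun x hx => hB x hx) hz

theorem eventually_mem_offCut (h : SupportedOn μ K) : ∀ᶠ z in Bornology.cobounded ℂ, z ∈ offCut K :=
  Bornology.isBounded_def.1 (h.compact.image Complex.continuous_ofReal).isBounded

theorem tendsto_mul_cauchy (h : SupportedOn μ K) {φ : ℝ → ℂ} (hφ : ContinuousOn φ K) :
    Tendsto (fun z => z * cauchy φ μ z) (Bornology.cobounded ℂ) (𝓝 (∫ x, φ x ∂μ)) := by
  have h1 : ContinuousOn (fun x : ℝ => (x : ℂ) * φ x) K :=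
    Complex.continuous_ofReal.continuousOn.mul hφ
  have := (h.tendsto_cauchy h1).add_const (∫ x, φ x ∂μ)
  rw [zero_add] at this
  refine this.congr' ?_
  filter_upwards [h.eventually_mem_offCut] with z hz
  rw [h.mul_cauchy hφ hz]

theorem integral_im_eq_zero (h : SupportedOn μ K) {φ : ℝ → ℂ}
    (hre : ∀ x ∈ K, (φ x).im = 0) : (∫ x, φ x ∂μ).im = 0 := by
  rw [← Complex.conj_eq_iff_im, ← integral_conj]
  exact h.integral_congr fun x hx => Complex.conj_eq_iff_im.2 (hre x hx)

theorem integral_swap (h : SupportedOn μ K) (h' : SupportedOn ν L) {f : ℝ → ℝ → ℂ}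
    (hf : ContinuousOn (Function.uncurry f) (K ×ˢ L)) :
    ∫ x, ∫ y, f x y ∂ν ∂μ = ∫ y, ∫ x, f x y ∂μ ∂ν := by
  have := h.finite
  have := h'.finite
  refine integral_integral_swap ?_
  have h1 : (μ.prod ν).restrict (K ×ˢ L) = μ.prod ν := by
    rw [← Measure.prod_restrict, h.restrict_eq, h'.restrict_eq]
  have := hf.integrableOn_compact (μ := μ.prod ν) (h.compact.prod h'.compact)
  rwa [IntegrableOn, h1] at this

/-- Multiplication of a measure by a continuous nonnegative density. -/
theorem exists_withDensity (h : SupportedOn μ K) {ρ : ℝ → ℝ} (hρ : ContinuousOn ρ K)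
    (hpos : ∀ x ∈ K, 0 ≤ ρ x) :
    ∃ μ' : Measure ℝ, SupportedOn μ' K ∧ (∀ f : ℝ → ℂ, ∫ x, f x ∂μ' = ∫ x, ρ x * f x ∂μ) ∧
      ∀ s, μ' s = 0 → μ ({x | ρ x ≠ 0} ∩ s) = 0 := by
  have := h.finite
  have hae : AEMeasurable (fun x => (ρ x).toNNReal) μ :=
    ((h.integrable hρ).aestronglyMeasurable.aemeasurable).real_toNNReal
  refine ⟨μ.withDensity fun x => ((ρ x).toNNReal : ENNReal), ⟨h.compact, ?_, ?_⟩,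
    fun f => ?_, fun s hs => ?_⟩
  · refine isFiniteMeasure_withDensity ?_
    have := (h.integrable hρ).2
    rw [HasFiniteIntegral] at this
    refine (lt_of_le_of_lt (lintegral_mono fun x => ?_) this).ne
    change ENNReal.ofReal (ρ x) ≤ _
    exact Real.ofReal_le_enorm _
  · exact withDensity_absolutelyContinuous _ _ h.null
  · rw [integral_withDensity_eq_integral_smul₀ hae]
    refine h.integral_congr fun x hx => ?_
    rw [NNReal.smul_def, Real.coe_toNNReal _ (hpos x hx)]
    simp
  · rw [withDensity_apply_eq_zero' (by exact hae.coe_nnreal_ennreal)] at hs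
    refine measure_mono_null (fun x hx => ?_) (measure_union_null hs h.null)
    by_cases hK : x ∈ K
    · refine Or.inl ⟨?_, hx.2⟩
      have := lt_of_le_of_ne (hpos x hK) (Ne.symm hx.1)
      simpa using this
    · exact Or.inr hK

end SupportedOn

/-! ### Sign arguments for measures with infinite support -/

namespace Carried

variable {μ ν : Measure ℝ} {K L : Set ℝ}

theorem ne_zero (h : Carried μ K) : μ ≠ 0 := by
  rintro rfl
  simpa using h.infinite ∅

theorem nonempty (h : Carried μ K) : K.Nonempty := by
  by_contra hK
  rw [Set.not_nonempty_iff_eq_empty] at hK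
  have := h.null
  rw [hK, Set.compl_empty] at this
  exact h.ne_zero (Measure.measure_univ_eq_zero.1 this)

/-- The finite set `s` of permitted zeros cannot carry `μ`, which is the only way the infinite
support enters. It is needed because the densities that occur are positive only away from the roots
of a polynomial. -/
theorem integral_pos_of_pos (h : Carried μ K) {f : ℝ → ℝ} (hf : ContinuousOn f K)
    (s : Finset ℝ) (h0 : ∀ x ∈ K, 0 ≤ f x) (hpos : ∀ x ∈ K, x ∉ s → f x ≠ 0) : 0 < ∫ x, f x ∂μ := by
  rw [integral_pos_iff_support_of_nonneg_ae]
  · refine pos_iff_ne_zero.2 fun h1 => h.infinite s ?_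
    have h2 : μ (Function.support f ∪ Kᶜ) = 0 := measure_union_null h1 h.null
    refine measure_mono_null (fun x hx => ?_) h2
    by_cases hK : x ∈ K
    · exact Or.inl (hpos x hK hx)
    · exact Or.inr hK
  · filter_upwards [h.ae_mem] with x hx using h0 x hx
  · exact h.integrable hf

theorem exists_sign (hK : K.OrdConnected) {φ : ℝ → ℂ} (hφ : ContinuousOn φ K)
    (hre : ∀ x ∈ K, (φ x).im = 0) (h0 : ∀ x ∈ K, φ x ≠ 0) :
    ∃ s : ℝ, (s = 1 ∨ s = -1) ∧ ∀ x ∈ K, φ x = s * ‖φ x‖ := by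
  have hc : ContinuousOn (fun x => (φ x).re) K := Complex.continuous_re.comp_continuousOn hφ
  have hne : ∀ x ∈ K, (φ x).re ≠ 0 := fun x hx h => h0 x hx (Complex.ext h (hre x hx))
  have habs : ∀ x ∈ K, φ x = (φ x).re ∧ ‖φ x‖ = |(φ x).re| := fun x hx => by
    have : φ x = (φ x).re := Complex.ext rfl (by simpa using hre x hx)
    refine ⟨this, ?_⟩
    conv_lhs => rw [this]
    rw [Complex.norm_real, Real.norm_eq_abs]
  have hsign : (∀ x ∈ K, 0 < (φ x).re) ∨ (∀ x ∈ K, (φ x).re < 0) := by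
    by_contra hcon
    push Not at hcon
    obtain ⟨⟨x, hx, hx0⟩, y, hy, hy0⟩ := hcon
    obtain ⟨c, hc1, hc2⟩ := hK.isPreconnected.intermediate_value hx hy hc ⟨hx0, hy0⟩
    exact hne c hc1 hc2
  rcases hsign with hs | hs
  · refine ⟨1, Or.inl rfl, fun x hx => ?_⟩
    rw [(habs x hx).2, abs_of_pos (hs x hx)]
    simpa using (habs x hx).1
  · refine ⟨-1, Or.inr rfl, fun x hx => ?_⟩
    rw [(habs x hx).2, abs_of_neg (hs x hx)]
    simpa using (habs x hx).1

/-- Im 1/(z - x) = -Im z/|z - x|² has the same sign for all x, and `φ` has constant sign on the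
interval, so nothing cancels. -/
theorem im_cauchy_ne_zero (h : Carried μ K) {φ : ℝ → ℂ} (hφ : ContinuousOn φ K)
    (hre : ∀ x ∈ K, (φ x).im = 0) (h0 : ∀ x ∈ K, φ x ≠ 0) {z : ℂ} (hz : z.im ≠ 0) :
    (cauchy φ μ z).im ≠ 0 := by
  obtain ⟨s, hs, hφs⟩ := exists_sign h.ordConnected hφ hre h0
  have hzK : z ∈ offCut K := mem_offCut_of_im_ne_zero hz
  have hpos : 0 < ∫ x, ‖φ x‖ / Complex.normSq (z - x) ∂μ := by
    refine h.integral_pos_of_pos ?_ ∅ (fun x _ => div_nonneg (norm_nonneg _) (Complex.normSq_nonneg _)) fun x hx _ => ?_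
    · refine hφ.norm.div ?_ fun x hx => ?_
      · exact (Complex.continuous_normSq.comp (by fun_prop)).continuousOn
      · simpa using sub_ne_zero_of_mem_offCut hzK hx
    · refine div_ne_zero (by simpa using h0 x hx) ?_
      simpa using sub_ne_zero_of_mem_offCut hzK hx
  have heq : (cauchy φ μ z).im = (-s * z.im) * ∫ x, ‖φ x‖ / Complex.normSq (z - x) ∂μ := by
    have h1 : (cauchy φ μ z).im = ∫ x, (φ x / (z - x)).im ∂μ :=
      (integral_im (𝕜 := ℂ) (h.integrable (continuousOn_kernel hzK hφ))).symm
    rw [h1, ← integral_const_mul]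
    refine h.integral_congr fun x hx => ?_
    rw [hφs x hx, Complex.div_im]
    simp
    rcases hs with rfl | rfl <;> simp <;> ring
  rw [heq]
  have : s ≠ 0 := by rcases hs with rfl | rfl <;> norm_num
  exact mul_ne_zero (mul_ne_zero (neg_ne_zero.2 this) hz) hpos.ne'

theorem integral_ne_zero (h : Carried μ K) {φ : ℝ → ℂ} (hφ : ContinuousOn φ K)
    (hre : ∀ x ∈ K, (φ x).im = 0) (h0 : ∀ x ∈ K, φ x ≠ 0) : ∫ x, φ x ∂μ ≠ 0 := by
  obtain ⟨s, hs, hφs⟩ := exists_sign h.ordConnected hφ hre h0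
  have hpos : 0 < ∫ x, ‖φ x‖ ∂μ :=
    h.integral_pos_of_pos hφ.norm ∅ (fun x _ => norm_nonneg _) fun x hx _ => by simpa using h0 x hx
  rw [h.integral_congr hφs, integral_const_mul, integral_complex_ofReal]
  refine mul_ne_zero ?_ (by exact_mod_cast hpos.ne')
  rcases hs with rfl | rfl <;> norm_num

theorem exists_withDensity (h : Carried μ K) {ρ : ℝ → ℝ} (hρ : ContinuousOn ρ K)
    (hpos : ∀ x ∈ K, 0 < ρ x) :
    ∃ μ' : Measure ℝ, Carried μ' K ∧ ∀ f : ℝ → ℂ, ∫ x, f x ∂μ' = ∫ x, ρ x * f x ∂μ := by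
  obtain ⟨μ', h', hint, hnull⟩ :=
    h.toSupportedOn.exists_withDensity hρ fun x hx => (hpos x hx).le
  refine ⟨μ', ⟨h', h.ordConnected, fun s hs => h.infinite s ?_⟩, hint⟩
  refine measure_mono_null (fun x hx => ?_) (measure_union_null (hnull _ hs) h.null)
  by_cases hK : x ∈ K
  · exact Or.inl ⟨(hpos x hK).ne', hx⟩
  · exact Or.inr hK

end Carried

/-! ### Spectral measures, multiplication operators and rank one perturbations -/

section Spectral

open scoped InnerProductSpace CompactlySupported

variable {E : Type*} [NormedAddCommGroup E] [InnerProductSpace ℂ E] [CompleteSpace E]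

/-- A self-adjoint operator whose spectrum is contained in the compact set `K ⊆ ℝ` has a spectral
measure on `K` at every vector. -/
theorem exists_spectral_measure (B : E →L[ℂ] E) (hB : IsSelfAdjoint B) (e : E) {K : Set ℝ}
    (hK : IsCompact K) (hspec : spectrum ℂ B ⊆ Complex.ofReal '' K) :
    ∃ τ : Measure ℝ, IsFiniteMeasure τ ∧ τ Kᶜ = 0 ∧ ∀ z ∈ offCut K, ∀ R : E →L[ℂ] E,
      (algebraMap ℂ (E →L[ℂ] E) z - B) * R = 1 → inner ℂ e (R e) = cauchy (fun _ => 1) τ z := by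
  have hn : IsStarNormal B := hB.isStarNormal
  let X := spectrum ℂ B
  let ψ : C(X, ℂ) →⋆ₐ[ℂ] (E →L[ℂ] E) := cfcHom (R := ℂ) (a := B) hn
  let ι : C(X, ℝ) → C(X, ℂ) := fun f => ⟨fun x => (f x : ℂ), by fun_prop⟩
  have hreal : ∀ f : C(X, ℝ), (inner ℂ e (ψ (ι f) e)).im = 0 := by
    intro f
    have h1 : star (ι f) = ι f := by ext x; simp [ι]
    have h2 : star (ψ (ι f)) = ψ (ι f) := by rw [← map_star, h1]
    rw [← Complex.conj_eq_iff_im, inner_conj_symm]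
    have h3 := ContinuousLinearMap.adjoint_inner_left (ψ (ι f)) e e
    rwa [← ContinuousLinearMap.star_eq_adjoint, h2] at h3
  have hpos : ∀ f : C(X, ℝ), 0 ≤ f → 0 ≤ (inner ℂ e (ψ (ι f) e)).re := by
    intro f hf
    -- With a continuous square root, the quadratic form of `f` at `e` becomes the squared norm of
    -- the vector `ψ (ι g) e`.
    let g : C(X, ℝ) := ⟨fun x => √(f x), by fun_prop⟩
    have h1 : ι f = star (ι g) * ι g := by
      ext x
      simp only [ι, g, ContinuousMap.mul_apply, ContinuousMap.star_apply, ContinuousMap.coe_mk]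
      rw [Complex.star_def, Complex.conj_ofReal, ← Complex.ofReal_mul, Real.mul_self_sqrt (show 0 ≤ f x from hf x)]
    have h2 : ψ (ι f) = star (ψ (ι g)) * ψ (ι g) := by rw [h1, map_mul, map_star]
    rw [h2, mul_apply_eq_comp, ContinuousLinearMap.star_eq_adjoint,
      ContinuousLinearMap.adjoint_inner_right]
    exact inner_self_nonneg (𝕜 := ℂ)
  have hadd : ∀ f g : C(X, ℝ), ι (f + g) = ι f + ι g := fun f g => by ext x; simp [ι]
  have hsmul : ∀ (c : ℝ) (f : C(X, ℝ)), ι (c • f) = (c : ℂ) • ι f := fun c f => by ext x; simp [ι]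
  let Λ₀ : C_c(X, ℝ) →ₗ[ℝ] ℝ :=
    { toFun := fun f => (inner ℂ e (ψ (ι f.toContinuousMap) e)).re
      map_add' := fun f g => by
        have : ι (f + g).toContinuousMap = ι f.toContinuousMap + ι g.toContinuousMap := hadd _ _
        rw [this, map_add, _root_.add_apply, inner_add_right, Complex.add_re]
      map_smul' := fun c f => by
        have : ι (c • f).toContinuousMap = (c : ℂ) • ι f.toContinuousMap := hsmul _ _
        rw [this, map_smul, _root_.smul_apply, inner_smul_right]
        simp }
  let Λ : C_c(X, ℝ) →ₚ[ℝ] ℝ := PositiveLinearMap.mk₀ Λ₀ fun f hf => hpos _ hf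
  -- Riesz–Markov turns the positive functional f ↦ ⟨e, f(B)e⟩ into the spectral measure on the
  -- spectrum.
  let ρ : Measure X := RealRMK.rieszMeasure Λ
  have hρ : ∀ f : C(X, ℝ), ((∫ x, f x ∂ρ : ℝ) : ℂ) = inner ℂ e (ψ (ι f) e) := by
    intro f
    have h1 := RealRMK.integral_rieszMeasure Λ (CompactlySupportedContinuousMap.continuousMapEquiv f)
    have h2 : ∫ x, f x ∂ρ = (inner ℂ e (ψ (ι f) e)).re := h1
    rw [h2]
    exact Complex.ext rfl (by simpa using (hreal f).symm)
  have hfin : IsFiniteMeasure ρ := by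
    have : IsFiniteMeasureOnCompacts ρ := by
      refine ⟨fun s hs => ?_⟩
      refine lt_of_le_of_lt (RealRMK.rieszMeasure_le_of_eq_one Λ
        (f := CompactlySupportedContinuousMap.continuousMapEquiv (1 : C(X, ℝ)))
        (fun _ => zero_le_one) hs fun _ _ => rfl) ENNReal.ofReal_lt_top
    exact ⟨isCompact_univ.measure_lt_top⟩
  have hXK : ∀ x : X, (x : ℂ).re ∈ K ∧ ((x : ℂ).re : ℂ) = x := by
    intro x
    obtain ⟨y, hy, hyx⟩ := hspec x.2
    rw [← hyx]
    exact ⟨by simpa using hy, by simp⟩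
  have hmeas : Measurable fun x : X => (x : ℂ).re := by fun_prop
  refine ⟨ρ.map fun x : X => (x : ℂ).re, inferInstance, ?_, ?_⟩
  · rw [Measure.map_apply hmeas hK.measurableSet.compl]
    convert measure_empty (μ := ρ)
    ext x
    simpa using (hXK x).1
  · intro z hz R hR
    have hne : ∀ x : X, z - (x : ℂ) ≠ 0 := fun x => by
      rw [← (hXK x).2]; exact sub_ne_zero_of_mem_offCut hz (hXK x).1
    let F : C(X, ℂ) := ⟨fun x => 1 / (z - x), by
      exact continuous_const.div (by fun_prop) hne⟩
    -- A left inverse and a right inverse coincide, so `R` is the functional calculus of 1/(z - x).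
    have hF : ψ F = R := by
      have h1 : F * (algebraMap ℂ C(X, ℂ) z - (ContinuousMap.id ℂ).restrict X) = 1 := by
        ext x
        simp [F, hne x]
      have h2 : ψ F * (algebraMap ℂ (E →L[ℂ] E) z - B) = 1 := by
        have := congrArg ψ h1
        rw [map_mul, map_sub, map_one, AlgHomClass.commutes] at this
        rwa [show ψ ((ContinuousMap.id ℂ).restrict X) = B from cfcHom_id hn] at this
      calc ψ F = ψ F * ((algebraMap ℂ (E →L[ℂ] E) z - B) * R) := by rw [hR, mul_one]
        _ = R := by rw [← mul_assoc, h2, one_mul]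
    let F₁ : C(X, ℝ) := ⟨fun x => (F x).re, by fun_prop⟩
    let F₂ : C(X, ℝ) := ⟨fun x => (F x).im, by fun_prop⟩
    have hF12 : F = ι F₁ + Complex.I • ι F₂ := by
      ext x
      simp only [ι, F₁, F₂, ContinuousMap.add_apply, ContinuousMap.smul_apply,
        ContinuousMap.coe_mk, smul_eq_mul]
      rw [mul_comm, Complex.re_add_im]
    have hint : ∀ f : C(X, ℝ), Integrable f ρ := fun f => f.continuous.integrable_of_hasCompactSupport
      (HasCompactSupport.of_compactSpace _)
    rw [← hF, hF12, map_add, map_smul, _root_.add_apply, _root_.smul_apply,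
      inner_add_right, inner_smul_right, ← hρ, ← hρ, cauchy, integral_map]
    · have h1 : ∀ x : X, (1 : ℂ) / (z - (((x : ℂ).re : ℝ) : ℂ)) = (F₁ x : ℂ) + Complex.I * (F₂ x : ℂ) := by
        intro x
        rw [(hXK x).2, mul_comm]
        exact (Complex.re_add_im (F x)).symm
      simp_rw [h1]
      rw [integral_add, integral_const_mul, integral_complex_ofReal, integral_complex_ofReal]
      · exact (hint F₁).ofReal
      · exact (hint F₂).ofReal.const_mul _
    · exact hmeas.aemeasurable
    · exact Measurable.aestronglyMeasurable (by fun_prop)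

open scoped ComplexOrder in
/-- Multiplication by the variable on the Hilbert space of a measure: a self-adjoint operator `X`
and a vector `e` for which the resolvent of `X` at `e` is the Cauchy transform. -/
theorem exists_multiplication_operator {μ : Measure ℝ} {K : Set ℝ} (h : SupportedOn μ K) :
    ∃ (E : Type) (_ : NormedAddCommGroup E) (_ : InnerProductSpace ℂ E) (_ : CompleteSpace E)
      (X : E →L[ℂ] E) (e : E), IsSelfAdjoint X ∧ ∀ z ∈ offCut K, ∃ R : E →L[ℂ] E,
        (algebraMap ℂ (E →L[ℂ] E) z - X) * R = 1 ∧ R * (algebraMap ℂ (E →L[ℂ] E) z - X) = 1 ∧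
        inner ℂ e (R e) = cauchy (fun _ => 1) μ z := by
  have := h.finite
  have : CompactSpace K := isCompact_iff_compactSpace.1 h.compact
  let ρ : Measure K := μ.comap (↑)
  have hρ : ∀ g : ℝ → ℂ, ∫ x : K, g x ∂ρ = ∫ x, g x ∂μ := fun g => by
    rw [integral_subtype_comap h.compact.measurableSet g, h.restrict_eq]
  have hfin : IsFiniteMeasure ρ := by
    refine ⟨?_⟩
    rw [(MeasurableEmbedding.subtype_coe h.compact.measurableSet).comap_apply]
    exact measure_lt_top _ _
  have hint : ∀ g : C(K, ℂ), Integrable g ρ := fun f => f.continuous.integrable_of_hasCompactSupport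
    (HasCompactSupport.of_compactSpace _)
  let φ₀ : C(K, ℂ) →ₗ[ℂ] ℂ :=
    { toFun := fun g => ∫ x, g x ∂ρ
      map_add' := fun f g => integral_add (hint f) (hint g)
      map_smul' := fun c g => integral_const_mul c _ }
  let φ : C(K, ℂ) →ₚ[ℂ] ℂ := PositiveLinearMap.mk₀ φ₀ fun g hg => by
    have h1 : ∀ x, g x = ((g x).re : ℂ) := fun x => by
      have := hg x
      exact Complex.ext rfl (by simpa using (Complex.le_def.1 this).2.symm)
    have h2 : φ₀ g = ((∫ x, (g x).re ∂ρ : ℝ) : ℂ) := by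
      rw [← integral_complex_ofReal]
      exact integral_congr_ae (Eventually.of_forall h1)
    rw [h2, Complex.zero_le_real]
    exact integral_nonneg fun x => (Complex.le_def.1 (hg x)).1
  have hφ : ∀ g, φ g = ∫ x, g x ∂ρ := fun g => rfl
  -- The class of the constant function 1 is the cyclic vector: its matrix coefficients are
  -- integrals.
  let e : φ.GNS := ((φ.toPreGNS 1 : φ.PreGNS) : φ.GNS)
  have hin : ∀ g, inner ℂ e (φ.gnsStarAlgHom g e) = ∫ x, g x ∂ρ := by
    intro g
    have h1 : φ.gnsStarAlgHom g e = ((φ.toPreGNS g : φ.PreGNS) : φ.GNS) := by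
      refine (φ.gnsNonUnitalStarAlgHom_apply_coe (a := g) (b := φ.toPreGNS 1)).trans ?_
      simp
    rw [h1, UniformSpace.Completion.inner_coe, PositiveLinearMap.preGNS_inner_def]
    simp [hφ]
  let x₀ : C(K, ℂ) := ⟨fun x => ((x : ℝ) : ℂ), by fun_prop⟩
  refine ⟨φ.GNS, inferInstance, inferInstance, inferInstance, φ.gnsStarAlgHom x₀, e, ?_, ?_⟩
  · rw [IsSelfAdjoint, ← map_star]
    congr 1
    ext x
    simp [x₀]
  · intro z hz
    have hne : ∀ x : K, z - ((x : ℝ) : ℂ) ≠ 0 := fun x => sub_ne_zero_of_mem_offCut hz x.2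
    let r : C(K, ℂ) := ⟨fun x => 1 / (z - ((x : ℝ) : ℂ)), continuous_const.div (by fun_prop) hne⟩
    have hr : (algebraMap ℂ C(K, ℂ) z - x₀) * r = 1 := by
      ext x
      simp [r, x₀, hne x]
    refine ⟨φ.gnsStarAlgHom r, ?_, ?_, ?_⟩
    · rw [← map_one φ.gnsStarAlgHom, ← hr, map_mul, map_sub, AlgHomClass.commutes]
    · rw [← map_one φ.gnsStarAlgHom, ← hr, mul_comm _ r, map_mul, map_sub, AlgHomClass.commutes]
    · rw [hin, cauchy]
      exact hρ fun x => 1 / (z - x)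

/-- The resolvent of a rank one perturbation. -/
theorem resolvent_sub_rankOne {E : Type*} [NormedAddCommGroup E] [InnerProductSpace ℂ E]
    {X R P : E →L[ℂ] E} {e : E} {z c s : ℂ} (hc : c ≠ 0) (hcs : c + s ≠ 0)
    (hP : ∀ v, P v = inner ℂ e v • e) (hR : (algebraMap ℂ (E →L[ℂ] E) z - X) * R = 1)
    (hR' : R * (algebraMap ℂ (E →L[ℂ] E) z - X) = 1) (hs : inner ℂ e (R e) = s) :
    ∃ R' : E →L[ℂ] E, (algebraMap ℂ (E →L[ℂ] E) z - (X - c⁻¹ • P)) * R' = 1 ∧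
      R' * (algebraMap ℂ (E →L[ℂ] E) z - (X - c⁻¹ • P)) = 1 ∧
      inner ℂ e (R' e) = s - (c + s)⁻¹ * s ^ 2 := by
  have hPRP : P * R * P = s • P := by
    ext v
    simp only [mul_apply_eq_comp, _root_.smul_apply, hP, map_smul, hs]
    exact smul_comm (inner ℂ e v) s e
  have hz : algebraMap ℂ (E →L[ℂ] E) z - (X - c⁻¹ • P) =
      (algebraMap ℂ (E →L[ℂ] E) z - X) + c⁻¹ • P := by abel
  have hcoef : c⁻¹ - (c + s)⁻¹ - c⁻¹ * (c + s)⁻¹ * s = 0 := by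
    field_simp
    ring
  -- The Sherman–Morrison formula: since PRP = sP, the Neumann series of the perturbation collapses
  -- to one term.
  refine ⟨R - (c + s)⁻¹ • (R * P * R), ?_, ?_, ?_⟩
  · rw [hz]
    calc _ = 1 + (c⁻¹ - (c + s)⁻¹ - c⁻¹ * (c + s)⁻¹ * s) • (P * R) := by
          rw [add_mul, mul_sub, hR, mul_smul_comm, ← mul_assoc, ← mul_assoc, hR, one_mul,
            smul_mul_assoc, mul_sub, mul_smul_comm, ← mul_assoc, ← mul_assoc, hPRP,
            smul_mul_assoc]
          module
      _ = 1 := by rw [hcoef, zero_smul, add_zero]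
  · rw [hz]
    calc _ = 1 + (c⁻¹ - (c + s)⁻¹ - c⁻¹ * (c + s)⁻¹ * s) • (R * P) := by
          rw [mul_add, sub_mul, hR', smul_mul_assoc, mul_assoc (R * P), hR', mul_one, mul_smul_comm,
            sub_mul, smul_mul_assoc, mul_assoc R P R, mul_assoc R, hPRP, mul_smul_comm]
          module
      _ = 1 := by rw [hcoef, zero_smul, add_zero]
  · simp only [_root_.sub_apply, _root_.smul_apply, mul_apply_eq_comp, inner_sub_right,
      inner_smul_right, hP, map_smul, hs]
    ring

end Spectral

/-! ### Reciprocals and polynomial multiples of Cauchy transforms -/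

namespace SupportedOn

variable {μ : Measure ℝ} {K : Set ℝ}

/-- Write μ̂(z) = ⟨e, (z - X)⁻¹e⟩. The operator B = X - c⁻¹⟨e, ·⟩e has a resolvent wherever c + μ̂ ≠
0, so its spectrum stays in K, and its resolvent at e is s - s²/(c + s) = c - c²/(c + s) with s =
μ̂(z). Solving for 1/(c + s) shows that `τ` can be the spectral measure of B at e. -/
theorem exists_inverse_of_ne_zero (h : SupportedOn μ K) {c : ℝ} (hc : c ≠ 0)
    (hne : ∀ z ∈ offCut K, c + cauchy (fun _ => 1) μ z ≠ 0) :
    ∃ τ : Measure ℝ, IsFiniteMeasure τ ∧ τ Kᶜ = 0 ∧ ∀ z ∈ offCut K,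
      (c + cauchy (fun _ => 1) μ z)⁻¹ = (c : ℂ)⁻¹ - ((c : ℂ) ^ 2)⁻¹ * cauchy (fun _ => 1) τ z := by
  obtain ⟨E, _, _, _, X, e, hX, hres⟩ := exists_multiplication_operator h
  have hc' : (c : ℂ) ≠ 0 := by exact_mod_cast hc
  let P : E →L[ℂ] E := (innerSL ℂ e).smulRight e
  have hP : ∀ v, P v = inner ℂ e v • e := fun v => rfl
  have hPs : IsSelfAdjoint P := by
    rw [ContinuousLinearMap.isSelfAdjoint_iff_isSymmetric]
    intro v w
    simp [hP, inner_smul_left, inner_smul_right, mul_comm]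
  let B : E →L[ℂ] E := X - (c : ℂ)⁻¹ • P
  have hB : IsSelfAdjoint B := by
    refine hX.sub (IsSelfAdjoint.smul ?_ hPs)
    rw [IsSelfAdjoint, Complex.star_def, map_inv₀, Complex.conj_ofReal]
  have hres' : ∀ z ∈ offCut K, ∃ R' : E →L[ℂ] E, (algebraMap ℂ (E →L[ℂ] E) z - B) * R' = 1 ∧
      R' * (algebraMap ℂ (E →L[ℂ] E) z - B) = 1 ∧
      inner ℂ e (R' e) = cauchy (fun _ => 1) μ z -
        (c + cauchy (fun _ => 1) μ z)⁻¹ * cauchy (fun _ => 1) μ z ^ 2 := fun z hz => by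
    obtain ⟨R, hR, hR', hs⟩ := hres z hz
    exact resolvent_sub_rankOne hc' (hne z hz) hP hR hR' hs
  have hspec : spectrum ℂ B ⊆ Complex.ofReal '' K := by
    intro z hz
    by_contra hzK
    obtain ⟨R', h1, h2, -⟩ := hres' z hzK
    exact hz ⟨⟨_, R', h1, h2⟩, rfl⟩
  obtain ⟨τ, hτ, hτK, hτz⟩ := exists_spectral_measure B hB e h.compact hspec
  refine ⟨τ, hτ, hτK, fun z hz => ?_⟩
  obtain ⟨R', h1, -, h3⟩ := hres' z hz
  rw [← hτz z hz R' h1, h3]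
  have := hne z hz
  field_simp
  ring

/-- Multiplying a Cauchy transform by a polynomial amounts, up to a polynomial, to multiplying the
measure by it. -/
theorem exists_eval_mul_cauchy (h : SupportedOn μ K) {φ : ℝ → ℂ} (hφ : ContinuousOn φ K) (w : ℂ[X]) :
    ∃ P : ℂ[X], (∀ z ∈ offCut K,
        w.eval z * cauchy φ μ z = cauchy (fun x => w.eval (x : ℂ) * φ x) μ z + P.eval z) ∧
      (∀ M : ℕ, w.degree ≤ M → P.degree < M) ∧
      ∀ M : ℕ, w.degree ≤ (M + 1 : ℕ) → P.coeff M = w.coeff (M + 1) * ∫ x, φ x ∂μ := by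
  induction hn : w.natDegree generalizing w with
  | zero =>
    rw [natDegree_eq_zero] at hn
    obtain ⟨a, rfl⟩ := hn
    refine ⟨0, fun z _ => ?_, fun M _ => by simp, fun M _ => by
      simp⟩
    simp only [eval_C, eval_zero, add_zero]
    rw [cauchy_const_mul]
  | succ n ih =>
    obtain ⟨P, hP, hdeg, hcoeff⟩ := ih w.divX (by rw [natDegree_divX_eq_natDegree_tsub_one, hn]; rfl)
    have hw : ∀ z, w.eval z = z * w.divX.eval z + w.coeff 0 := fun z => by
      conv_lhs => rw [← divX_mul_X_add w]
      rw [eval_add, eval_mul, eval_X, eval_C, mul_comm]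
    have hc : ∀ p : ℂ[X], ContinuousOn (fun x : ℝ => p.eval (x : ℂ) * φ x) K := fun p =>
      (p.continuous.comp Complex.continuous_ofReal).continuousOn.mul hφ
    have hX : ∀ M : ℕ, w.degree ≤ (M + 1 : ℕ) → w.divX.degree ≤ M := by
      intro M hM
      rw [degree_le_iff_coeff_zero] at hM ⊢
      intro m hm
      rw [coeff_divX]
      refine hM _ ?_
      exact_mod_cast Nat.succ_lt_succ (by exact_mod_cast hm)
    have hdeg0 : ¬ w.degree ≤ (0 : ℕ) := fun h0 => by
      have := natDegree_le_iff_degree_le.2 h0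
      omega
    -- Horner's scheme w = X · `w.divX` + w(0): each multiplication by z adds one constant, the
    -- total mass of the current density.
    refine ⟨X * P + C (∫ x, w.divX.eval (x : ℂ) * φ x ∂μ), fun z hz => ?_, fun M hM => ?_,
      fun M hM => ?_⟩
    · have h1 : cauchy (fun x => w.eval (x : ℂ) * φ x) μ z =
          cauchy (fun x => x * (w.divX.eval (x : ℂ) * φ x)) μ z + w.coeff 0 * cauchy φ μ z := by
        have h2 := h.cauchy_add (φ := fun x : ℝ => (x : ℂ) * (w.divX.eval (x : ℂ) * φ x))
          (ψ := fun x => w.coeff 0 * φ x) (Complex.continuous_ofReal.continuousOn.mul (hc _))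
          (continuousOn_const.mul hφ) hz
        rw [← cauchy_const_mul, ← h2]
        refine h.cauchy_congr (fun x _ => ?_) z
        rw [hw]
        ring
      have h2 := h.mul_cauchy (hc w.divX) hz
      rw [hw, add_mul, mul_assoc, hP z hz, mul_add, h2, h1]
      simp only [eval_add, eval_mul, eval_X, eval_C]
      ring
    · cases M with
      | zero => exact absurd hM hdeg0
      | succ M =>
        have h1 := hdeg M (hX M hM)
        refine lt_of_le_of_lt (degree_add_le _ _) (max_lt ?_ ?_)
        · rw [degree_lt_iff_coeff_zero] at h1 ⊢
          intro m hm
          cases m with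
          | zero => simp at hm
          | succ m => rw [coeff_X_mul]; exact h1 m (by omega)
        · refine lt_of_le_of_lt degree_C_le ?_
          exact_mod_cast Nat.succ_pos M
    · cases M with
      | zero =>
        have h1 : w.divX = C (w.coeff 1) := by
          have := eq_C_of_degree_le_zero (hX 0 hM)
          rwa [coeff_divX] at this
        rw [h1]
        simp only [eval_C, coeff_add, coeff_X_mul_zero, coeff_C_zero, zero_add]
        rw [integral_const_mul]
      | succ M =>
        rw [coeff_add, coeff_X_mul, coeff_C_succ, add_zero, hcoeff M (hX _ hM), coeff_divX]

end SupportedOn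

theorem Polynomial.eq_zero_of_tendsto_cobounded {P : ℂ[X]}
    (h : Tendsto (fun z => P.eval z) (Bornology.cobounded ℂ) (𝓝 0)) : P = 0 := by
  have hdeg : ¬ 0 < P.degree := fun hdeg =>
    not_tendsto_nhds_of_tendsto_atTop
      (P.tendsto_norm_atTop hdeg tendsto_norm_cobounded_atTop) _ h.norm
  rw [eq_C_of_degree_le_zero (not_lt.1 hdeg)] at h ⊢
  simp only [eval_C] at h
  rw [tendsto_nhds_unique tendsto_const_nhds h, C_0]

namespace SupportedOn

variable {μ : Measure ℝ} {K : Set ℝ}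

/-- A Cauchy transform tends to 0 at infinity, so a polynomial equal to it vanishes; the coefficient
of 1/z is then zero as well. -/
theorem integral_eq_zero_of_cauchy_eq_eval (h : SupportedOn μ K) {φ : ℝ → ℂ}
    (hφ : ContinuousOn φ K) {P : ℂ[X]} (hP : ∀ z ∈ offCut K, cauchy φ μ z = P.eval z) :
    P = 0 ∧ ∫ x, φ x ∂μ = 0 := by
  have hP0 : P = 0 := by
    refine eq_zero_of_tendsto_cobounded ((h.tendsto_cauchy hφ).congr' ?_)
    filter_upwards [h.eventually_mem_offCut] with z hz using hP z hz
  refine ⟨hP0, ?_⟩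
  have h1 := h.tendsto_mul_cauchy hφ
  refine tendsto_nhds_unique h1 (tendsto_const_nhds.congr' ?_)
  filter_upwards [h.eventually_mem_offCut] with z hz
  rw [hP z hz, hP0]
  simp

end SupportedOn

namespace Carried

variable {μ : Measure ℝ} {K : Set ℝ}

/-- The Cauchy transform of a measure with infinite support is not a rational function. -/
theorem eq_zero_of_eval_mul_cauchy (h : Carried μ K) {R Q : ℂ[X]}
    (hRQ : ∀ z ∈ offCut K, R.eval z * cauchy (fun _ => 1) μ z = Q.eval z) : R = 0 := by
  by_contra hR
  have hc : ∀ p : ℂ[X], ContinuousOn (fun x : ℝ => p.eval (x : ℂ)) K := fun p =>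
    (p.continuous.comp Complex.continuous_ofReal).continuousOn
  obtain ⟨P, hP, -⟩ := h.exists_eval_mul_cauchy (φ := fun _ => 1) continuousOn_const R
  have h1 : ∀ z ∈ offCut K, cauchy (fun x => R.eval (x : ℂ)) μ z = (Q - P).eval z := by
    intro z hz
    have := hP z hz
    rw [hRQ z hz] at this
    rw [eval_sub, this]
    simp
  have h2 := (h.integral_eq_zero_of_cauchy_eq_eval (hc R) h1).1
  -- By now the Cauchy transform of R dμ vanishes. Multiplying by the conjugate polynomial gives ∫
  -- |R|² dμ = 0, impossible since the roots of R do not carry `μ`.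
  let S : ℂ[X] := R.map (starRingEnd ℂ)
  obtain ⟨P', hP', -⟩ := h.exists_eval_mul_cauchy (hc R) S
  have h3 := (h.integral_eq_zero_of_cauchy_eq_eval (φ := fun x => S.eval (x : ℂ) * R.eval (x : ℂ))
    (P := -P') ((hc S).mul (hc R)) fun z hz => by
      have := hP' z hz
      rw [h1 z hz, h2, eval_zero, mul_zero] at this
      rw [eval_neg, eq_neg_iff_add_eq_zero, ← this]).2
  have hS : ∀ x : ℝ, S.eval (x : ℂ) = (starRingEnd ℂ) (R.eval (x : ℂ)) := fun x => by
    rw [← Complex.conj_ofReal x, eval_map, eval₂_hom, Complex.conj_ofReal]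
  have h4 : ∫ x, S.eval (x : ℂ) * R.eval (x : ℂ) ∂μ =
      ((∫ x, Complex.normSq (R.eval ((x : ℝ) : ℂ)) ∂μ : ℝ) : ℂ) := by
    rw [← integral_complex_ofReal]
    refine h.integral_congr fun x _ => ?_
    rw [hS, Complex.normSq_eq_conj_mul_self]
  rw [h4, Complex.ofReal_eq_zero] at h3
  refine (h.integral_pos_of_pos (f := fun x => Complex.normSq (R.eval ((x : ℝ) : ℂ)))
    ?_ (R.roots.toFinset.image Complex.re) (fun x _ => Complex.normSq_nonneg _)
    fun x _ hx h0 => hx ?_).ne' h3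
  · exact (Complex.continuous_normSq.comp
      (R.continuous.comp Complex.continuous_ofReal)).continuousOn
  · rw [Finset.mem_image]
    refine ⟨x, ?_, Complex.ofReal_re x⟩
    rw [Multiset.mem_toFinset, mem_roots hR]
    exact Complex.normSq_eq_zero.1 h0

/-- The reciprocal of `c + μ̂` is, up to a polynomial of degree at most one, minus the Cauchy
transform of a positive measure. -/
theorem exists_inverse (h : Carried μ K) (c : ℝ)
    (hne : ∀ z ∈ offCut K, c + cauchy (fun _ => 1) μ z ≠ 0) :
    ∃ τ : Measure ℝ, Carried τ K ∧ ∃ α β : ℝ, ∀ z ∈ offCut K,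
      (c + cauchy (fun _ => 1) μ z)⁻¹ = α * z + β - cauchy (fun _ => 1) τ z := by
  obtain ⟨τ, hτ, α, β, hτz⟩ : ∃ τ : Measure ℝ, SupportedOn τ K ∧ ∃ α β : ℝ, ∀ z ∈ offCut K,
      (c + cauchy (fun _ => 1) μ z)⁻¹ = α * z + β - cauchy (fun _ => 1) τ z := by
    by_cases hc : c = 0
    · subst hc
      have hfin := h.finite
      -- For c = 0 the perturbation is not available. With a = min K the measure (x - a) dμ is
      -- positive and (z - a)μ̂ = b + μ̂', where b = μ(ℝ) ≠ 0, so the case of a nonzero constant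
      -- applies to μ'. Multiplication by z - a then returns to 1/μ̂ and produces the affine part.
      obtain ⟨a, ha⟩ := h.compact.exists_isLeast h.nonempty
      obtain ⟨μ', hμ', hint, -⟩ := h.toSupportedOn.exists_withDensity (ρ := fun x => x - a)
        (by fun_prop) fun x hx => sub_nonneg.2 (ha.2 hx)
      let b : ℝ := μ.real Set.univ
      have hb : b ≠ 0 := by
        have : NeZero μ := ⟨h.ne_zero⟩
        exact measureReal_univ_ne_zero
      have hb' : (b : ℂ) ≠ 0 := by exact_mod_cast hb
      have hshift : ∀ {ν : Measure ℝ}, SupportedOn ν K → ∀ z ∈ offCut K,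
          (z - a) * cauchy (fun _ => 1) ν z =
            cauchy (fun x => ((x - a : ℝ) : ℂ)) ν z + (ν.real Set.univ : ℝ) := by
        intro ν hν z hz
        have := hν.finite
        rw [sub_mul, hν.mul_cauchy continuousOn_const hz, ← cauchy_const_mul]
        have h2 := hν.cauchy_add (φ := fun x : ℝ => (x : ℂ) * 1) (ψ := fun _ : ℝ => -(a : ℂ) * 1)
          (by fun_prop) (by fun_prop) hz
        have h3 : cauchy (fun x => ((x - a : ℝ) : ℂ)) ν z =
            cauchy (fun x : ℝ => (x : ℂ) * 1 + -(a : ℂ) * 1) ν z :=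
          hν.cauchy_congr (fun x _ => by push_cast; ring) z
        rw [h3, h2, cauchy_const_mul (fun _ => 1) ν (-(a : ℂ)), cauchy_const_mul]
        simp
        ring
      have hμ'z : ∀ z ∈ offCut K,
          (z - a) * cauchy (fun _ => 1) μ z = b + cauchy (fun _ => 1) μ' z := by
        intro z hz
        rw [hshift h.toSupportedOn z hz, add_comm]
        congr 1
        rw [cauchy, cauchy, hint]
        refine h.integral_congr fun x _ => ?_
        push_cast
        ring
      have hza : ∀ z ∈ offCut K, z - a ≠ 0 := fun z hz => sub_ne_zero_of_mem_offCut hz ha.1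
      have hne' : ∀ z ∈ offCut K, b + cauchy (fun _ => 1) μ' z ≠ 0 := by
        intro z hz
        rw [← hμ'z z hz]
        refine mul_ne_zero (hza z hz) ?_
        simpa using hne z hz
      obtain ⟨τ', hτ'f, hτ'K, hτ'z⟩ := hμ'.exists_inverse_of_ne_zero hb hne'
      have hτ' : SupportedOn τ' K := ⟨h.compact, hτ'f, hτ'K⟩
      obtain ⟨τ, hτ, hintτ, -⟩ := hτ'.exists_withDensity (ρ := fun x => (x - a) / b ^ 2)
        (by fun_prop) fun x hx => div_nonneg (sub_nonneg.2 (ha.2 hx)) (sq_nonneg b)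
      refine ⟨τ, hτ, 1 / b, -a / b - τ'.real Set.univ / b ^ 2, fun z hz => ?_⟩
      have h1 : cauchy (fun _ => 1) τ z =
          ((b : ℂ) ^ 2)⁻¹ * cauchy (fun x => ((x - a : ℝ) : ℂ)) τ' z := by
        rw [cauchy, hintτ, ← cauchy_const_mul, cauchy]
        refine hτ'.integral_congr fun x _ => ?_
        push_cast
        ring
      have h2 := hτ'z z hz
      rw [← hμ'z z hz] at h2
      have h3 : (((0 : ℝ) : ℂ) + cauchy (fun _ => 1) μ z)⁻¹ =
          (z - a) * ((z - a) * cauchy (fun _ => 1) μ z)⁻¹ := by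
        have := hza z hz
        rw [mul_inv, ← mul_assoc, mul_inv_cancel₀ this, one_mul]
        simp
      rw [h3, h2, h1]
      have h4 := hshift hτ' z hz
      rw [mul_sub, mul_left_comm, h4]
      push_cast
      field_simp
      ring
    · obtain ⟨τ', hτ'f, hτ'K, hτ'z⟩ := h.toSupportedOn.exists_inverse_of_ne_zero hc hne
      have hτ' : SupportedOn τ' K := ⟨h.compact, hτ'f, hτ'K⟩
      obtain ⟨τ, hτ, hintτ, -⟩ := hτ'.exists_withDensity (ρ := fun x => (c ^ 2)⁻¹)
        (by fun_prop) fun x hx => by positivity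
      refine ⟨τ, hτ, 0, c⁻¹, fun z hz => ?_⟩
      rw [hτ'z z hz, ← cauchy_const_mul (fun _ => 1) τ', cauchy, cauchy, hintτ]
      push_cast
      simp only [zero_mul, zero_add, mul_div_assoc]
  refine ⟨τ, ⟨hτ, h.ordConnected, fun s hs => ?_⟩, α, β, hτz⟩
  -- If a finite set carried `τ`, then `Q` times τ̂ would be a polynomial, hence R(c + μ̂) = Q with
  -- a polynomial R, contradicting that μ̂ is not rational.
  let Q : ℂ[X] := ∏ a ∈ s, (X - C (a : ℂ))
  have hQ : Q ≠ 0 := Finset.prod_ne_zero_iff.2 fun a _ => X_sub_C_ne_zero _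
  obtain ⟨P, hP, -⟩ := hτ.exists_eval_mul_cauchy (φ := fun _ => 1) continuousOn_const Q
  have hQs : ∀ z, cauchy (fun x => Q.eval (x : ℂ) * 1) τ z = 0 := by
    intro z
    rw [cauchy, integral_eq_zero_of_ae]
    have : ∀ᵐ x ∂τ, x ∈ s := by rw [ae_iff]; exact hs
    filter_upwards [this] with x hx
    have : Q.eval (x : ℂ) = 0 := by
      rw [eval_prod]
      exact Finset.prod_eq_zero hx (by simp)
    simp [this]
  let R : ℂ[X] := Q * (C (α : ℂ) * X + C (β : ℂ)) - P
  have hR : ∀ z ∈ offCut K, R.eval z * (c + cauchy (fun _ => 1) μ z) = Q.eval z := by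
    intro z hz
    have h1 := hP z hz
    rw [hQs, zero_add] at h1
    have h2 : R.eval z = Q.eval z * (c + cauchy (fun _ => 1) μ z)⁻¹ := by
      rw [hτz z hz]
      simp only [R, eval_sub, eval_mul, eval_add, eval_C, eval_X]
      rw [← h1]
      ring
    rw [h2, mul_assoc, inv_mul_cancel₀ (hne z hz), mul_one]
  have hR0 : R = 0 := h.eq_zero_of_eval_mul_cauchy (Q := Q - C (c : ℂ) * R) fun z hz => by
    have := hR z hz
    simp only [eval_sub, eval_mul, eval_C]
    rw [← this]
    ring
  apply hQ
  refine eq_zero_of_infinite_isRoot Q (Set.Infinite.mono (s := {z : ℂ | z.im ≠ 0}) ?_ ?_)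
  · intro z hz
    have := hR z (mem_offCut_of_im_ne_zero hz)
    rw [hR0, eval_zero, zero_mul] at this
    exact this.symm
  · refine Set.infinite_of_injective_forall_mem (f := fun n : ℕ => ((n : ℂ) + 1) * Complex.I) ?_ ?_
    · intro m n hmn
      simpa using hmn
    · intro n
      simp only [Set.mem_ofPred_eq, Complex.mul_im, Complex.I_im, Complex.I_re]
      simp
      positivity

end Carried

/-! ### Counting zeros by real polynomial divisors -/

/-- The function `f` commutes with complex conjugation on `U`. -/
def ConjSymm (U : Set ℂ) (f : ℂ → ℂ) : Prop :=
  ∀ z ∈ U, f ((starRingEnd ℂ) z) = (starRingEnd ℂ) (f z)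

/-- The polynomial `w` divides `f` in the ring of analytic functions on `U`. -/
def AnalyticDvd (U : Set ℂ) (w : ℂ[X]) (f : ℂ → ℂ) : Prop :=
  ∃ g, AnalyticOnNhd ℂ g U ∧ ∀ z ∈ U, f z = w.eval z * g z

/-- Real polynomials with zeros in `U` that divide `f` on `U` have degree less than `N`. -/
def FewZeros (U : Set ℂ) (N : ℕ) (f : ℂ → ℂ) : Prop :=
  ∀ w : ℝ[X], w ≠ 0 → (∀ z, aeval z w = 0 → z ∈ U) →
    AnalyticDvd U (w.map (algebraMap ℝ ℂ)) f → w.natDegree < N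

theorem aeval_conj_real (w : ℝ[X]) (z : ℂ) :
    aeval ((starRingEnd ℂ) z) w = (starRingEnd ℂ) (aeval z w) :=
  Polynomial.aeval_conj w z

theorem eval_map_real (w : ℝ[X]) (z : ℂ) : (w.map (algebraMap ℝ ℂ)).eval z = aeval z w := by
  rw [eval_map, aeval_def]

section

variable {U : Set ℂ} {f : ℂ → ℂ}

theorem analyticOnNhd_conj_conj (hU : IsOpen U) (hc : ∀ z ∈ U, (starRingEnd ℂ) z ∈ U) {g : ℂ → ℂ}
    (hg : AnalyticOnNhd ℂ g U) :
    AnalyticOnNhd ℂ (fun z => (starRingEnd ℂ) (g ((starRingEnd ℂ) z))) U := by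
  refine DifferentiableOn.analyticOnNhd (fun z hz => ?_) hU
  have h1 := (hg _ (hc z hz)).differentiableAt
  have h2 := h1.conj_conj
  simp only [Complex.conj_conj] at h2
  exact h2.differentiableWithinAt

/-- Both `w` and `f` commute with conjugation, so the conjugate reflection of a quotient is again a
quotient; the average of the two is symmetric. -/
theorem AnalyticDvd.exists_conjSymm (hU : IsOpen U) (hc : ∀ z ∈ U, (starRingEnd ℂ) z ∈ U)
    (hf : ConjSymm U f) {w : ℝ[X]} (h : AnalyticDvd U (w.map (algebraMap ℝ ℂ)) f) :
    ∃ g, AnalyticOnNhd ℂ g U ∧ ConjSymm U g ∧ ∀ z ∈ U, f z = aeval z w * g z := by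
  obtain ⟨g, hg, hfg⟩ := h
  simp only [eval_map_real] at hfg
  refine ⟨fun z => (2⁻¹ : ℂ) * (g z + (starRingEnd ℂ) (g ((starRingEnd ℂ) z))), ?_, ?_, ?_⟩
  · exact analyticOnNhd_const.mul (hg.add (analyticOnNhd_conj_conj hU hc hg))
  · intro z hz
    have h2 : (starRingEnd ℂ) 2 = 2 := map_ofNat _ 2
    simp [add_comm, h2]
  · intro z hz
    have h1 := hfg z hz
    have h2 := hfg _ (hc z hz)
    rw [hf z hz, aeval_conj_real] at h2
    have h3 := congrArg (starRingEnd ℂ) h2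
    simp only [map_mul, Complex.conj_conj] at h3
    linear_combination (2⁻¹ : ℂ) * h1 + (2⁻¹ : ℂ) * h3

theorem exists_eq_sub_mul (hU : IsOpen U) {g : ℂ → ℂ} (hg : AnalyticOnNhd ℂ g U) {ζ : ℂ}
    (hζ : ζ ∈ U) (h0 : g ζ = 0) :
    ∃ k, AnalyticOnNhd ℂ k U ∧ ∀ z, g z = (z - ζ) * k z := by
  refine ⟨dslope g ζ, ?_, fun z => ?_⟩
  · refine DifferentiableOn.analyticOnNhd ?_ hU
    exact (Complex.differentiableOn_dslope (hU.mem_nhds hζ)).2 hg.differentiableOn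
  · have := sub_smul_dslope g ζ z
    rw [h0, sub_zero, smul_eq_mul] at this
    exact this.symm

/-- A polynomial that is a multiple of `w` among analytic functions is one among polynomials. -/
theorem dvd_of_analyticDvd (hU : IsOpen U) {w : ℂ[X]} (hw : w ≠ 0) (hr : ∀ z, w.eval z = 0 → z ∈ U)
    {P : ℂ[X]} (h : AnalyticDvd U w fun z => P.eval z) : w ∣ P := by
  induction hn : w.natDegree generalizing w P with
  | zero =>
    rw [Polynomial.eq_C_of_natDegree_eq_zero hn] at hw ⊢
    have : IsUnit (C (w.coeff 0)) := by
      rw [isUnit_C]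
      exact IsUnit.mk0 _ fun h => hw (by rw [h, C_0])
    exact this.dvd
  | succ n ih =>
    obtain ⟨ζ, hζ⟩ := Complex.exists_root (f := w) (by
      rw [← natDegree_pos_iff_degree_pos]; omega)
    obtain ⟨w', rfl⟩ := dvd_iff_isRoot.2 hζ
    obtain ⟨g, hg, hP⟩ := h
    have hζU : ζ ∈ U := hr ζ hζ
    have hPζ : P.IsRoot ζ := by
      have := hP ζ hζU
      simpa using this
    obtain ⟨P', rfl⟩ := dvd_iff_isRoot.2 hPζ
    have hw' : w' ≠ 0 := right_ne_zero_of_mul hw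
    refine mul_dvd_mul_left _ (ih hw' (fun z hz => hr z (by simp [hz])) ⟨g, hg, ?_⟩ ?_)
    · have hne : ∀ z ∈ U, z ≠ ζ → P'.eval z = w'.eval z * g z := by
        intro z hz hzζ
        have := hP z hz
        simp only [eval_mul, eval_sub, eval_X, eval_C] at this
        exact mul_left_cancel₀ (sub_ne_zero.2 hzζ) (by rw [this]; ring)
      intro z hz
      by_cases hzζ : z = ζ
      · subst hzζ
        have h1 : Tendsto (fun y => P'.eval y) (𝓝[≠] z) (𝓝 (P'.eval z)) :=
          (P'.continuous.tendsto z).mono_left nhdsWithin_le_nhds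
        have h2 : Tendsto (fun y => w'.eval y * g y) (𝓝[≠] z) (𝓝 (w'.eval z * g z)) :=
          ((w'.continuous.tendsto z).mul (hg z hz).continuousAt).mono_left nhdsWithin_le_nhds
        refine tendsto_nhds_unique h1 (h2.congr' ?_)
        filter_upwards [nhdsWithin_le_nhds (hU.mem_nhds hz), self_mem_nhdsWithin] with y hy hyz
        exact (hne y hy hyz).symm
      · exact hne z hz hzζ
    · rw [natDegree_mul (X_sub_C_ne_zero ζ) hw', natDegree_X_sub_C] at hn
      omega

/-- A real function with few zeros is nonnegative on an interval after multiplication by a polynomial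
of low degree. -/
theorem FewZeros.exists_sign (hU : IsOpen U) (hc : ∀ z ∈ U, (starRingEnd ℂ) z ∈ U) {N : ℕ}
    (h : FewZeros U N f) (hf : AnalyticOnNhd ℂ f U) (hs : ConjSymm U f) {K : Set ℝ} (hK : K.OrdConnected)
    (hKU : ∀ x ∈ K, (x : ℂ) ∈ U) :
    ∃ q : ℝ[X], q.natDegree < N ∧ ∃ S : Finset ℝ, ∃ φ : ℝ → ℝ, ∀ x ∈ K,
      ((q.eval x : ℝ) : ℂ) * f x = φ x ∧ 0 ≤ φ x ∧ (x ∉ S → φ x ≠ 0) := by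
  by_contra hcon
  -- If the claim fails, every divisor can be enlarged by another zero on K. Divisors of every
  -- degree then exist, against the bound `N`.
  have key : ∀ d : ℕ, ∃ w : ℝ[X], w.natDegree = d ∧ w ≠ 0 ∧ (∀ z, aeval z w = 0 → z ∈ U) ∧
      AnalyticDvd U (w.map (algebraMap ℝ ℂ)) f := by
    intro d
    induction d with
    | zero => exact ⟨1, by simp, one_ne_zero, by simp, f, hf, by simp⟩
    | succ d ih =>
      obtain ⟨w, hd, hw, hwU, hdvd⟩ := ih
      have hlt := h w hw hwU hdvd
      obtain ⟨g, hg, hgs, hfg⟩ := hdvd.exists_conjSymm hU hc hs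
      by_cases h0 : ∃ x ∈ K, g x = 0
      · obtain ⟨x, hx, hgx⟩ := h0
        obtain ⟨k, hk, hgk⟩ := exists_eq_sub_mul hU hg (hKU x hx) hgx
        refine ⟨w * (X - C x), ?_, mul_ne_zero hw (X_sub_C_ne_zero x), ?_, k, hk, ?_⟩
        · rw [natDegree_mul hw (X_sub_C_ne_zero x), natDegree_X_sub_C, hd]
        · intro z hz
          rw [map_mul, mul_eq_zero] at hz
          rcases hz with hz | hz
          · exact hwU z hz
          · simp [sub_eq_zero] at hz
            rw [hz]
            exact hKU x hx
        · intro z hz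
          rw [eval_map_real, hfg z hz, hgk z]
          simp
          ring
      · push Not at h0
        have hre : ∀ x ∈ K, (g x).im = 0 := fun x hx => by
          have := hgs _ (hKU x hx)
          rw [Complex.conj_ofReal] at this
          exact Complex.conj_eq_iff_im.1 this.symm
        have hgc : ContinuousOn (fun x : ℝ => g x) K :=
          hg.continuousOn.comp Complex.continuous_ofReal.continuousOn hKU
        obtain ⟨s, hs1, hsg⟩ := Carried.exists_sign hK hgc hre h0
        have hss : s * s = 1 := by rcases hs1 with rfl | rfl <;> norm_num
        -- Once the quotient g has no zero on K it has a constant sign s there, and (s w) f = w²|g|.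
        -- This is nonzero away from the roots of `w`.
        refine absurd ⟨C s * w, (natDegree_C_mul_le _ _).trans_lt hlt, w.roots.toFinset,
          fun x => w.eval x ^ 2 * ‖g x‖, fun x hx => ⟨?_, by positivity, fun hxw => ?_⟩⟩ hcon
        · rw [hfg _ (hKU x hx), hsg x hx]
          have : aeval (x : ℂ) w = ((w.eval x : ℝ) : ℂ) := by
            have := Polynomial.aeval_algebraMap_apply ℂ x w
            simpa using this
          rw [this, eval_C_mul]
          push_cast
          have hss' : (s : ℂ) * s = 1 := by exact_mod_cast hss
          linear_combination (((w.eval x : ℝ) : ℂ) ^ 2 * ‖g x‖ ) * hss'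
        · refine mul_ne_zero (pow_ne_zero _ fun hx0 => hxw ?_) (by simpa using h0 x hx)
          simpa [hw] using hx0
  obtain ⟨w, hd, hw, hwU, hdvd⟩ := key N
  have := h w hw hwU hdvd
  omega


theorem analyticDvd_pow_of_le_order (hU : IsOpen U) {ζ : ℂ} (hζ : ζ ∈ U) (m : ℕ)
    (hf : AnalyticOnNhd ℂ f U) (hm : (m : ℕ∞) ≤ analyticOrderAt f ζ) :
    AnalyticDvd U ((X - C ζ) ^ m) f := by
  induction m generalizing f with
  | zero => exact ⟨f, hf, by simp⟩
  | succ m ih =>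
    have h0 : f ζ = 0 := by
      by_contra h
      rw [(hf ζ hζ).analyticOrderAt_eq_zero.2 h] at hm
      simp at hm
    obtain ⟨k, hk, hfk⟩ := exists_eq_sub_mul hU hf hζ h0
    have h1 : f = (fun z => z - ζ) * k := funext hfk
    have h2 : AnalyticAt ℂ (fun z => z - ζ) ζ := by fun_prop
    have h3 : analyticOrderAt (fun z => z - ζ) ζ = 1 := analyticOrderAt_id_sub_const_self
    rw [h1, analyticOrderAt_mul h2 (hk ζ hζ), h3] at hm
    obtain ⟨g, hg, hkg⟩ := ih hk (by
      rw [Nat.cast_succ, add_comm] at hm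
      exact (ENat.add_le_add_iff_left ENat.one_ne_top).1 hm)
    refine ⟨g, hg, fun z hz => ?_⟩
    rw [hfk, hkg z hz, pow_succ]
    simp
    ring

theorem AnalyticDvd.conj (hU : IsOpen U) (hc : ∀ z ∈ U, (starRingEnd ℂ) z ∈ U)
    (hs : ConjSymm U f) {ζ : ℂ} {m : ℕ} (h : AnalyticDvd U ((X - C ζ) ^ m) f) :
    AnalyticDvd U ((X - C ((starRingEnd ℂ) ζ)) ^ m) f := by
  obtain ⟨g, hg, hfg⟩ := h
  refine ⟨_, analyticOnNhd_conj_conj hU hc hg, fun z hz => ?_⟩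
  have h1 := hfg _ (hc z hz)
  rw [hs z hz] at h1
  have h2 := congrArg (starRingEnd ℂ) h1
  rw [Complex.conj_conj] at h2
  rw [h2]
  simp

/-- With aw + bv = 1, f = wg and f = vk, one has f = wv(ak + bg). -/
theorem AnalyticDvd.mul_of_isCoprime {w v : ℂ[X]} (h : IsCoprime w v) (hw : AnalyticDvd U w f)
    (hv : AnalyticDvd U v f) : AnalyticDvd U (w * v) f := by
  obtain ⟨a, b, hab⟩ := h
  obtain ⟨g, hg, hfg⟩ := hw
  obtain ⟨k, hk, hfk⟩ := hv
  have hp : ∀ p : ℂ[X], AnalyticOnNhd ℂ (fun z => p.eval z) U := fun p =>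
    (AnalyticOnNhd.eval_polynomial p).mono (Set.subset_univ _)
  refine ⟨fun z => a.eval z * k z + b.eval z * g z, ((hp a).mul hk).add ((hp b).mul hg),
    fun z hz => ?_⟩
  have h1 := congrArg (fun q => eval z q) hab
  simp only [eval_add, eval_mul, eval_one] at h1 ⊢
  linear_combination (-f z) * h1 + a.eval z * w.eval z * hfk z hz + b.eval z * v.eval z * hfg z hz

theorem AnalyticDvd.prod (T : Finset ℂ) (m : ℂ → ℕ) (hf : AnalyticOnNhd ℂ f U)
    (h : ∀ ζ ∈ T, AnalyticDvd U ((X - C ζ) ^ m ζ) f) :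
    AnalyticDvd U (∏ ζ ∈ T, (X - C ζ) ^ m ζ) f := by
  induction T using Finset.induction_on with
  | empty => exact ⟨f, hf, by simp⟩
  | insert a s ha ih =>
    rw [Finset.prod_insert ha]
    refine AnalyticDvd.mul_of_isCoprime ?_ (h a (Finset.mem_insert_self _ _))
      (ih fun ζ hζ => h ζ (Finset.mem_insert_of_mem hζ))
    refine IsCoprime.prod_right fun i hi => IsCoprime.pow ?_
    exact isCoprime_X_sub_C_of_isUnit_sub (IsUnit.mk0 _ (sub_ne_zero.2 fun h => ha (h ▸ hi)))

theorem exists_real_polynomial {W : ℂ[X]} (h : W.map (starRingEnd ℂ) = W) :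
    ∃ w : ℝ[X], w.map (algebraMap ℝ ℂ) = W := by
  have : W ∈ Polynomial.lifts (algebraMap ℝ ℂ) := by
    rw [Polynomial.lifts_iff_coeff_lifts]
    intro n
    have h1 := congrArg (fun q => coeff q n) h
    simp only [coeff_map] at h1
    exact ⟨(W.coeff n).re, Complex.conj_eq_iff_re.1 h1⟩
  exact (Polynomial.mem_lifts _).1 this

/-- The bound for polynomial divisors bounds the number of zeros with multiplicities. -/
theorem FewZeros.sum_analyticOrderAt_lt (hU : IsOpen U) (hc : ∀ z ∈ U, (starRingEnd ℂ) z ∈ U) {N : ℕ}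
    (h : FewZeros U N f) (hf : AnalyticOnNhd ℂ f U) (hs : ConjSymm U f) (T : Finset ℂ)
    (hT : (T : Set ℂ) ⊆ U) : ∑ z ∈ T, analyticOrderAt f z < (N : ℕ∞) := by
  classical
  by_contra hcon
  push Not at hcon
  -- Truncation at `N` keeps the multiplicities finite, as `analyticOrderAt` is infinite where f
  -- vanishes locally; one such point alone already contributes `N`.
  set m : ℂ → ℕ := fun z => (min (analyticOrderAt f z) N).toNat with hm
  have hmle : ∀ z, (m z : ℕ∞) ≤ analyticOrderAt f z := fun z =>
    (ENat.natCast_toNat_le_self _).trans (min_le_left _ _)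
  have hmN : N ≤ ∑ z ∈ T, m z := by
    by_cases hbig : ∃ z ∈ T, (N : ℕ∞) ≤ analyticOrderAt f z
    · obtain ⟨z, hz, hle⟩ := hbig
      have : m z = N := by simp [hm, min_eq_right hle]
      exact this.ge.trans (Finset.single_le_sum (f := m) (fun _ _ => Nat.zero_le _) hz)
    · push Not at hbig
      have : ((∑ z ∈ T, m z : ℕ) : ℕ∞) = ∑ z ∈ T, analyticOrderAt f z := by
        rw [Nat.cast_sum]
        refine Finset.sum_congr rfl fun z hz => ?_
        have h1 := hbig z hz
        rw [hm]
        simp only [min_eq_left h1.le]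
        exact ENat.natCast_toNat h1.ne_top
      rw [← this] at hcon
      exact_mod_cast hcon
  -- Symmetrizing under conjugation makes the divisor a real polynomial. The maximum is legitimate
  -- because f vanishes to the same order at conjugate points.
  set m' : ℂ → ℕ := fun z => max (m z) (m ((starRingEnd ℂ) z)) with hm'
  set T' : Finset ℂ := T ∪ T.image (starRingEnd ℂ) with hT'
  have hT'U : ∀ z ∈ T', z ∈ U := by
    intro z hz
    rcases Finset.mem_union.1 hz with hz | hz
    · exact hT hz
    · obtain ⟨y, hy, rfl⟩ := Finset.mem_image.1 hz
      exact hc y (hT hy)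
  have hT'c : ∀ z ∈ T', (starRingEnd ℂ) z ∈ T' := by
    intro z hz
    rcases Finset.mem_union.1 hz with hz | hz
    · exact Finset.mem_union_right _ (Finset.mem_image_of_mem _ hz)
    · obtain ⟨y, hy, rfl⟩ := Finset.mem_image.1 hz
      rw [Complex.conj_conj]
      exact Finset.mem_union_left _ hy
  set W : ℂ[X] := ∏ ζ ∈ T', (X - C ζ) ^ m' ζ with hW
  have hWf : AnalyticDvd U W f := by
    refine AnalyticDvd.prod T' m' hf fun ζ hζ => ?_
    have h1 := analyticDvd_pow_of_le_order hU (hT'U ζ hζ) (m ζ) hf (hmle ζ)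
    have h2 := (analyticDvd_pow_of_le_order hU (hT'U _ (hT'c ζ hζ)) (m _) hf (hmle _)).conj hU hc hs
    rw [Complex.conj_conj] at h2
    rcases max_choice (m ζ) (m ((starRingEnd ℂ) ζ)) with h3 | h3
    · rw [hm']
      simp only [h3]
      exact h1
    · rw [hm']
      simp only [h3]
      exact h2
  have hWc : W.map (starRingEnd ℂ) = W := by
    rw [hW, Polynomial.map_prod]
    refine Finset.prod_bij (fun ζ _ => (starRingEnd ℂ) ζ) (fun z hz => hT'c z hz)
      (fun a _ b _ hab => (starRingEnd ℂ).injective hab)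
      (fun b hb => ⟨_, hT'c b hb, Complex.conj_conj b⟩) fun z hz => ?_
    simp [hm', max_comm]
  have hWm : W.Monic := monic_prod_of_monic _ _ fun ζ _ => (monic_X_sub_C ζ).pow _
  have hWdeg : N ≤ W.natDegree := by
    rw [hW, natDegree_prod_of_monic _ _ fun ζ _ => (monic_X_sub_C ζ).pow _]
    simp only [natDegree_pow, natDegree_X_sub_C, mul_one]
    calc N ≤ ∑ z ∈ T, m z := hmN
      _ ≤ ∑ z ∈ T, m' z := Finset.sum_le_sum fun z _ => le_max_left _ _
      _ ≤ ∑ z ∈ T', m' z := Finset.sum_le_sum_of_subset Finset.subset_union_left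
  obtain ⟨w, hw⟩ := exists_real_polynomial hWc
  have hw0 : w ≠ 0 := by
    rintro rfl
    rw [Polynomial.map_zero] at hw
    exact hWm.ne_zero hw.symm
  have := h w hw0 (fun z hz => ?_) (hw ▸ hWf)
  · rw [← hw, natDegree_map] at hWdeg
    omega
  · rw [← eval_map_real, hw, hW, eval_prod, Finset.prod_eq_zero_iff] at hz
    obtain ⟨ζ, hζ, h0⟩ := hz
    have := eq_zero_of_pow_eq_zero (by simpa using h0 : (z - ζ) ^ m' ζ = 0)
    rw [sub_eq_zero.1 this]
    exact hT'U ζ hζ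

end

/-! ### Families with few zeros: orthogonality and division by one function -/

/-- All polynomial combinations of the functions `u k`, `k ∈ J`, have few zeros on `U`. -/
def ATFamily {ι : Type*} (U : Set ℂ) (J : Finset ι) (u : ι → ℂ → ℂ) : Prop :=
  ∀ (n : ι → ℕ) (p : ι → ℝ[X]), (∀ k ∈ J, (p k).degree < n k) → (∃ k ∈ J, p k ≠ 0) →
    FewZeros U (∑ k ∈ J, n k) fun z => ∑ k ∈ J, aeval z (p k) * u k z

theorem degree_map_mul_lt {p : ℝ[X]} {a b : ℂ} {n m : ℕ} (hp : p.degree < n) (ha : a ≠ 0 → n + 1 ≤ m)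
    (hb : b ≠ 0 → n ≤ m) : (p.map (algebraMap ℝ ℂ) * (C a * X + C b)).degree < (m : WithBot ℕ) := by
  have hp' : (p.map (algebraMap ℝ ℂ)).degree < n := degree_map_le.trans_lt hp
  rw [mul_add]
  refine (degree_add_le _ _).trans_lt (max_lt ?_ ?_)
  · by_cases h : a = 0
    · simp [h]
    · rw [show p.map (algebraMap ℝ ℂ) * (C a * X) = C a * (p.map (algebraMap ℝ ℂ) * X) by ring,
        degree_C_mul h, degree_mul_X]
      refine lt_of_lt_of_le ?_ (Nat.cast_le.2 (ha h))
      by_cases h0 : p.map (algebraMap ℝ ℂ) = 0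
      · rw [h0, degree_zero, WithBot.bot_add]
        exact WithBot.bot_lt_coe _
      · rw [degree_eq_natDegree h0] at hp' ⊢
        exact_mod_cast Nat.succ_lt_succ (by exact_mod_cast hp')
  · by_cases h : b = 0
    · simp [h]
    · rw [mul_comm, degree_C_mul h]
      exact hp'.trans_le (Nat.cast_le.2 (hb h))

theorem isOpen_symm_offCut {K : Set ℝ} (hK : IsCompact K) :
    IsOpen (offCut K) ∧ ∀ z ∈ offCut K, (starRingEnd ℂ) z ∈ offCut K :=
  ⟨isOpen_offCut hK, fun _ => conj_mem_offCut⟩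

theorem ConjSymm.im_eq_zero {U : Set ℂ} {f : ℂ → ℂ} (hf : ConjSymm U f) {x : ℝ} (hx : (x : ℂ) ∈ U) :
    (f x).im = 0 := by
  have := hf _ hx
  rw [Complex.conj_ofReal] at this
  exact Complex.conj_eq_iff_im.1 this.symm

theorem aeval_ofReal (w : ℝ[X]) (x : ℝ) : aeval (x : ℂ) w = ((w.eval x : ℝ) : ℂ) := by
  have := Polynomial.aeval_algebraMap_apply ℂ x w
  simpa using this

/-- A function `Q + s ∫ G dμ / (z - x)`, where `deg Q < n` and `G` has fewer than `R` zeros near the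
support of `μ`, has fewer than `n + R` zeros. -/
theorem fewZeros_add_cauchy {μ : Measure ℝ} {K K' : Set ℝ} (hμ : Carried μ K) (hK' : IsCompact K')
    (hKK : Disjoint K K') {Q : ℂ[X]} {n R : ℕ} (hQ : Q.degree < n) {s : ℂ} (hs : s ≠ 0) {G : ℂ → ℂ}
    (hG : AnalyticOnNhd ℂ G (offCut K')) (hGs : ConjSymm (offCut K') G) (hGR : FewZeros (offCut K') R G) :
    FewZeros (offCut K) (n + R) fun z => Q.eval z + s * cauchy (fun x => G x) μ z := by
  intro w hw hwK hdvd
  by_contra hdeg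
  push Not at hdeg
  have hKsub : ∀ x ∈ K, (x : ℂ) ∈ offCut K' := fun x hx =>
    mem_offCut_ofReal.2 (Set.disjoint_left.1 hKK hx)
  have hU := isOpen_symm_offCut hK'
  obtain ⟨q, hqR, S, φ, hφ⟩ := hGR.exists_sign hU.1 hU.2 hG hGs hμ.ordConnected hKsub
  have hGc : ContinuousOn (fun x : ℝ => G x) K :=
    hG.continuousOn.comp Complex.continuous_ofReal.continuousOn hKsub
  have hpc : ∀ p : ℂ[X], ContinuousOn (fun x : ℝ => p.eval (x : ℂ)) K := fun p =>
    (p.continuous.comp Complex.continuous_ofReal).continuousOn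
  set q' := q.map (algebraMap ℝ ℂ) with hq'
  set w' := w.map (algebraMap ℝ ℂ) with hw'
  have hw'0 : w' ≠ 0 := (Polynomial.map_ne_zero_iff (algebraMap ℝ ℂ).injective).2 hw
  have hwx : ∀ x ∈ K, w'.eval (x : ℂ) ≠ 0 := fun x hx h0 => by
    rw [hw', eval_map_real] at h0
    exact mem_offCut_ofReal.1 (hwK _ h0) hx
  -- The density whose integral will vanish. By the choice of `q` and since `w` has no zeros on K,
  -- it has constant sign there, with only finitely many zeros.
  set h : ℝ → ℂ := fun x => q'.eval (x : ℂ) * G x / w'.eval (x : ℂ) with hh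
  have hhc : ContinuousOn h K := ((hpc q').mul hGc).div (hpc w') hwx
  obtain ⟨P₁, hP₁, hP₁d, -⟩ := hμ.exists_eval_mul_cauchy hGc q'
  obtain ⟨P₂, hP₂, hP₂d, hP₂c⟩ := hμ.exists_eval_mul_cauchy hhc w'
  obtain ⟨M, hM⟩ : ∃ M, w'.natDegree = M + 1 := by
    refine ⟨w'.natDegree - 1, ?_⟩
    rw [hw', natDegree_map]
    omega
  have hMdeg : n + R ≤ M + 1 := by rw [← hM, hw', natDegree_map]; exact hdeg
  have hwdeg : w'.degree ≤ (M + 1 : ℕ) := by rw [← hM]; exact degree_le_natDegree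
  -- Subtracting s w ĥ from q times the given function cancels the Cauchy transforms and leaves this
  -- polynomial. Both terms are analytic multiples of `w` off K, hence `w` divides D as a
  -- polynomial.
  set D := q' * Q + C s * P₁ - C s * P₂ with hD
  obtain ⟨g, hg, hgw⟩ := hdvd
  have hDdvd : w' ∣ D := by
    refine dvd_of_analyticDvd (isOpen_offCut hμ.compact) hw'0
      (fun z hz => hwK z (by rwa [hw', eval_map_real] at hz))
      ⟨fun z => q'.eval z * g z - s * cauchy h μ z, ?_, fun z hz => ?_⟩
    · refine (((AnalyticOnNhd.eval_polynomial q').mono (Set.subset_univ _)).mul hg).sub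
        (analyticOnNhd_const.mul (hμ.analyticOnNhd_cauchy hhc))
    · have h1 := hP₁ z hz
      have h2 := hP₂ z hz
      have h3 : cauchy (fun x => w'.eval (x : ℂ) * h x) μ z
          = cauchy (fun x => q'.eval (x : ℂ) * G x) μ z :=
        hμ.cauchy_congr (fun x hx => by rw [hh]; field_simp [hwx x hx]) z
      have h4 := hgw z hz
      rw [h3] at h2
      simp only [hD, eval_sub, eval_add, eval_mul, eval_C]
      linear_combination q'.eval z * h4 - s * h1 + s * h2
  have hq'deg : q'.degree ≤ q.natDegree := degree_map_le.trans degree_le_natDegree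
  have hA : (q' * Q + C s * P₁).degree < M := by
    have h1 : (q' * Q).degree < M := by
      rw [degree_mul]
      by_cases h0 : q' = 0
      · rw [h0, degree_zero, WithBot.bot_add]
        exact WithBot.bot_lt_coe _
      by_cases h0' : Q = 0
      · rw [h0', degree_zero, WithBot.add_bot]
        exact WithBot.bot_lt_coe _
      rw [degree_eq_natDegree h0, degree_eq_natDegree h0']
      rw [degree_eq_natDegree h0'] at hQ
      have h2 : Q.natDegree < n := by exact_mod_cast hQ
      have h3 : q'.natDegree ≤ q.natDegree := natDegree_map_le
      exact_mod_cast (by omega : q'.natDegree + Q.natDegree < M)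
    refine (degree_add_le _ _).trans_lt (max_lt h1 ?_)
    rw [degree_C_mul hs]
    refine lt_of_lt_of_le (hP₁d _ hq'deg) (Nat.cast_le.2 (by omega))
  have hD0 : D = 0 := by
    refine eq_zero_of_dvd_of_degree_lt hDdvd ?_
    rw [degree_eq_natDegree hw'0, hM]
    refine (degree_sub_le _ _).trans_lt (max_lt (hA.trans_le ?_) ?_)
    · exact_mod_cast Nat.le_succ M
    · rw [degree_C_mul hs]
      exact hP₂d _ hwdeg
  -- In D = 0, read the coefficient in degree M = deg w - 1. Only `P₂` reaches it, with the leading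
  -- coefficient of `w` times ∫ h dμ.
  have hint : ∫ x, h x ∂μ = 0 := by
    have h1 := congrArg (fun p => coeff p M) hD0
    simp only [hD, coeff_sub, coeff_zero, coeff_C_mul] at h1
    rw [coeff_eq_zero_of_degree_lt hA, hP₂c M hwdeg] at h1
    have h2 : w'.coeff (M + 1) ≠ 0 := by
      rw [← hM]
      exact leadingCoeff_ne_zero.2 hw'0
    simpa [hs, h2] using h1
  obtain ⟨ε, hε, hwε⟩ := Carried.exists_sign hμ.ordConnected (hpc w')
    (fun x hx => by rw [hw', eval_map_real, aeval_ofReal]; exact Complex.ofReal_im _) hwx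
  have hpos : 0 < ∫ x, ‖h x‖ ∂μ := by
    refine hμ.integral_pos_of_pos hhc.norm S (fun _ _ => norm_nonneg _) fun x hx hxS => ?_
    refine norm_ne_zero_iff.2 (div_ne_zero ?_ (hwx x hx))
    rw [hq', eval_map_real, aeval_ofReal, (hφ x hx).1]
    exact_mod_cast (hφ x hx).2.2 hxS
  have hhε : ∀ x ∈ K, h x = ε * ‖h x‖ := by
    intro x hx
    have h1 : h x = φ x / (ε * ‖w'.eval (x : ℂ)‖) := by
      rw [← hwε x hx, ← (hφ x hx).1, hh, hq']
      simp only [eval_map_real, aeval_ofReal]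
    have h2 : ‖h x‖ = φ x / ‖w'.eval (x : ℂ)‖ := by
      rw [hh]
      simp only [norm_div]
      rw [hq', eval_map_real, aeval_ofReal, (hφ x hx).1, Complex.norm_real, Real.norm_eq_abs,
        abs_of_nonneg (hφ x hx).2.1]
    rw [h2, h1]
    have : (‖w'.eval (x : ℂ)‖ : ℂ) ≠ 0 := by simpa using hwx x hx
    rcases hε with rfl | rfl
    · push_cast
      field_simp
    · push_cast
      field_simp
  rw [hμ.integral_congr hhε, integral_const_mul, integral_complex_ofReal] at hint
  have hε0 : (ε : ℂ) ≠ 0 := by rcases hε with rfl | rfl <;> norm_num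
  exact mul_ne_zero hε0 (by exact_mod_cast hpos.ne') hint

theorem fewZeros_eval {U : Set ℂ} (hU : IsOpen U) {Q : ℂ[X]} {n : ℕ} (hQ : Q.degree < n) (hQ0 : Q ≠ 0) :
    FewZeros U n fun z => Q.eval z := by
  intro w hw hwU hdvd
  have hw0 : w.map (algebraMap ℝ ℂ) ≠ 0 := (Polynomial.map_ne_zero_iff (algebraMap ℝ ℂ).injective).2 hw
  have h1 := dvd_of_analyticDvd hU hw0 (fun z hz => hwU z (by rwa [eval_map_real] at hz)) hdvd
  have h2 := natDegree_le_of_dvd h1 hQ0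
  rw [natDegree_map] at h2
  rw [degree_eq_natDegree hQ0] at hQ
  have : Q.natDegree < n := by exact_mod_cast hQ
  omega

theorem FewZeros.mono {U : Set ℂ} {f : ℂ → ℂ} {n m : ℕ} (h : FewZeros U n f) (hnm : n ≤ m) :
    FewZeros U m f :=
  fun w hw hU hd => (h w hw hU hd).trans_le hnm

theorem AnalyticOnNhd.aeval_real {U : Set ℂ} (p : ℝ[X]) : AnalyticOnNhd ℂ (fun z => aeval z p) U := by
  have := (AnalyticOnNhd.eval_polynomial (𝕜 := ℂ) (p.map (algebraMap ℝ ℂ))).mono (Set.subset_univ U)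
  simpa only [eval_map_real] using this

/-- Families with few zeros, one step in the induction over the number of functions: divide by one
function and use the zeros of the densities. -/
theorem fewZeros_step {ι : Type*} [DecidableEq ι] {μ : Measure ℝ} {K K' : Set ℝ} (hμ : Carried μ K)
    (hK' : IsCompact K') (hKK : Disjoint K K') {J : Finset ι} {j : ι} (hj : j ∈ J) {u g : ι → ℂ → ℂ}
    (hu : AnalyticOnNhd ℂ (u j) (offCut K)) (hu0 : ∀ z ∈ offCut K, u j z ≠ 0) {α β : ι → ℂ} {s : ℂ}
    (hs : s ≠ 0)
    (hrep : ∀ k ∈ J, k ≠ j → ∀ z ∈ offCut K,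
      u k z = u j z * (α k * z + β k + s * cauchy (fun x => g k x) μ z))
    (hg : ∀ k ∈ J, k ≠ j → AnalyticOnNhd ℂ (g k) (offCut K') ∧ ConjSymm (offCut K') (g k))
    (hAT : ATFamily (offCut K') (J.erase j) g) {n : ι → ℕ} {p : ι → ℝ[X]}
    (hα : ∀ k ∈ J, k ≠ j → α k ≠ 0 → n k + 1 ≤ n j) (hβ : ∀ k ∈ J, k ≠ j → β k ≠ 0 → n k ≤ n j)
    (hn : ∀ k ∈ J, k ≠ j → n k ≤ n j + 1) (hp : ∀ k ∈ J, (p k).degree < n k)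
    (hp0 : ∃ k ∈ J, p k ≠ 0) :
    FewZeros (offCut K) (∑ k ∈ J, n k) fun z => ∑ k ∈ J, aeval z (p k) * u k z := by
  have hU := isOpen_offCut hμ.compact
  -- Dividing by the zero-free function `u j` does not change the polynomial divisors.
  have hdiv : ∀ (N : ℕ) (f : ℂ → ℂ),
      (∀ z ∈ offCut K, ∑ k ∈ J, aeval z (p k) * u k z = u j z * f z) → FewZeros (offCut K) N f →
        FewZeros (offCut K) N fun z => ∑ k ∈ J, aeval z (p k) * u k z := by
    intro N f hf hN w hw hwU ⟨g, hg, hgw⟩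
    refine hN w hw hwU ⟨fun z => g z / u j z, hg.div hu hu0, fun z hz => ?_⟩
    have h1 := hf z hz
    simp only at hgw
    rw [hgw z hz] at h1
    have h2 := hu0 z hz
    field_simp
    linear_combination -h1
  rw [← Finset.add_sum_erase J n hj]
  have hmem : ∀ k ∈ J.erase j, k ∈ J ∧ k ≠ j := fun k hk =>
    ⟨Finset.mem_of_mem_erase hk, Finset.ne_of_mem_erase hk⟩
  by_cases hall : ∀ k ∈ J.erase j, p k = 0
  · refine hdiv _ (fun z => ((p j).map (algebraMap ℝ ℂ)).eval z) (fun z hz => ?_)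
      ((fewZeros_eval hU (degree_map_le.trans_lt (hp j hj)) ?_).mono (Nat.le_add_right _ _))
    · rw [← Finset.add_sum_erase J _ hj, Finset.sum_eq_zero fun k hk => by rw [hall k hk]; simp,
        eval_map_real]
      ring
    · rw [Polynomial.map_ne_zero_iff (algebraMap ℝ ℂ).injective]
      obtain ⟨k, hk, hk0⟩ := hp0
      by_cases hkj : k = j
      · exact hkj ▸ hk0
      · exact absurd (hall k (Finset.mem_erase.2 ⟨hkj, hk⟩)) hk0
  · push Not at hall
    have hKsub : ∀ x ∈ K, (x : ℂ) ∈ offCut K' := fun x hx =>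
      mem_offCut_ofReal.2 (Set.disjoint_left.1 hKK hx)
    have hgc : ∀ k ∈ J.erase j, ContinuousOn (fun x : ℝ => g k x) K := fun k hk =>
      (hg k (hmem k hk).1 (hmem k hk).2).1.continuousOn.comp
        Complex.continuous_ofReal.continuousOn hKsub
    have hP : ∀ k ∈ J.erase j, ∃ P : ℂ[X], P.degree < n j ∧ ∀ z ∈ offCut K,
        aeval z (p k) * cauchy (fun x => g k x) μ z =
          cauchy (fun x => aeval (x : ℂ) (p k) * g k x) μ z + P.eval z := by
      intro k hk
      obtain ⟨P, h1, h2, -⟩ := hμ.exists_eval_mul_cauchy (hgc k hk) ((p k).map (algebraMap ℝ ℂ))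
      simp only [eval_map_real] at h1
      refine ⟨P, h2 _ ?_, h1⟩
      -- Moving a polynomial of degree at most `n j` under the integral leaves a remainder of degree
      -- less than `n j`, so n k ≤ n j + 1 suffices here.
      have h3 : (p k).degree < (n j + 1 : ℕ) :=
        (hp k (hmem k hk).1).trans_le (Nat.cast_le.2 (hn k (hmem k hk).1 (hmem k hk).2))
      refine degree_map_le.trans ?_
      rw [← natDegree_le_iff_degree_le]
      by_cases h0 : p k = 0
      · simp [h0]
      · have h4 := (natDegree_lt_iff_degree_lt h0).2 h3
        omega
    choose! P hPd hP using hP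
    set G : ℂ → ℂ := fun z => ∑ k ∈ J.erase j, aeval z (p k) * g k z with hG
    set Q : ℂ[X] := (p j).map (algebraMap ℝ ℂ) +
      ∑ k ∈ J.erase j, ((p k).map (algebraMap ℝ ℂ) * (C (α k) * X + C (β k)) + C s * P k) with hQ
    refine hdiv _ (fun z => Q.eval z + s * cauchy (fun x => G x) μ z) (fun z hz => ?_)
      (fewZeros_add_cauchy hμ hK' hKK ?_ hs ?_ ?_ (hAT n p (fun k hk => hp k (hmem k hk).1) hall))
    · have h1 : cauchy (fun x => G x) μ z =
          ∑ k ∈ J.erase j, cauchy (fun x => aeval (x : ℂ) (p k) * g k x) μ z := by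
        simp only [cauchy, hG, Finset.sum_div]
        refine integral_finsetSum _ fun k hk => hμ.integrable (continuousOn_kernel hz ?_)
        refine ContinuousOn.mul ?_ (hgc k hk)
        exact (AnalyticOnNhd.aeval_real (U := Set.univ) (p k)).continuousOn.comp
          Complex.continuous_ofReal.continuousOn fun _ _ => Set.mem_univ _
      rw [h1, hQ, eval_add, eval_finsetSum, eval_map_real, Finset.mul_sum, add_assoc,
        ← Finset.sum_add_distrib, mul_add, Finset.mul_sum, ← Finset.add_sum_erase J _ hj]
      congr 1
      · ring
      refine Finset.sum_congr rfl fun k hk => ?_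
      have h2 := hP k hk z hz
      rw [hrep k (hmem k hk).1 (hmem k hk).2 z hz]
      simp only [eval_add, eval_mul, eval_map_real, eval_C, eval_X]
      linear_combination u j z * s * h2
    · refine (degree_add_le _ _).trans_lt (max_lt (degree_map_le.trans_lt (hp j hj)) ?_)
      refine (degree_sum_le _ _).trans_lt ((Finset.sup_lt_iff (WithBot.bot_lt_coe _)).2 fun k hk => ?_)
      refine (degree_add_le _ _).trans_lt (max_lt ?_ ?_)
      · exact degree_map_mul_lt (hp k (hmem k hk).1) (hα k (hmem k hk).1 (hmem k hk).2)
          (hβ k (hmem k hk).1 (hmem k hk).2)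
      · rw [degree_C_mul hs]
        exact hPd k hk
    · exact Finset.analyticOnNhd_fun_sum _ fun k hk =>
        (AnalyticOnNhd.aeval_real (p k)).mul (hg k (hmem k hk).1 (hmem k hk).2).1
    · intro z hz
      simp only [hG, map_sum, map_mul]
      refine Finset.sum_congr rfl fun k hk => ?_
      rw [aeval_conj_real, (hg k (hmem k hk).1 (hmem k hk).2).2 z hz]

/-! ### Minors on lists of columns and Sylvester's identity -/

/-- The minor of the infinite matrix `W` on the first `n` rows and the first `n` columns listed in
`c`. -/
noncomputable def minorAux (W : ℕ → ℕ → ℂ) (n : ℕ) (c : List ℕ) : ℂ :=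
  (Matrix.of fun a b : Fin n => W a (c.getD b 0)).det

/-- The minor of the infinite matrix `W` on the first rows and the columns listed in `c`. -/
noncomputable def listMinor (W : ℕ → ℕ → ℂ) (c : List ℕ) : ℂ :=
  minorAux W c.length c

/-- The determinant with first row `ρ` and the following rows from `W`, on the columns in `c`. -/
noncomputable def rowMinor (W : ℕ → ℕ → ℂ) (ρ : ℕ → ℂ) (n : ℕ) (c : List ℕ) : ℂ :=
  (Matrix.of fun a b : Fin (n + 1) => (Fin.cases (ρ (c.getD b 0)) (fun a' => W a' (c.getD b 0)) a : ℂ)).det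

section

variable (W : ℕ → ℕ → ℂ)

theorem minorAux_congr {W V : ℕ → ℕ → ℂ} {n : ℕ} {c d : List ℕ}
    (h : ∀ a < n, ∀ b < n, W a (c.getD b 0) = V a (d.getD b 0)) : minorAux W n c = minorAux V n d := by
  unfold minorAux
  congr 1
  ext a b
  exact h a a.2 b b.2

theorem minorAux_swap (n : ℕ) (P Q : List ℕ) (x y : ℕ) (hn : P.length + 1 < n) :
    minorAux W n (P ++ x :: y :: Q) = -minorAux W n (P ++ y :: x :: Q) := by
  set i : Fin n := ⟨P.length, by omega⟩ with hi
  set j : Fin n := ⟨P.length + 1, hn⟩ with hj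
  have hij : i ≠ j := by simp [hi, hj]
  have h := Matrix.det_permute' (Equiv.swap i j)
    (Matrix.of fun a b : Fin n => W a ((P ++ y :: x :: Q).getD b 0))
  rw [Equiv.Perm.sign_swap hij] at h
  have h2 : minorAux W n (P ++ x :: y :: Q) = (((Matrix.of fun a b : Fin n =>
      W a ((P ++ y :: x :: Q).getD b 0))).submatrix id (Equiv.swap i j)).det := by
    unfold minorAux
    congr 1
    ext a b
    simp only [Matrix.of_apply, Matrix.submatrix_apply, id_eq]
    congr 1
    by_cases hbi : b = i
    · subst hbi
      rw [Equiv.swap_apply_left]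
      simp [hi, hj]
    by_cases hbj : b = j
    · subst hbj
      rw [Equiv.swap_apply_right]
      simp [hi, hj]
    rw [Equiv.swap_apply_of_ne_of_ne hbi hbj]
    have h1 : (b : ℕ) ≠ P.length := fun h => hbi (Fin.ext h)
    have h2 : (b : ℕ) ≠ P.length + 1 := fun h => hbj (Fin.ext h)
    rcases lt_or_gt_of_ne h1 with hlt | hgt
    · rw [List.getD_append _ _ _ _ hlt, List.getD_append _ _ _ _ hlt]
    · rw [List.getD_append_right _ _ _ _ (by omega), List.getD_append_right _ _ _ _ (by omega)]
      obtain ⟨t, ht⟩ : ∃ t, (b : ℕ) - P.length = t + 2 := ⟨b - P.length - 2, by omega⟩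
      rw [ht]
      simp
  rw [h2, h]
  simp [minorAux]

theorem listMinor_swap (P Q : List ℕ) (x y : ℕ) :
    listMinor W (P ++ x :: y :: Q) = -listMinor W (P ++ y :: x :: Q) := by
  unfold listMinor
  rw [minorAux_swap _ _ _ _ _ _ (by simp)]
  simp

/-- Permuting the first columns changes minors by a sign that does not depend on the other columns or
on the matrix. -/
theorem exists_sign_listMinor_perm {L L' : List ℕ} (h : L.Perm L') :
    ∃ ε : ℝ, (ε = 1 ∨ ε = -1) ∧
      ∀ (W : ℕ → ℕ → ℂ) (T : List ℕ), listMinor W (L' ++ T) = ε * listMinor W (L ++ T) := by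
  suffices ∃ ε : ℝ, (ε = 1 ∨ ε = -1) ∧
      ∀ (W : ℕ → ℕ → ℂ) (P T : List ℕ), listMinor W (P ++ (L' ++ T)) = ε * listMinor W (P ++ (L ++ T)) by
    obtain ⟨ε, hε, h⟩ := this
    exact ⟨ε, hε, fun W T => h W [] T⟩
  induction h with
  | nil => exact ⟨1, Or.inl rfl, by simp⟩
  | cons x _ ih =>
    obtain ⟨ε, hε, ih⟩ := ih
    refine ⟨ε, hε, fun W P T => ?_⟩
    simpa using ih W (P ++ [x]) T
  | swap x y l =>
    refine ⟨-1, Or.inr rfl, fun W P T => ?_⟩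
    simpa using listMinor_swap W P (l ++ T) x y
  | trans _ _ ih₁ ih₂ =>
    obtain ⟨ε, hε, ih₁⟩ := ih₁
    obtain ⟨δ, hδ, ih₂⟩ := ih₂
    refine ⟨δ * ε, ?_, fun W P T => ?_⟩
    · rcases hε with rfl | rfl <;> rcases hδ with rfl | rfl <;> norm_num
    · rw [ih₂, ih₁]
      push_cast
      ring

theorem listMinor_nil : listMinor W [] = 1 := by
  simp [listMinor, minorAux]

theorem listMinor_singleton (k : ℕ) : listMinor W [k] = W 0 k := by
  simp [listMinor, minorAux]

theorem getD_map_succ {c : List ℕ} {b : ℕ} (hb : b < c.length) :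
    (c.map Nat.succ).getD b 0 = c.getD b 0 + 1 := by
  rw [List.getD_eq_getElem _ _ (by simpa using hb), List.getD_eq_getElem _ _ hb]
  simp

variable {W}

/-- Column 0 is a unit vector, so expansion along it deletes the first row and shifts the remaining
columns. -/
theorem listMinor_zero_cons (h0 : W 0 0 = 1) (hs : ∀ i, W (i + 1) 0 = 0) (c : List ℕ) :
    listMinor W (0 :: c.map Nat.succ) = listMinor (fun i k => W (i + 1) (k + 1)) c := by
  have : listMinor W (0 :: c.map Nat.succ) = minorAux W (c.length + 1) (0 :: c.map Nat.succ) := by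
    simp [listMinor]
  rw [this, minorAux, Matrix.det_succ_column_zero, Fin.sum_univ_succ,
    Finset.sum_eq_zero fun i _ => by simp [hs]]
  simp only [Fin.val_zero, pow_zero, Matrix.of_apply, List.getD_cons_zero, h0, one_mul, add_zero,
    listMinor, minorAux]
  congr 1
  ext a b
  simp only [Matrix.submatrix_apply, Matrix.of_apply, Fin.zero_succAbove, Fin.val_succ,
    List.getD_cons_succ]
  rw [getD_map_succ b.2]

theorem listMinor_map_succ {c : List ℕ} {n : ℕ} (hc : c.length = n + 1) :
    listMinor W (c.map Nat.succ) =
      rowMinor (fun i k => W (i + 1) (k + 1)) (fun k => W 0 (k + 1)) n c := by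
  have : listMinor W (c.map Nat.succ) = minorAux W (n + 1) (c.map Nat.succ) := by
    simp [listMinor, hc]
  rw [this, minorAux, rowMinor]
  congr 1
  ext a b
  simp only [Matrix.of_apply]
  rw [getD_map_succ (by omega)]
  refine Fin.cases ?_ (fun a' => ?_) a <;> simp

variable (W)

theorem rowMinor_eq_sum (ρ : ℕ → ℂ) (n : ℕ) (c : List ℕ) :
    rowMinor W ρ n c = ∑ b : Fin (n + 1), (-1) ^ (b : ℕ) * ρ (c.getD b 0) *
      (Matrix.of fun a i : Fin n => W a (c.getD (b.succAbove i) 0)).det := by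
  rw [rowMinor, Matrix.det_succ_row_zero]
  rfl

theorem rowMinor_row {i n : ℕ} (hi : i < n) (c : List ℕ) : rowMinor W (W i) n c = 0 := by
  rw [rowMinor]
  refine Matrix.det_zero_of_row_eq (i := 0) (j := (⟨i, hi⟩ : Fin n).succ) (Fin.succ_ne_zero _).symm ?_
  ext b
  simp

theorem rowMinor_sub_sum (ρ : ℕ → ℂ) {n r : ℕ} (hr : r ≤ n) (x : Fin r → ℂ) (c : List ℕ) :
    rowMinor W (fun k => ρ k - ∑ i, x i * W i k) n c = rowMinor W ρ n c := by
  have h : rowMinor W (fun k => ρ k - ∑ i, x i * W i k) n c =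
      rowMinor W ρ n c - ∑ i, x i * rowMinor W (W i) n c := by
    simp only [rowMinor_eq_sum, Finset.mul_sum]
    rw [Finset.sum_comm, ← Finset.sum_sub_distrib]
    refine Finset.sum_congr rfl fun b _ => ?_
    rw [mul_sub, sub_mul, Finset.mul_sum, Finset.sum_mul]
    congr 1
    exact Finset.sum_congr rfl fun i _ => by ring
  rw [h, Finset.sum_eq_zero fun i _ => by rw [rowMinor_row W (by omega), mul_zero], sub_zero]

theorem rowMinor_append_singleton {ρ : ℕ → ℂ} {A : List ℕ} (hρ : ∀ k ∈ A, ρ k = 0) (j : ℕ) :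
    rowMinor W ρ A.length (A ++ [j]) = (-1) ^ A.length * ρ j * listMinor W A := by
  rw [rowMinor_eq_sum, Fin.sum_univ_castSucc, Finset.sum_eq_zero, zero_add]
  · simp only [Fin.val_last, Fin.succAbove_last, Fin.val_castSucc, listMinor]
    congr 1
    · simp
    · refine minorAux_congr fun a _ b hb => ?_
      rw [List.getD_append _ _ _ _ hb]
  · intro b _
    have hb : ((b.castSucc : Fin (A.length + 1)) : ℕ) < A.length := b.2
    rw [List.getD_append _ _ _ _ hb, List.getD_eq_getElem _ _ hb, hρ _ (List.getElem_mem hb)]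
    simp

theorem rowMinor_append_pair {ρ : ℕ → ℂ} {A : List ℕ} (hρ : ∀ k ∈ A, ρ k = 0) (j k : ℕ) :
    rowMinor W ρ (A.length + 1) (A ++ [j, k]) = (-1) ^ A.length *
      (ρ j * listMinor W (A ++ [k]) - ρ k * listMinor W (A ++ [j])) := by
  rw [rowMinor_eq_sum, Fin.sum_univ_castSucc, Fin.sum_univ_castSucc, Finset.sum_eq_zero, zero_add]
  · have h1 : (Matrix.of fun a i : Fin (A.length + 1) =>
        W a ((A ++ [j, k]).getD ((Fin.last A.length).castSucc.succAbove i) 0)).det =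
          listMinor W (A ++ [k]) := by
      have : listMinor W (A ++ [k]) = minorAux W (A.length + 1) (A ++ [k]) := by simp [listMinor]
      rw [this, minorAux]
      congr 1
      ext a i
      simp only [Matrix.of_apply]
      congr 1
      refine Fin.lastCases ?_ (fun i => ?_) i
      · rw [Fin.succAbove_castSucc_of_le _ _ le_rfl]
        simp
      · rw [Fin.succAbove_castSucc_of_lt _ _ (Fin.castSucc_lt_last i)]
        simp only [Fin.val_castSucc]
        rw [List.getD_append _ _ _ _ i.2, List.getD_append _ _ _ _ i.2]
    have h2 : (Matrix.of fun a i : Fin (A.length + 1) =>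
        W a ((A ++ [j, k]).getD ((Fin.last (A.length + 1)).succAbove i) 0)).det =
          listMinor W (A ++ [j]) := by
      have : listMinor W (A ++ [j]) = minorAux W (A.length + 1) (A ++ [j]) := by simp [listMinor]
      rw [this, minorAux]
      congr 1
      ext a i
      simp only [Matrix.of_apply, Fin.succAbove_last, Fin.val_castSucc]
      congr 1
      rw [show A ++ [j, k] = (A ++ [j]) ++ [k] by simp, List.getD_append _ _ _ _ (by simp; omega)]
    rw [h1, h2]
    simp
    ring
  · intro b _
    have hb : ((b.castSucc.castSucc : Fin (A.length + 1 + 1)) : ℕ) < A.length := b.2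
    rw [List.getD_append _ _ _ _ hb, List.getD_eq_getElem _ _ hb, hρ _ (List.getElem_mem hb)]
    simp

variable {W}

/-- Sylvester's identity for the minors that are obtained by adding two columns. -/
theorem listMinor_sylvester {V : ℕ → ℕ → ℂ} (hV : ∀ i k, W (i + 1) (k + 1) = V i k) {A : List ℕ}
    (hA : listMinor V A ≠ 0) (j k : ℕ) :
    listMinor V A * listMinor W ((A ++ [j, k]).map Nat.succ) =
      listMinor W ((A ++ [j]).map Nat.succ) * listMinor V (A ++ [k]) -
        listMinor W ((A ++ [k]).map Nat.succ) * listMinor V (A ++ [j]) := by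
  have hV' : (fun i k => W (i + 1) (k + 1)) = V := by
    ext i k
    exact hV i k
  set ρ : ℕ → ℂ := fun k => W 0 (k + 1) with hρ
  set B : Matrix (Fin A.length) (Fin A.length) ℂ := Matrix.of fun a b => V a (A.getD b 0) with hB
  have hdet : IsUnit B.det := IsUnit.mk0 _ hA
  -- Because the minor of `V` on `A` is nonzero, a combination of its rows agrees with the first row
  -- on the columns in `A`. Subtracting it leaves at most two nonzero entries in the first row, and
  -- all three shifted minors expand at once.
  set x : Fin A.length → ℂ := Matrix.vecMul (fun b : Fin A.length => ρ (A.getD b 0)) B⁻¹ with hx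
  have hxB : Matrix.vecMul x B = fun b => ρ (A.getD (b : Fin A.length) 0) := by
    rw [hx, Matrix.vecMul_vecMul, Matrix.nonsing_inv_mul _ hdet, Matrix.vecMul_one]
  have h0 : ∀ k ∈ A, ρ k - ∑ i, x i * V i k = 0 := by
    intro k hk
    obtain ⟨b, hb, rfl⟩ := List.mem_iff_getElem.1 hk
    have := congrFun hxB ⟨b, hb⟩
    simp only [Matrix.vecMul, dotProduct, hB, Matrix.of_apply] at this
    rw [List.getD_eq_getElem _ _ hb] at this
    rw [this, sub_self]
  rw [listMinor_map_succ (n := A.length + 1) (by simp), listMinor_map_succ (n := A.length) (by simp),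
    listMinor_map_succ (n := A.length) (by simp), hV',
    ← rowMinor_sub_sum V ρ (Nat.le_succ _) x, ← rowMinor_sub_sum V ρ le_rfl x,
    ← rowMinor_sub_sum V ρ le_rfl x, rowMinor_append_singleton V h0, rowMinor_append_singleton V h0,
    rowMinor_append_pair V h0]
  ring

end

/-! ### Identities off the real line and leading behaviour at infinity -/

theorem closure_im_ne_zero : closure {z : ℂ | z.im ≠ 0} = Set.univ := by
  refine Set.eq_univ_of_forall fun z => ?_
  rcases le_total 0 z.im with h | h
  · have : z ∈ closure {z : ℂ | 0 < z.im} := by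
      rw [Complex.closure_setOfPred_lt_im]
      exact h
    exact closure_mono (fun w hw => ne_of_gt hw) this
  · have : z ∈ closure {z : ℂ | z.im < 0} := by
      rw [Complex.closure_setOfPred_im_lt]
      exact h
    exact closure_mono (fun w hw => ne_of_lt hw) this

/-- Nonreal points are dense and avoid all cuts, so identities between minors are proved there and
then extended to each function's larger domain by continuity. -/
theorem eqOn_of_im_ne_zero {U : Set ℂ} (hU : IsOpen U) {f g : ℂ → ℂ} (hf : ContinuousOn f U)
    (hg : ContinuousOn g U) (h : ∀ z : ℂ, z.im ≠ 0 → f z = g z) : ∀ z ∈ U, f z = g z := by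
  intro z hz
  have hne : (𝓝[{z : ℂ | z.im ≠ 0}] z).NeBot := by
    rw [← mem_closure_iff_nhdsWithin_neBot, closure_im_ne_zero]
    trivial
  have h1 : Tendsto f (𝓝[{z : ℂ | z.im ≠ 0}] z) (𝓝 (f z)) :=
    (hf.continuousAt (hU.mem_nhds hz)).mono_left nhdsWithin_le_nhds
  have h2 : Tendsto g (𝓝[{z : ℂ | z.im ≠ 0}] z) (𝓝 (g z)) :=
    (hg.continuousAt (hU.mem_nhds hz)).mono_left nhdsWithin_le_nhds
  exact tendsto_nhds_unique h1 (h2.congr' (eventually_nhdsWithin_of_forall fun w hw => (h w hw).symm))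

/-- The function `f` is equivalent at infinity to a nonzero multiple of `z ^ (-d)`. -/
def HasLead (d : ℤ) (f : ℂ → ℂ) : Prop :=
  ∃ l : ℂ, l ≠ 0 ∧ Tendsto (fun z => z ^ d * f z) (Bornology.cobounded ℂ) (𝓝 l)

namespace HasLead

variable {f g : ℂ → ℂ} {d e : ℤ}

theorem _root_.eventually_ne_zero_cobounded : ∀ᶠ z : ℂ in Bornology.cobounded ℂ, z ≠ 0 := by
  filter_upwards [tendsto_norm_cobounded_atTop.eventually_gt_atTop (0 : ℝ)] with z hz
  exact norm_pos_iff.1 hz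

theorem congr' (hf : HasLead d f) (h : ∀ᶠ z in Bornology.cobounded ℂ, f z = g z) : HasLead d g := by
  obtain ⟨l, hl, ht⟩ := hf
  refine ⟨l, hl, ht.congr' ?_⟩
  filter_upwards [h] with z hz
  rw [hz]

theorem mul (hf : HasLead d f) (hg : HasLead e g) : HasLead (d + e) fun z => f z * g z := by
  obtain ⟨l, hl, ht⟩ := hf
  obtain ⟨k, hk, hs⟩ := hg
  refine ⟨l * k, mul_ne_zero hl hk, (ht.mul hs).congr' ?_⟩
  filter_upwards [eventually_ne_zero_cobounded] with z hz
  rw [zpow_add₀ hz]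
  ring

theorem div (hf : HasLead d f) (hg : HasLead e g) : HasLead (d - e) fun z => f z / g z := by
  obtain ⟨l, hl, ht⟩ := hf
  obtain ⟨k, hk, hs⟩ := hg
  refine ⟨l / k, div_ne_zero hl hk, (ht.div hs hk).congr' ?_⟩
  filter_upwards [eventually_ne_zero_cobounded] with z hz
  rw [zpow_sub₀ hz, Pi.div_apply, mul_div_mul_comm]

theorem const_mul {c : ℂ} (hc : c ≠ 0) (hf : HasLead d f) : HasLead d fun z => c * f z := by
  obtain ⟨l, hl, ht⟩ := hf
  refine ⟨c * l, mul_ne_zero hc hl, (ht.const_mul c).congr fun z => by ring⟩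

theorem tendsto_zero (hf : HasLead d f) (hd : 0 < d) : Tendsto f (Bornology.cobounded ℂ) (𝓝 0) := by
  obtain ⟨l, hl, ht⟩ := hf
  have h1 : Tendsto (fun z : ℂ => z ^ (-d)) (Bornology.cobounded ℂ) (𝓝 0) := by
    obtain ⟨n, rfl⟩ := Int.eq_ofNat_of_zero_le hd.le
    have : Tendsto (fun z : ℂ => (z⁻¹) ^ n) (Bornology.cobounded ℂ) (𝓝 (0 ^ n)) :=
      tendsto_inv₀_cobounded.pow n
    rw [zero_pow (by rintro rfl; simp at hd)] at this
    exact this.congr fun z => by simp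
  have := h1.mul ht
  rw [zero_mul] at this
  refine this.congr' ?_
  filter_upwards [eventually_ne_zero_cobounded] with z hz
  rw [← mul_assoc, ← zpow_add₀ hz, neg_add_cancel, zpow_zero, one_mul]

section affine

variable {a b : ℂ} {r : ℂ → ℂ}

theorem tendsto_inv_mul_affine (hr : Tendsto r (Bornology.cobounded ℂ) (𝓝 0)) :
    Tendsto (fun z => z⁻¹ * (a * z + b + r z)) (Bornology.cobounded ℂ) (𝓝 a) := by
  have h1 : Tendsto (fun z : ℂ => a + z⁻¹ * (b + r z)) (Bornology.cobounded ℂ) (𝓝 (a + 0 * (b + 0))) :=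
    (tendsto_inv₀_cobounded.mul (hr.const_add b)).const_add a
  rw [zero_mul, add_zero] at h1
  refine h1.congr' ?_
  filter_upwards [eventually_ne_zero_cobounded] with z hz
  field_simp
  ring

/-- Together with the next two lemmas this reads off, from the order of a quotient at infinity,
which coefficients of its affine part are present. These facts decide which degrees are admissible
when dividing linear forms. -/
theorem slope_eq_zero (hf : HasLead d fun z => a * z + b + r z) (hd : 0 ≤ d)
    (hr : Tendsto r (Bornology.cobounded ℂ) (𝓝 0)) : a = 0 := by
  have h1 : HasLead 1 fun z : ℂ => z⁻¹ := by
    refine ⟨1, one_ne_zero, tendsto_const_nhds.congr' ?_⟩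
    filter_upwards [eventually_ne_zero_cobounded] with z hz
    rw [zpow_one, mul_inv_cancel₀ hz]
  exact tendsto_nhds_unique (tendsto_inv_mul_affine hr) ((h1.mul hf).tendsto_zero (by omega))

theorem const_eq_zero (hf : HasLead d fun z => a * z + b + r z) (hd : 0 < d)
    (hr : Tendsto r (Bornology.cobounded ℂ) (𝓝 0)) : b = 0 := by
  have h1 := hf.tendsto_zero hd
  rw [hf.slope_eq_zero hd.le hr] at h1
  have h2 : Tendsto (fun z => (0 : ℂ) * z + b + r z) (Bornology.cobounded ℂ) (𝓝 (0 + b + 0)) := by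
    simpa using hr.const_add b
  simpa using tendsto_nhds_unique h2 h1

theorem slope_ne_zero (hf : HasLead (-1) fun z => a * z + b + r z)
    (hr : Tendsto r (Bornology.cobounded ℂ) (𝓝 0)) : a ≠ 0 := by
  obtain ⟨l, hl, ht⟩ := hf
  have h1 : Tendsto (fun z => z⁻¹ * (a * z + b + r z)) (Bornology.cobounded ℂ) (𝓝 l) := by
    simpa using ht
  rw [tendsto_nhds_unique (tendsto_inv_mul_affine hr) h1]
  exact hl

end affine

end HasLead

/-! ### Divided differences and exchange of integrations -/

namespace SupportedOn

variable {μ ν : Measure ℝ} {K L : Set ℝ}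

theorem hasLead_cauchy (h : SupportedOn μ K) {φ : ℝ → ℂ} (hφ : ContinuousOn φ K)
    (h0 : ∫ x, φ x ∂μ ≠ 0) : HasLead 1 (cauchy φ μ) :=
  ⟨_, h0, by simpa using h.tendsto_mul_cauchy hφ⟩

variable {φ : ℝ → ℂ} {a b : ℂ}

/-- The divided difference of `a z + b + ∫ φ dν / (z - y)`. -/
theorem affine_add_cauchy_sub (hν : SupportedOn ν L) (hφ : ContinuousOn φ L) {z t : ℂ}
    (hz : z ∈ offCut L) (ht : t ∈ offCut L) :
    (a * z + b + cauchy φ ν z) - (a * t + b + cauchy φ ν t) =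
      (z - t) * (a - cauchy (fun y => φ y / (z - y)) ν t) := by
  have h1 : cauchy φ ν z - cauchy φ ν t = -((z - t) * cauchy (fun y => φ y / (z - y)) ν t) := by
    simp only [cauchy]
    rw [← integral_sub (hν.integrable (continuousOn_kernel hz hφ))
      (hν.integrable (continuousOn_kernel ht hφ)), ← integral_const_mul, ← integral_neg]
    refine hν.integral_congr fun y hy => ?_
    have h1 := sub_ne_zero_of_mem_offCut hz hy
    have h2 := sub_ne_zero_of_mem_offCut ht hy
    field_simp
    ring
  linear_combination h1

variable {g : ℝ → ℂ}

theorem ofReal_mem_offCut_of_disjoint (hKL : Disjoint K L) {x : ℝ} (hx : x ∈ K) : (x : ℂ) ∈ offCut L :=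
  mem_offCut_ofReal.2 (Set.disjoint_left.1 hKL hx)

theorem continuousOn_ofReal_comp (hKL : Disjoint K L) {f : ℂ → ℂ} (hf : ContinuousOn f (offCut L)) :
    ContinuousOn (fun x : ℝ => f x) K :=
  hf.comp Complex.continuous_ofReal.continuousOn fun _ hx => ofReal_mem_offCut_of_disjoint hKL hx

/-- With b(z) = az + b + φ̂(z), the left side is ∫ g(t)(b(z) - b(t))/(z - t) dμ(t), and the divided
difference is again a Cauchy transform, now in t. -/
theorem mul_cauchy_sub_cauchy_mul (hμ : SupportedOn μ K) (hν : SupportedOn ν L) (hKL : Disjoint K L)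
    (hg : ContinuousOn g K) (hφ : ContinuousOn φ L) {z : ℂ} (hz : z ∈ offCut K) (hz' : z ∈ offCut L) :
    (a * z + b + cauchy φ ν z) * cauchy g μ z -
        cauchy (fun t => g t * (a * t + b + cauchy φ ν t)) μ z =
      ∫ t, g t * (a - cauchy (fun y => φ y / (z - y)) ν t) ∂μ := by
  have h1 : ContinuousOn (fun t : ℝ => a * (t : ℂ) + b + cauchy φ ν t) K :=
    ContinuousOn.add (by fun_prop) (continuousOn_ofReal_comp hKL (hν.continuousOn_cauchy hφ))
  have h2 : ContinuousOn (fun t : ℝ => g t * (a * t + b + cauchy φ ν t)) K := hg.mul h1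
  rw [show cauchy g μ z = ∫ t : ℝ, g t / (z - t) ∂μ from rfl,
    show cauchy (fun t => g t * (a * t + b + cauchy φ ν t)) μ z =
      ∫ t : ℝ, g t * (a * t + b + cauchy φ ν t) / (z - t) ∂μ from rfl,
    ← integral_const_mul, ← integral_sub ((hμ.integrable (continuousOn_kernel hz hg)).const_mul _)
    (hμ.integrable (continuousOn_kernel hz h2))]
  refine hμ.integral_congr fun t ht => ?_
  have h2 := affine_add_cauchy_sub hν hφ hz' (ofReal_mem_offCut_of_disjoint hKL ht) (a := a) (b := b)
  have h3 := sub_ne_zero_of_mem_offCut hz ht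
  field_simp
  linear_combination g t * h2

/-- Fubini, applicable as the kernel is continuous on K × L for disjoint K and L. It turns an
integral over K into a Cauchy transform over L, so the cut moves from one interval to the next. -/
theorem integral_mul_sub_cauchy (hμ : SupportedOn μ K) (hν : SupportedOn ν L) (hKL : Disjoint K L)
    (hg : ContinuousOn g K) (hφ : ContinuousOn φ L) {z : ℂ} (hz' : z ∈ offCut L) :
    ∫ t, g t * (a - cauchy (fun y => φ y / (z - y)) ν t) ∂μ =
      a * ∫ t, g t ∂μ + cauchy (fun y => φ y * cauchy g μ y) ν z := by
  have hφz := continuousOn_kernel hz' hφ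
  have h1 := continuousOn_ofReal_comp hKL (hν.continuousOn_cauchy hφz)
  have h2 : ContinuousOn (fun t : ℝ => g t * cauchy (fun y => φ y / (z - y)) ν t) K := hg.mul h1
  simp only [mul_sub]
  rw [integral_sub ((hμ.integrable hg).mul_const a) (hμ.integrable h2),
    integral_mul_const,
    mul_comm, sub_eq_add_neg]
  congr 1
  simp only [cauchy]
  simp only [← integral_const_mul]
  have hne : ∀ x ∈ K, ∀ y ∈ L, (x : ℂ) - y ≠ 0 := fun x hx y hy => by
    rw [sub_ne_zero]
    exact_mod_cast fun h : x = y => Set.disjoint_left.1 hKL hx (h ▸ hy)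
  rw [integral_swap hμ hν, ← integral_neg]
  · refine hν.integral_congr fun y hy => ?_
    rw [← integral_neg, ← integral_div]
    refine hμ.integral_congr fun x hx => ?_
    have h2 := sub_ne_zero_of_mem_offCut hz' hy
    have h3 := hne x hx y hy
    have h4 : (y : ℂ) - x ≠ 0 := by
      rw [← neg_sub]
      exact neg_ne_zero.2 h3
    field_simp
    ring
  · refine ContinuousOn.mul (hg.comp continuousOn_fst fun p hp => hp.1) ?_
    refine ContinuousOn.div (hφz.comp continuousOn_snd fun p hp => hp.2) (by fun_prop) ?_
    exact fun p hp => hne p.1 hp.1 p.2 hp.2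

end SupportedOn

/-- For real z off the interval K, the kernel 1/(z - x) has constant sign on K; for nonreal z the
imaginary part is already nonzero. -/
theorem Carried.cauchy_ne_zero {μ : Measure ℝ} {K : Set ℝ} (h : Carried μ K) {φ : ℝ → ℂ} (hφ : ContinuousOn φ K)
    (hre : ∀ x ∈ K, (φ x).im = 0) (h0 : ∀ x ∈ K, φ x ≠ 0) {z : ℂ} (hz : z ∈ offCut K) :
    cauchy φ μ z ≠ 0 := by
  by_cases hzr : z.im = 0
  · obtain ⟨y, rfl⟩ : ∃ y : ℝ, (y : ℂ) = z := ⟨z.re, Complex.ext rfl (by simp [hzr])⟩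
    refine h.integral_ne_zero (continuousOn_kernel hz hφ) (fun x hx => ?_) fun x hx =>
      div_ne_zero (h0 x hx) (sub_ne_zero_of_mem_offCut hz hx)
    rw [← Complex.conj_eq_iff_im]
    simp [Complex.conj_eq_iff_im.2 (hre x hx)]
  · intro h1
    exact h.im_cauchy_ne_zero hφ hre h0 hzr (by rw [h1]; rfl)

/-! ### Minors of the Nikishin matrix and the zero bound they imply -/

/-- The sequence without its first term. -/
abbrev tailSeq {α : Type*} (f : ℕ → α) : ℕ → α := fun i => f (i + 1)

/-- The functions `1, μ̂₀, ⟨μ₀, μ₁⟩^, ⟨μ₀, μ₁, μ₂⟩^, …` of the Nikishin system generated by a sequence of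
positive measures. -/
noncomputable def nikishinFun : (ℕ → Measure ℝ) → ℕ → ℂ → ℂ
  | _, 0 => fun _ => 1
  | μ, k + 1 => cauchy (fun x => nikishinFun (tailSeq μ) k x) (μ 0)

/-- The matrix whose row `i` consists of the functions of the Nikishin system generated by the
measures `μ i, μ (i + 1), …`. -/
noncomputable def nikishinMatrix : (ℕ → Measure ℝ) → ℂ → ℕ → ℕ → ℂ
  | μ, z, 0, k => nikishinFun μ k z
  | _, _, _ + 1, 0 => 0
  | μ, z, i + 1, k + 1 => nikishinMatrix (tailSeq μ) z i k

/-- A sequence of positive measures on compact intervals, consecutive ones being disjoint. -/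
structure NikishinChain (μ : ℕ → Measure ℝ) (K : ℕ → Set ℝ) : Prop where
  carried : ∀ i, Carried (μ i) (K i)
  disjoint : ∀ i, Disjoint (K i) (K (i + 1))

/-- The minor of the matrix of a Nikishin system on the columns in `c`. -/
noncomputable def nikishinMinor (μ : ℕ → Measure ℝ) (c : List ℕ) (z : ℂ) : ℂ :=
  listMinor (nikishinMatrix μ z) c

/-- The analytic continuation of the minor across the parts of the real line where it exists. -/
noncomputable def minorExt (μ : ℕ → Measure ℝ) (c : List ℕ) : ℂ → ℂ :=
  extendFrom {z : ℂ | z.im ≠ 0} (nikishinMinor μ c)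

/-- The set outside of which minors of size `q` are analytic. -/
def cutSet (K : ℕ → Set ℝ) : ℕ → Set ℝ
  | 0 => ∅
  | q + 1 => K q

/-- The order of vanishing at infinity of the minor on the columns in `c`. -/
def minorLead (c : List ℕ) : ℕ := c.countP (c.length ≤ ·)

/-- The minor on the columns in `c` continues analytically to the complement of one interval and has
no zeros there. -/
structure RegularMinor (μ : ℕ → Measure ℝ) (K : ℕ → Set ℝ) (c : List ℕ) : Prop where
  analytic : AnalyticOnNhd ℂ (minorExt μ c) (offCut (cutSet K c.length))
  conj : ConjSymm (offCut (cutSet K c.length)) (minorExt μ c)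
  ne_zero : ∀ z ∈ offCut (cutSet K c.length), minorExt μ c z ≠ 0
  eq : ∀ z : ℂ, z.im ≠ 0 → minorExt μ c z = nikishinMinor μ c z
  lead : HasLead (minorLead c) (minorExt μ c)

theorem NikishinChain.tail {μ : ℕ → Measure ℝ} {K : ℕ → Set ℝ} (h : NikishinChain μ K) :
    NikishinChain (tailSeq μ) (tailSeq K) :=
  ⟨fun i => h.carried (i + 1), fun i => h.disjoint (i + 1)⟩

theorem NikishinChain.isCompact_cutSet {μ : ℕ → Measure ℝ} {K : ℕ → Set ℝ} (h : NikishinChain μ K) (q : ℕ) :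
    IsCompact (cutSet K q) := by
  cases q with
  | zero => exact isCompact_empty
  | succ q => exact (h.carried q).compact

theorem cutSet_tail_subset (K : ℕ → Set ℝ) (q : ℕ) : cutSet (tailSeq K) q ⊆ cutSet K (q + 1) := by
  cases q with
  | zero => exact Set.empty_subset _
  | succ q => exact subset_rfl

namespace RegularMinor

variable {μ : ℕ → Measure ℝ} {K : ℕ → Set ℝ} {c : List ℕ}

/-- A continuous function equal to the minor at nonreal points is its extension, so regularity may
be checked on any explicit formula. -/
theorem of_eq (hμ : NikishinChain μ K) {f : ℂ → ℂ} (hf : AnalyticOnNhd ℂ f (offCut (cutSet K c.length)))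
    (hc : ConjSymm (offCut (cutSet K c.length)) f) (h0 : ∀ z ∈ offCut (cutSet K c.length), f z ≠ 0)
    (heq : ∀ z : ℂ, z.im ≠ 0 → f z = nikishinMinor μ c z) (hl : HasLead (minorLead c) f) :
    RegularMinor μ K c ∧ ∀ z ∈ offCut (cutSet K c.length), minorExt μ c z = f z := by
  have hU := isOpen_offCut (hμ.isCompact_cutSet c.length)
  have key : ∀ z ∈ offCut (cutSet K c.length), minorExt μ c z = f z := by
    intro z hz
    refine extendFrom_eq (by rw [closure_im_ne_zero]; trivial) ?_
    refine ((hf z hz).continuousAt.mono_left nhdsWithin_le_nhds).congr' ?_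
    exact eventually_nhdsWithin_of_forall fun w hw => heq w hw
  refine ⟨⟨hf.congr hU fun z hz => (key z hz).symm, fun z hz => ?_, fun z hz => ?_, fun z hz => ?_, ?_⟩, key⟩
  · rw [key _ (conj_mem_offCut hz), key z hz, hc z hz]
  · rw [key z hz]
    exact h0 z hz
  · rw [key z (mem_offCut_of_im_ne_zero hz), heq z hz]
  · refine hl.congr' ?_
    have : ∀ᶠ z in Bornology.cobounded ℂ, z ∈ offCut (cutSet K c.length) :=
      Bornology.isBounded_def.1
        ((hμ.isCompact_cutSet c.length).image Complex.continuous_ofReal).isBounded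
    filter_upwards [this] with z hz
    rw [key z hz]

theorem perm (hμ : NikishinChain μ K) (h : RegularMinor μ K c) {c' : List ℕ} (hc : c.Perm c') :
    RegularMinor μ K c' := by
  obtain ⟨ε, hε, hs⟩ := exists_sign_listMinor_perm hc
  have hε0 : (ε : ℂ) ≠ 0 := by rcases hε with rfl | rfl <;> norm_num
  have hlen := hc.length_eq
  have hlead : minorLead c = minorLead c' := by
    unfold minorLead
    rw [hlen, hc.countP_eq]
  refine (of_eq (f := fun z => ε * minorExt μ c z) hμ ?_ ?_ ?_ ?_ ?_).1
  · rw [← hlen]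
    exact analyticOnNhd_const.mul h.analytic
  · rw [← hlen]
    intro z hz
    simp [h.conj z hz]
  · rw [← hlen]
    exact fun z hz => mul_ne_zero hε0 (h.ne_zero z hz)
  · intro z hz
    have := hs (nikishinMatrix μ z) []
    simp only [List.append_nil] at this
    rw [h.eq z hz, nikishinMinor, nikishinMinor, this]
  · rw [← hlead]
    exact h.lead.const_mul hε0

end RegularMinor

/-- The quotients of minors that differ in one column are Cauchy transforms of a measure with a density
given by larger minors, up to polynomials. -/
def HasQuotientRep (μ : ℕ → Measure ℝ) (K : ℕ → Set ℝ) (m : ℕ) (S : List ℕ) (j : ℕ) : Prop :=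
  ∃ ω : Measure ℝ, Carried ω (K S.length) ∧ ∃ s : ℝ, (s = 1 ∨ s = -1) ∧ ∀ k < m, k ∉ S → k ≠ j →
    ∃ α β : ℝ, ∀ z : ℂ, z.im ≠ 0 → nikishinMinor μ (S ++ [k]) z = nikishinMinor μ (S ++ [j]) z *
      (α * z + β + s * cauchy (fun x => minorExt μ (S ++ [j, k]) x) ω z)

/-- The list has distinct entries less than `m`. -/
def Columns (m : ℕ) (c : List ℕ) : Prop := c.Nodup ∧ ∀ x ∈ c, x < m

/-- All minors on the first `m` columns are regular and have quotient representations. -/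
structure RegularSystem (m : ℕ) (μ : ℕ → Measure ℝ) (K : ℕ → Set ℝ) : Prop where
  chain : NikishinChain μ K
  regular : ∀ c, Columns m c → RegularMinor μ K c
  rep : ∀ S j, Columns m (S ++ [j]) → HasQuotientRep μ K m S j

theorem Columns.append_singleton {m : ℕ} {S : List ℕ} {k : ℕ} (hS : Columns m S) (hk : k < m)
    (hkS : k ∉ S) : Columns m (S ++ [k]) := by
  refine ⟨List.nodup_append.2 ⟨hS.1, List.nodup_singleton k, ?_⟩, ?_⟩
  · intro a ha b hb h
    rw [List.mem_singleton] at hb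
    exact hkS (hb ▸ h ▸ ha)
  · intro x hx
    rcases List.mem_append.1 hx with hx | hx
    · exact hS.2 x hx
    · rw [List.mem_singleton.1 hx]
      exact hk

theorem Columns.of_append {m : ℕ} {S T : List ℕ} (h : Columns m (S ++ T)) : Columns m S :=
  ⟨(List.nodup_append.1 h.1).1, fun x hx => h.2 x (List.mem_append_left _ hx)⟩

theorem Columns.last {m : ℕ} {S : List ℕ} {j : ℕ} (h : Columns m (S ++ [j])) : j < m ∧ j ∉ S :=
  ⟨h.2 j (by simp), fun hj => (List.nodup_append.1 h.1).2.2 j hj j (by simp) rfl⟩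

theorem Columns.append_pair {m : ℕ} {S : List ℕ} {j k : ℕ} (h : Columns m (S ++ [j])) (hk : k < m)
    (hkS : k ∉ S) (hkj : k ≠ j) : Columns m (S ++ [j, k]) := by
  have := h.append_singleton hk (by simp [hkS, hkj])
  simpa using this

theorem minorLead_append_singleton (S : List ℕ) (k : ℕ) :
    minorLead (S ++ [k]) = S.countP (S.length + 1 ≤ ·) + if S.length < k then 1 else 0 := by
  simp [minorLead, List.countP_append, List.countP_singleton]

namespace RegularSystem

variable {m : ℕ} {μ : ℕ → Measure ℝ} {K : ℕ → Set ℝ}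

theorem continuousOn_minorExt (h : RegularSystem m μ K) {S : List ℕ} {j : ℕ} (hS : Columns m (S ++ [j]))
    {k : ℕ} (hk : k < m) (hkS : k ∉ S) (hkj : k ≠ j) :
    ContinuousOn (fun x : ℝ => minorExt μ (S ++ [j, k]) x) (K S.length) := by
  have h1 := (h.regular _ (hS.append_pair hk hkS hkj)).analytic.continuousOn
  have h2 : cutSet K (S ++ [j, k]).length = K (S.length + 1) := by simp [cutSet]
  rw [h2] at h1
  exact SupportedOn.continuousOn_ofReal_comp (h.chain.disjoint _) h1

/-- The quotient representation off the cut, and its coefficients. -/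
theorem exists_rep (h : RegularSystem m μ K) {S : List ℕ} {j : ℕ} (hS : Columns m (S ++ [j])) :
    ∃ ω : Measure ℝ, Carried ω (K S.length) ∧ ∃ s : ℝ, (s = 1 ∨ s = -1) ∧ ∀ k < m, k ∉ S → k ≠ j →
      ∃ α β : ℝ, (∀ z ∈ offCut (K S.length), minorExt μ (S ++ [k]) z = minorExt μ (S ++ [j]) z *
        (α * z + β + s * cauchy (fun x => minorExt μ (S ++ [j, k]) x) ω z)) ∧
      (α ≠ 0 ↔ S.length < j ∧ k ≤ S.length) ∧ (β ≠ 0 → S.length < k → S.length < j) := by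
  obtain ⟨ω, hω, s, hs, hrep⟩ := h.rep S j hS
  refine ⟨ω, hω, s, hs, fun k hk hkS hkj => ?_⟩
  obtain ⟨α, β, hz⟩ := hrep k hk hkS hkj
  have hc := h.continuousOn_minorExt hS hk hkS hkj
  have hj := h.regular _ hS
  have hk' := h.regular _ (hS.of_append.append_singleton hk hkS)
  have e1 : ∀ i, cutSet K (S ++ [i]).length = K S.length := fun i => by simp [cutSet]
  have key : ∀ z ∈ offCut (K S.length), minorExt μ (S ++ [k]) z = minorExt μ (S ++ [j]) z *
        (α * z + β + s * cauchy (fun x => minorExt μ (S ++ [j, k]) x) ω z) := by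
    refine eqOn_of_im_ne_zero (isOpen_offCut hω.compact) ?_ ?_ fun z hz' => ?_
    · have := hk'.analytic.continuousOn
      rwa [e1] at this
    · have := hj.analytic.continuousOn
      rw [e1] at this
      exact this.mul (ContinuousOn.add (by fun_prop)
        (continuousOn_const.mul (hω.continuousOn_cauchy hc)))
    · rw [hk'.eq z hz', hj.eq z hz', hz z hz']
  have hr : Tendsto (fun z => (s : ℂ) * cauchy (fun x => minorExt μ (S ++ [j, k]) x) ω z)
      (Bornology.cobounded ℂ) (𝓝 0) := by
    simpa using (hω.tendsto_cauchy hc).const_mul (s : ℂ)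
  -- With r the length of S, the order of the quotient is [r < k] - [r < j]. It is -1 exactly when
  -- the slope survives, and +1 exactly when the constant must vanish too.
  have hlead : HasLead (minorLead (S ++ [k]) - minorLead (S ++ [j]) : ℤ) fun z => (α : ℂ) * z + β +
      s * cauchy (fun x => minorExt μ (S ++ [j, k]) x) ω z := by
    refine (hk'.lead.div hj.lead).congr' ?_
    filter_upwards [hω.eventually_mem_offCut] with z hz'
    rw [key z hz', mul_div_cancel_left₀]
    exact hj.ne_zero z (by rwa [e1])
  refine ⟨α, β, key, ?_, ?_⟩
  · rw [minorLead_append_singleton, minorLead_append_singleton] at hlead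
    constructor
    · intro hα
      by_contra hcon
      refine hα ?_
      have := hlead.slope_eq_zero (by split_ifs <;> push_cast <;> omega) hr
      exact_mod_cast this
    · rintro ⟨h1, h2⟩
      rw [if_neg (by omega), if_pos h1] at hlead
      push_cast at hlead
      rw [show ((S.countP (S.length + 1 ≤ ·) : ℕ) : ℤ) + 0 - ((S.countP (S.length + 1 ≤ ·) : ℕ) + 1)
        = -1 by ring] at hlead
      exact_mod_cast hlead.slope_ne_zero hr
  · intro hβ h1
    rw [minorLead_append_singleton, minorLead_append_singleton] at hlead
    by_contra h2
    refine hβ ?_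
    rw [if_pos h1, if_neg h2] at hlead
    have := hlead.const_eq_zero (by push_cast; omega) hr
    exact_mod_cast this

/-- Minors that differ in the last column form a family with few zeros. -/
theorem atFamily (h : RegularSystem m μ K) (J : Finset ℕ) :
    ∀ S : List ℕ, Columns m S → (∀ k ∈ J, k < m ∧ k ∉ S) →
      ATFamily (offCut (K S.length)) J fun k => minorExt μ (S ++ [k]) := by
  induction hN : J.card generalizing J with
  | zero =>
    intro S _ _ n p _ ⟨k, hk, _⟩
    rw [Finset.card_eq_zero.1 hN] at hk
    simp at hk
  | succ N ih =>
    intro S hS hJ n p hp hp0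
    -- The correction by [r < k] matches the order at infinity. Maximality gives n k ≤ n j + [r < k]
    -- - [r < j]: one spare degree exactly when the slope is nonzero, and an excess of one only when
    -- slope and constant both vanish.
    obtain ⟨j, hj, hmax⟩ := Finset.exists_max_image J
      (fun k => (n k : ℤ) - if S.length < k then 1 else 0) (Finset.card_pos.1 (by omega))
    have hSj := hS.append_singleton (hJ j hj).1 (hJ j hj).2
    obtain ⟨ω, hω, s, hs, hrep⟩ := h.exists_rep hSj
    choose! α β hrep hα hβ using hrep
    have e1 : ∀ i, cutSet K (S ++ [i]).length = K S.length := fun i => by simp [cutSet]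
    have e2 : ∀ i k, cutSet K (S ++ [i, k]).length = K (S.length + 1) := fun i k => by simp [cutSet]
    have hreg := h.regular _ hSj
    refine fewZeros_step (g := fun k => minorExt μ (S ++ [j, k])) (α := fun k => α k)
      (β := fun k => β k) (s := s) (K' := K (S.length + 1)) hω
      (h.chain.carried _).compact (h.chain.disjoint _) hj ?_ ?_ ?_ ?_ ?_ ?_ ?_ ?_ ?_ hp hp0
    · exact e1 j ▸ hreg.analytic
    · exact e1 j ▸ hreg.ne_zero
    · rcases hs with rfl | rfl <;> norm_num
    · intro k hk hkj z hz
      exact hrep k (hJ k hk).1 (hJ k hk).2 hkj z hz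
    · intro k hk hkj
      have := h.regular _ (hSj.append_pair (hJ k hk).1 (hJ k hk).2 hkj)
      exact ⟨e2 j k ▸ this.analytic, e2 j k ▸ this.conj⟩
    · have := ih (J.erase j) (by rw [Finset.card_erase_of_mem hj]; omega) (S ++ [j]) hSj fun k hk => by
        have hk' := Finset.mem_of_mem_erase hk
        refine ⟨(hJ k hk').1, ?_⟩
        simp [(hJ k hk').2, Finset.ne_of_mem_erase hk]
      simpa using this
    · intro k hk hkj hk0
      have h1 := (hα k (hJ k hk).1 (hJ k hk).2 hkj).1 (by exact_mod_cast hk0)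
      have h2 := hmax k hk
      rw [if_pos h1.1, if_neg (by omega)] at h2
      omega
    · intro k hk hkj hk0
      have h1 := hβ k (hJ k hk).1 (hJ k hk).2 hkj (by exact_mod_cast hk0)
      have h2 := hmax k hk
      split_ifs at h2 <;> omega
    · intro k hk hkj
      have h2 := hmax k hk
      split_ifs at h2 <;> omega

end RegularSystem

theorem nikishinMinor_zero_cons (μ : ℕ → Measure ℝ) (c : List ℕ) (z : ℂ) :
    nikishinMinor μ (0 :: c.map Nat.succ) z = nikishinMinor (tailSeq μ) c z :=
  listMinor_zero_cons rfl (fun _ => rfl) c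

theorem nikishinMinor_nil (μ : ℕ → Measure ℝ) (z : ℂ) : nikishinMinor μ [] z = 1 := listMinor_nil _

theorem nikishinMinor_singleton (μ : ℕ → Measure ℝ) (k : ℕ) (z : ℂ) :
    nikishinMinor μ [k] z = nikishinFun μ k z := by
  rw [nikishinMinor, listMinor_singleton]
  rfl

theorem nikishinMinor_sylvester {μ : ℕ → Measure ℝ} {A : List ℕ} {z : ℂ}
    (hA : nikishinMinor (tailSeq μ) A z ≠ 0) (j k : ℕ) :
    nikishinMinor (tailSeq μ) A z * nikishinMinor μ ((A ++ [j, k]).map Nat.succ) z =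
      nikishinMinor μ ((A ++ [j]).map Nat.succ) z * nikishinMinor (tailSeq μ) (A ++ [k]) z -
        nikishinMinor μ ((A ++ [k]).map Nat.succ) z *
          nikishinMinor (tailSeq μ) (A ++ [j]) z :=
  listMinor_sylvester (W := nikishinMatrix μ z) (V := nikishinMatrix (tailSeq μ) z) (fun _ _ => rfl)
    hA j k

/-! ### Minors that avoid column 0 -/

section

variable {m : ℕ} {μ : ℕ → Measure ℝ} {K : ℕ → Set ℝ}

/-- The quotients of shifted minors by minors of the tail are Cauchy transforms. -/
def HasShiftedRep (m : ℕ) (μ : ℕ → Measure ℝ) (K : ℕ → Set ℝ) (A : List ℕ) : Prop :=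
  ∃ ω : Measure ℝ, Carried ω (K A.length) ∧ ∃ s : ℝ, (s = 1 ∨ s = -1) ∧ ∀ k < m, k ∉ A →
    ∃ c : ℝ, ∀ z : ℂ, z.im ≠ 0 → nikishinMinor μ ((A ++ [k]).map Nat.succ) z =
      nikishinMinor (tailSeq μ) A z * (c + s * cauchy (fun x => minorExt (tailSeq μ) (A ++ [k]) x) ω z)

theorem minorLead_map_succ_append_singleton (A : List ℕ) (k : ℕ) :
    minorLead ((A ++ [k]).map Nat.succ) = minorLead A + if A.length ≤ k then 1 else 0 := by
  simp [minorLead, List.countP_append, List.countP_map, List.countP_singleton, Function.comp_def]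

theorem minorLead_map_succ_append_pair (A : List ℕ) (j k : ℕ) :
    minorLead ((A ++ [j, k]).map Nat.succ) =
      minorLead (A ++ [j]) + if A.length < k then 1 else 0 := by
  rw [show A ++ [j, k] = (A ++ [j]) ++ [k] by simp, minorLead_map_succ_append_singleton]
  simp

theorem RegularSystem.tail_facts (h : RegularSystem m (tailSeq μ) (tailSeq K)) {A : List ℕ} {k : ℕ}
    (hA : Columns m (A ++ [k])) :
    (AnalyticOnNhd ℂ (minorExt (tailSeq μ) (A ++ [k])) (offCut (K (A.length + 1)))) ∧
    (ConjSymm (offCut (K (A.length + 1))) (minorExt (tailSeq μ) (A ++ [k]))) ∧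
    (∀ z ∈ offCut (K (A.length + 1)), minorExt (tailSeq μ) (A ++ [k]) z ≠ 0) := by
  have h1 := h.regular _ hA
  have e : cutSet (tailSeq K) (A ++ [k]).length = K (A.length + 1) := by simp [cutSet]
  exact ⟨e ▸ h1.analytic, e ▸ h1.conj, e ▸ h1.ne_zero⟩

/-- Two shifted columns: formulas for the quotients of the minors. -/
theorem exists_pair_formula (hμ : NikishinChain μ K) (h : RegularSystem m (tailSeq μ) (tailSeq K)) {A : List ℕ} {j : ℕ}
    (hA : Columns m (A ++ [j])) (hX : HasShiftedRep m μ K A)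
    (hreg : ∀ k < m, k ∉ A → RegularMinor μ K ((A ++ [k]).map Nat.succ)) :
    ∃ (ω ω' : Measure ℝ) (s s' c : ℝ) (H : ℂ → ℂ),
      Carried ω (K A.length) ∧ Carried ω' (K (A.length + 1)) ∧ (s = 1 ∨ s = -1) ∧ (s' = 1 ∨ s' = -1) ∧
      (∀ z, H z = c + s * cauchy (fun x => minorExt (tailSeq μ) (A ++ [j]) x) ω z) ∧
      AnalyticOnNhd ℂ H (offCut (K A.length)) ∧ ConjSymm (offCut (K A.length)) H ∧
      (∀ z ∈ offCut (K A.length), H z ≠ 0) ∧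
      (∀ z : ℂ, z.im ≠ 0 → nikishinMinor μ ((A ++ [j]).map Nat.succ) z = nikishinMinor (tailSeq μ) A z * H z) ∧
      (A.length ≤ j → c = 0) ∧
      ∀ k < m, k ∉ A → k ≠ j → ∃ c' α β κ : ℝ,
        (A.length ≤ k → c' = 0) ∧
        (α ≠ 0 ↔ A.length < j ∧ k ≤ A.length) ∧
        (κ : ℂ) = c * β - c' + s * (α * ∫ x, minorExt (tailSeq μ) (A ++ [j]) x ∂ω) ∧
        (∀ z ∈ offCut (K (A.length + 1)), minorExt (tailSeq μ) (A ++ [k]) z = minorExt (tailSeq μ) (A ++ [j]) z *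
          (α * z + β + s' * cauchy (fun x => minorExt (tailSeq μ) (A ++ [j, k]) x) ω' z)) ∧
        (∀ z : ℂ, z.im ≠ 0 → nikishinMinor μ ((A ++ [k]).map Nat.succ) z = nikishinMinor (tailSeq μ) A z *
          ((α * z + β + s' * cauchy (fun x => minorExt (tailSeq μ) (A ++ [j, k]) x) ω' z) * H z -
            (κ + s' * cauchy (fun x => minorExt (tailSeq μ) (A ++ [j, k]) x * H x) ω' z))) ∧
        (∀ z : ℂ, z.im ≠ 0 → nikishinMinor μ ((A ++ [j, k]).map Nat.succ) z =
          nikishinMinor (tailSeq μ) (A ++ [j]) z *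
            (κ + s' * cauchy (fun x => minorExt (tailSeq μ) (A ++ [j, k]) x * H x) ω' z)) := by
  obtain ⟨ω, hω, s, hs, hX⟩ := hX
  obtain ⟨ω', hω', s', hs', hrep⟩ := h.exists_rep hA
  have hAc : Columns m A := hA.of_append
  have hd : Disjoint (K A.length) (K (A.length + 1)) := hμ.disjoint _
  have hgc : ∀ k, Columns m (A ++ [k]) → ContinuousOn (fun x : ℝ => minorExt (tailSeq μ) (A ++ [k]) x) (K A.length) :=
    fun k hk => SupportedOn.continuousOn_ofReal_comp hd (h.tail_facts hk).1.continuousOn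
  have hgre : ∀ k, Columns m (A ++ [k]) → ∀ x ∈ K A.length, (minorExt (tailSeq μ) (A ++ [k]) x).im = 0 :=
    fun k hk x hx => (h.tail_facts hk).2.1.im_eq_zero (SupportedOn.ofReal_mem_offCut_of_disjoint hd hx)
  have hregA := h.regular A hAc
  have hAne : ∀ z : ℂ, z.im ≠ 0 → nikishinMinor (tailSeq μ) A z ≠ 0 := fun z hz => by
    rw [← hregA.eq z hz]
    exact hregA.ne_zero z (mem_offCut_of_im_ne_zero hz)
  have hAoff : offCut (K A.length) ⊆ offCut (cutSet (tailSeq K) A.length) :=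
    offCut_mono (cutSet_tail_subset K A.length)
  have e : ∀ k, cutSet K ((A ++ [k]).map Nat.succ).length = K A.length := fun k => by simp [cutSet]
  have hc0 : ∀ k, k < m → k ∉ A → ∀ c : ℝ, (∀ z : ℂ, z.im ≠ 0 →
      nikishinMinor μ ((A ++ [k]).map Nat.succ) z = nikishinMinor (tailSeq μ) A z *
        (c + s * cauchy (fun x => minorExt (tailSeq μ) (A ++ [k]) x) ω z)) →
      (∀ z ∈ offCut (K A.length), minorExt μ ((A ++ [k]).map Nat.succ) z = minorExt (tailSeq μ) A z *
        (c + s * cauchy (fun x => minorExt (tailSeq μ) (A ++ [k]) x) ω z)) ∧ (A.length ≤ k → c = 0) := by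
    intro k hk hkA c hc
    have hkc := hAc.append_singleton hk hkA
    have hr := hreg k hk hkA
    have key : ∀ z ∈ offCut (K A.length), minorExt μ ((A ++ [k]).map Nat.succ) z = minorExt (tailSeq μ) A z *
        (c + s * cauchy (fun x => minorExt (tailSeq μ) (A ++ [k]) x) ω z) := by
      refine eqOn_of_im_ne_zero (isOpen_offCut hω.compact) ?_ ?_ fun z hz => ?_
      · exact e k ▸ hr.analytic.continuousOn
      · exact (hregA.analytic.continuousOn.mono hAoff).mul (continuousOn_const.add
          (continuousOn_const.mul (hω.continuousOn_cauchy (hgc k hkc))))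
      · rw [hr.eq z hz, hregA.eq z hz, hc z hz]
    refine ⟨key, fun hle => ?_⟩
    have hl : HasLead (minorLead ((A ++ [k]).map Nat.succ) - minorLead A : ℤ) fun z =>
        (0 : ℂ) * z + c + s * cauchy (fun x => minorExt (tailSeq μ) (A ++ [k]) x) ω z := by
      refine (hr.lead.div hregA.lead).congr' ?_
      filter_upwards [hω.eventually_mem_offCut] with z hz
      rw [key z hz, mul_div_cancel_left₀ _ (hregA.ne_zero z (hAoff hz)), zero_mul, zero_add]
    have := hl.const_eq_zero (by
      rw [minorLead_map_succ_append_singleton, if_pos hle]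
      push_cast
      omega) (by simpa using (hω.tendsto_cauchy (hgc k hkc)).const_mul (s : ℂ))
    exact_mod_cast this
  obtain ⟨c, hc⟩ := hX j hA.last.1 hA.last.2
  obtain ⟨hHz, hcz⟩ := hc0 j hA.last.1 hA.last.2 c hc
  set H : ℂ → ℂ := fun z => c + s * cauchy (fun x => minorExt (tailSeq μ) (A ++ [j]) x) ω z with hH
  have hs0 : (s : ℂ) ≠ 0 := by rcases hs with rfl | rfl <;> norm_num
  have hHan : AnalyticOnNhd ℂ H (offCut (K A.length)) :=
    analyticOnNhd_const.add (analyticOnNhd_const.mul (hω.analyticOnNhd_cauchy (hgc j hA)))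
  refine ⟨ω, ω', s, s', c, H, hω, hω', hs, hs', fun z => rfl, hHan, fun z hz => ?_, fun z hz h0 => ?_, hc,
    hcz, fun k hk hkA hkj => ?_⟩
  · simp [hH, hω.cauchy_conj (hgre j hA)]
  · have := hHz z hz
    rw [show (c + s * cauchy (fun x => minorExt (tailSeq μ) (A ++ [j]) x) ω z : ℂ) = 0 from h0, mul_zero] at this
    exact (hreg j hA.last.1 hA.last.2).ne_zero z (by rwa [e]) this
  obtain ⟨α, β, hαβ, hα, -⟩ := hrep k hk hkA hkj
  obtain ⟨c', hc'⟩ := hX k hk hkA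
  have hkc := hAc.append_singleton hk hkA
  -- The product `H` times the affine part could contain the term cαz. It does not: a slope needs
  -- A.length < j, and then c = 0 by the order at infinity.
  have hcα : c * α = 0 := by
    by_cases h0 : α = 0
    · rw [h0, mul_zero]
    · rw [hcz (hα.1 h0).1.le, zero_mul]
  set I : ℂ := ∫ x, minorExt (tailSeq μ) (A ++ [j]) x ∂ω with hI
  have hIre : I = I.re := Complex.ext rfl (by simpa using hω.integral_im_eq_zero (hgre j hA))
  set γ : ℝ → ℂ := fun x => minorExt (tailSeq μ) (A ++ [j, k]) x with hγ
  have hγc : ContinuousOn γ (K (A.length + 1)) := h.continuousOn_minorExt hA hk hkA hkj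
  have hregj := h.regular _ hA
  have hregk := h.regular _ hkc
  -- The heart of the computation. Let g_k be the tail minor on A ++ [k] and b the bracket with g_k
  -- = g_j b. Then bĝ_j and the transform of g_j b differ by a divided difference, which Fubini
  -- rewrites as a constant plus a transform over the next interval.
  have main : ∀ z : ℂ, z.im ≠ 0 →
      (α * z + β + s' * cauchy γ ω' z) * H z -
        (c' + s * cauchy (fun x => minorExt (tailSeq μ) (A ++ [k]) x) ω z) =
      c * β - c' + s * (α * I) + s' * cauchy (fun x => γ x * H x) ω' z := by
    intro z hz
    have hz1 : z ∈ offCut (K A.length) := mem_offCut_of_im_ne_zero hz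
    have hz2 : z ∈ offCut (K (A.length + 1)) := mem_offCut_of_im_ne_zero hz
    have hγs : ContinuousOn (fun x => s' * γ x) (K (A.length + 1)) := continuousOn_const.mul hγc
    have h1 := hω.toSupportedOn.mul_cauchy_sub_cauchy_mul (a := α) (b := β) hω'.toSupportedOn hd (hgc j hA)
      hγs hz1 hz2
    rw [hω.toSupportedOn.integral_mul_sub_cauchy hω'.toSupportedOn hd (hgc j hA) hγs hz2] at h1
    have h2 : cauchy (fun t => minorExt (tailSeq μ) (A ++ [j]) t *
        (α * t + β + cauchy (fun x => s' * γ x) ω' t)) ω z =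
          cauchy (fun x => minorExt (tailSeq μ) (A ++ [k]) x) ω z := by
      refine hω.cauchy_congr (fun x hx => ?_) z
      rw [hαβ x (SupportedOn.ofReal_mem_offCut_of_disjoint hd hx), cauchy_const_mul]
    have hjc : ContinuousOn (fun y : ℝ => cauchy (fun x => minorExt (tailSeq μ) (A ++ [j]) x) ω y) (K (A.length + 1)) :=
      SupportedOn.continuousOn_ofReal_comp hd.symm (hω.continuousOn_cauchy (hgc j hA))
    have h3 : cauchy (fun x => γ x * H x) ω' z = c * cauchy γ ω' z +
        s * cauchy (fun x => γ x * cauchy (fun x => minorExt (tailSeq μ) (A ++ [j]) x) ω x) ω' z := by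
      have h5 : ContinuousOn (fun x => c * γ x) (K (A.length + 1)) := continuousOn_const.mul hγc
      have h6 : ContinuousOn (fun x : ℝ => s * (γ x * cauchy (fun x => minorExt (tailSeq μ) (A ++ [j]) x) ω x))
          (K (A.length + 1)) := continuousOn_const.mul (hγc.mul hjc)
      rw [← cauchy_const_mul, ← cauchy_const_mul, ← hω'.cauchy_add h5 h6 hz2]
      refine hω'.cauchy_congr (fun x _ => ?_) z
      simp only [hH]
      ring
    have h4 : cauchy (fun y => s' * γ y * cauchy (fun x => minorExt (tailSeq μ) (A ++ [j]) x) ω y) ω' z =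
        s' * cauchy (fun x => γ x * cauchy (fun x => minorExt (tailSeq μ) (A ++ [j]) x) ω x) ω' z := by
      rw [← cauchy_const_mul]
      exact hω'.cauchy_congr (fun x _ => by ring) z
    rw [h2, cauchy_const_mul, h4] at h1
    have hcα' : (c : ℂ) * α = 0 := by exact_mod_cast hcα
    rw [h3]
    simp only [hH]
    linear_combination (s : ℂ) * h1 + z * hcα'
  have hκ : ((c * β - c' + s * (α * I.re) : ℝ) : ℂ) = c * β - c' + s * (α * I) := by
    rw [hIre]
    push_cast
    simp
  refine ⟨c', α, β, c * β - c' + s * (α * I.re), (hc0 k hk hkA c' hc').2, hα, hκ, hαβ, fun z hz => ?_,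
    fun z hz => ?_⟩
  · rw [hκ, ← main z hz, hc' z hz]
    ring
  -- Sylvester's identity expresses the minor with two added columns by exactly the difference
  -- evaluated in `main`.
  · have h1 := nikishinMinor_sylvester (hAne z hz) j k
    have h2 := hαβ z (mem_offCut_of_im_ne_zero hz)
    rw [hregk.eq z hz, hregj.eq z hz] at h2
    rw [hc z hz, hc' z hz, h2] at h1
    refine mul_left_cancel₀ (hAne z hz) (h1.trans ?_)
    have h3 := main z hz
    rw [hκ, ← h3]
    simp only [hH]
    ring

end

section

variable {m : ℕ} {μ : ℕ → Measure ℝ} {K : ℕ → Set ℝ}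

theorem analyticOnNhd_nikishinFun (hμ : NikishinChain μ K) (k : ℕ) :
    AnalyticOnNhd ℂ (nikishinFun μ k) (offCut (K 0)) ∧ ConjSymm (offCut (K 0)) (nikishinFun μ k) := by
  induction k generalizing μ K with
  | zero => exact ⟨analyticOnNhd_const, fun z _ => by simp [nikishinFun]⟩
  | succ k ih =>
    have h1 := ih hμ.tail
    refine ⟨(hμ.carried 0).analyticOnNhd_cauchy
      (SupportedOn.continuousOn_ofReal_comp (hμ.disjoint 0) h1.1.continuousOn), fun z _ => ?_⟩
    exact (hμ.carried 0).cauchy_conj (fun _ hx => h1.2.im_eq_zero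
      (SupportedOn.ofReal_mem_offCut_of_disjoint (hμ.disjoint 0) hx)) z

theorem minorExt_singleton (hμ : NikishinChain μ K) (k : ℕ) {z : ℂ} (hz : z ∈ offCut (K 0)) :
    minorExt μ [k] z = nikishinFun μ k z := by
  refine extendFrom_eq (by rw [closure_im_ne_zero]; trivial) ?_
  refine (((analyticOnNhd_nikishinFun hμ k).1 z hz).continuousAt.mono_left nhdsWithin_le_nhds).congr' ?_
  exact eventually_nhdsWithin_of_forall fun w _ => (nikishinMinor_singleton μ k w).symm

theorem nikishinFun_succ (hμ : NikishinChain μ K) (k : ℕ) (z : ℂ) :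
    nikishinFun μ (k + 1) z = cauchy (fun x => minorExt (tailSeq μ) [k] x) (μ 0) z :=
  (hμ.carried 0).cauchy_congr (fun _ hx => (minorExt_singleton hμ.tail k
    (SupportedOn.ofReal_mem_offCut_of_disjoint (hμ.disjoint 0) hx)).symm) z

theorem hasShiftedRep_nil (hμ : NikishinChain μ K) (m : ℕ) : HasShiftedRep m μ K [] := by
  refine ⟨μ 0, hμ.carried 0, 1, Or.inl rfl, fun k _ _ => ⟨0, fun z hz => ?_⟩⟩
  simp only [List.nil_append, List.map_cons, List.map_nil]
  rw [nikishinMinor_nil, nikishinMinor_singleton, nikishinFun_succ hμ]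
  simp

theorem regularMinor_nil (hμ : NikishinChain μ K) : RegularMinor μ K [] := by
  refine (RegularMinor.of_eq (f := fun _ => 1) hμ analyticOnNhd_const (fun _ _ => by simp)
    (fun _ _ => one_ne_zero) (fun z _ => (nikishinMinor_nil μ z).symm) ?_).1
  exact ⟨1, one_ne_zero, by simp [minorLead]⟩

theorem regularMinor_singleton (hμ : NikishinChain μ K) (h : RegularSystem m (tailSeq μ) (tailSeq K))
    {k : ℕ} (hk : k < m) : RegularMinor μ K [k + 1] := by
  have hd := hμ.disjoint 0
  have hA : Columns m ([] ++ [k]) := by simp [Columns, hk]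
  obtain ⟨h1, h2, h3⟩ := h.tail_facts hA
  simp only [List.nil_append, List.length_nil, zero_add] at h1 h2 h3
  have hc := SupportedOn.continuousOn_ofReal_comp hd h1.continuousOn
  have hre : ∀ x ∈ K 0, (minorExt (tailSeq μ) [k] x).im = 0 := fun x hx =>
    h2.im_eq_zero (SupportedOn.ofReal_mem_offCut_of_disjoint hd hx)
  have hne : ∀ x ∈ K 0, minorExt (tailSeq μ) [k] x ≠ 0 := fun x hx =>
    h3 x (SupportedOn.ofReal_mem_offCut_of_disjoint hd hx)
  have h0 := hμ.carried 0
  refine (RegularMinor.of_eq (c := [k + 1]) (f := cauchy (fun x => minorExt (tailSeq μ) [k] x) (μ 0)) hμ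
    (h0.analyticOnNhd_cauchy hc) (fun z _ => h0.cauchy_conj hre z)
    (fun z hz => h0.cauchy_ne_zero hc hre hne hz) (fun z _ => ?_) ?_).1
  · rw [nikishinMinor_singleton, nikishinFun_succ hμ]
  · have : minorLead [k + 1] = 1 := by simp [minorLead]
    rw [this]
    exact h0.hasLead_cauchy hc (h0.integral_ne_zero hc hre hne)

/-- The factor `H` has no zeros on the next interval, hence constant sign there; |H| is absorbed
into the measure, which stays positive and independent of k. -/
theorem hasShiftedRep_append (hμ : NikishinChain μ K) (h : RegularSystem m (tailSeq μ) (tailSeq K))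
    {A : List ℕ} {j : ℕ} (hA : Columns m (A ++ [j])) (hX : HasShiftedRep m μ K A)
    (hreg : ∀ k < m, k ∉ A → RegularMinor μ K ((A ++ [k]).map Nat.succ)) :
    HasShiftedRep m μ K (A ++ [j]) := by
  obtain ⟨ω, ω', s, s', c, H, hω, hω', hs, hs', -, hH, hHc, hH0, -, -, hk⟩ :=
    exists_pair_formula hμ h hA hX hreg
  have hd := (hμ.disjoint A.length).symm
  have hHcont := SupportedOn.continuousOn_ofReal_comp hd hH.continuousOn
  have hmem : ∀ x ∈ K (A.length + 1), (x : ℂ) ∈ offCut (K A.length) := fun x hx =>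
    SupportedOn.ofReal_mem_offCut_of_disjoint hd hx
  obtain ⟨t, ht, hHt⟩ := Carried.exists_sign hω'.ordConnected hHcont
    (fun x hx => hHc.im_eq_zero (hmem x hx)) fun x hx => hH0 x (hmem x hx)
  obtain ⟨ν, hν, hνint⟩ := hω'.exists_withDensity hHcont.norm fun x hx => norm_pos_iff.2 (hH0 x (hmem x hx))
  refine ⟨ν, by simpa using hν, s' * t, ?_, fun k hkm hkA => ?_⟩
  · rcases hs' with rfl | rfl <;> rcases ht with rfl | rfl <;> norm_num
  simp only [List.mem_append, List.mem_singleton, not_or] at hkA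
  obtain ⟨-, -, -, κ, -, -, -, -, -, hE⟩ := hk k hkm hkA.1 hkA.2
  refine ⟨κ, fun z hz => ?_⟩
  simp only [List.append_assoc, List.cons_append, List.nil_append]
  rw [hE z hz]
  congr 2
  rw [Complex.ofReal_mul, mul_assoc]
  congr 1
  simp only [cauchy]
  rw [hνint, ← integral_const_mul]
  refine hω'.integral_congr fun x hx => ?_
  rw [show minorExt (tailSeq μ) (A ++ [j, k]) x * H x = minorExt (tailSeq μ) (A ++ [j, k]) x *
    (t * ‖H x‖) by rw [← hHt x hx]]
  ring

/-- Only E = κ + s'∫ γH dω'/(z - x) has to be shown zero-free, the other factor being a tail minor.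
Off the real line this is the constant sign of γH. On it, E is an integral over K_r, with r the
length of A, of a tail minor times a divided difference, and the zero bound for two tail minors
prevents that divided difference from vanishing. The hypotheses A.length ≤ j and A.length ≤ k remove
the additive constants, which would spoil this integral formula. -/
theorem regularMinor_pair (hμ : NikishinChain μ K) (h : RegularSystem m (tailSeq μ) (tailSeq K))
    {A : List ℕ} {j : ℕ} (hA : Columns m (A ++ [j])) (hX : HasShiftedRep m μ K A)
    (hreg : ∀ k < m, k ∉ A → RegularMinor μ K ((A ++ [k]).map Nat.succ)) {k : ℕ} (hkm : k < m)
    (hkA : k ∉ A) (hkj : k ≠ j) (hrj : A.length ≤ j) (hrk : A.length ≤ k) :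
    RegularMinor μ K ((A ++ [j, k]).map Nat.succ) := by
  obtain ⟨ω, ω', s, s', c, H, hω, hω', hs, hs', hHdef, hH, hHc, hH0, -, hc, hk⟩ :=
    exists_pair_formula hμ h hA hX hreg
  obtain ⟨c', α, β, κ, hc', hα, hκ, hrep, -, hE⟩ := hk k hkm hkA hkj
  obtain rfl := hc hrj
  obtain rfl := hc' hrk
  have hd := hμ.disjoint A.length
  have hs0 : (s : ℂ) ≠ 0 := by rcases hs with rfl | rfl <;> norm_num
  have hs0' : (s' : ℂ) ≠ 0 := by rcases hs' with rfl | rfl <;> norm_num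
  have hAk := hA.of_append.append_singleton hkm hkA
  have hmem : ∀ x ∈ K (A.length + 1), (x : ℂ) ∈ offCut (K A.length) := fun x hx =>
    SupportedOn.ofReal_mem_offCut_of_disjoint hd.symm hx
  have hmem' : ∀ x ∈ K A.length, (x : ℂ) ∈ offCut (K (A.length + 1)) := fun x hx =>
    SupportedOn.ofReal_mem_offCut_of_disjoint hd hx
  obtain ⟨hgan, hgcs, hg0⟩ := h.tail_facts hA
  set g : ℝ → ℂ := fun x => minorExt (tailSeq μ) (A ++ [j]) x with hg
  set γ : ℝ → ℂ := fun x => minorExt (tailSeq μ) (A ++ [j, k]) x with hγ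
  have hgc : ContinuousOn g (K A.length) := SupportedOn.continuousOn_ofReal_comp hd hgan.continuousOn
  have hgre : ∀ x ∈ K A.length, (g x).im = 0 := fun x hx => hgcs.im_eq_zero (hmem' x hx)
  have hg0' : ∀ x ∈ K A.length, g x ≠ 0 := fun x hx => hg0 x (hmem' x hx)
  have hAjk := h.regular _ (hA.append_pair hkm hkA hkj)
  have hγc : ContinuousOn γ (K (A.length + 1)) := h.continuousOn_minorExt hA hkm hkA hkj
  have hd' : Disjoint (K (A.length + 1)) (cutSet (tailSeq K) (A ++ [j, k]).length) := by
    simpa [cutSet] using hμ.disjoint (A.length + 1)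
  have hγre : ∀ x ∈ K (A.length + 1), (γ x).im = 0 := fun x hx =>
    hAjk.conj.im_eq_zero (SupportedOn.ofReal_mem_offCut_of_disjoint hd' hx)
  have hγ0 : ∀ x ∈ K (A.length + 1), γ x ≠ 0 := fun x hx =>
    hAjk.ne_zero _ (SupportedOn.ofReal_mem_offCut_of_disjoint hd' hx)
  set ψ : ℝ → ℂ := fun x => γ x * H x with hψ
  have hψc : ContinuousOn ψ (K (A.length + 1)) :=
    hγc.mul (SupportedOn.continuousOn_ofReal_comp hd.symm hH.continuousOn)
  have hψre : ∀ x ∈ K (A.length + 1), (ψ x).im = 0 := fun x hx => by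
    rw [hψ]
    simp [Complex.mul_im, hγre x hx, hHc.im_eq_zero (hmem x hx)]
  have hψ0 : ∀ x ∈ K (A.length + 1), ψ x ≠ 0 := fun x hx => mul_ne_zero (hγ0 x hx) (hH0 x (hmem x hx))
  set E : ℂ → ℂ := fun z => κ + s' * cauchy ψ ω' z with hEdef
  have hφc : ContinuousOn (fun x => s' * γ x) (K (A.length + 1)) := continuousOn_const.mul hγc
  have hEint : ∀ z ∈ offCut (K (A.length + 1)),
      E z = s * ∫ t : ℝ, g t * (α - cauchy (fun y => s' * γ y / (z - y)) ω' t) ∂ω := by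
    intro z hz
    rw [hω.toSupportedOn.integral_mul_sub_cauchy hω'.toSupportedOn hd hgc hφc hz]
    have h1 : cauchy ψ ω' z = s * cauchy (fun y => γ y * cauchy g ω y) ω' z := by
      rw [← cauchy_const_mul]
      refine hω'.cauchy_congr (fun x _ => ?_) z
      simp only [hψ, hHdef]
      push_cast
      ring
    have h2 : cauchy (fun y => s' * γ y * cauchy g ω y) ω' z =
        s' * cauchy (fun y => γ y * cauchy g ω y) ω' z := by
      rw [← cauchy_const_mul]
      exact hω'.cauchy_congr (fun x _ => by ring) z
    simp only [hEdef]
    rw [h1, h2, hκ]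
    push_cast
    ring
  have hE0 : ∀ z ∈ offCut (K (A.length + 1)), E z ≠ 0 := by
    intro z hz
    by_cases hzr : z.im = 0
    · obtain ⟨y, rfl⟩ : ∃ y : ℝ, (y : ℂ) = z := ⟨z.re, Complex.ext rfl (by simp [hzr])⟩
      rw [hEint _ hz]
      have hφy := continuousOn_kernel hz hφc
      have hbre : ∀ t ∈ K A.length, (α - cauchy (fun x => s' * γ x / (y - x)) ω' t).im = 0 := by
        intro t ht
        have h1 := hω'.cauchy_conj (φ := fun x => s' * γ x / (y - x)) (fun x hx => by
          rw [← Complex.conj_eq_iff_im]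
          simp [Complex.conj_eq_iff_im.2 (hγre x hx)]) t
        rw [Complex.conj_ofReal] at h1
        simpa using Complex.conj_eq_iff_im.1 h1.symm
      have hb0 : ∀ t ∈ K A.length, (α - cauchy (fun x => s' * γ x / (y - x)) ω' t) ≠ 0 := by
        intro t ht h0
        have hban : AnalyticOnNhd ℂ (fun w => α - cauchy (fun x => s' * γ x / (y - x)) ω' w)
            (offCut (K (A.length + 1))) :=
          analyticOnNhd_const.sub (hω'.analyticOnNhd_cauchy hφy)
        obtain ⟨q, hq, hbq⟩ := exists_eq_sub_mul (isOpen_offCut hω'.compact) hban (hmem' t ht) h0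
        -- The value at y of the quotient of the tail minors on A ++ [k] and A ++ [j]. If the
        -- divided difference vanishes at t, the form with constant coefficients 1 and -v is
        -- divisible by (z - y)(z - t), also when y = t.
        set v : ℂ := α * y + β + s' * cauchy γ ω' y with hv
        have hvre : v = v.re := by
          refine Complex.ext rfl ?_
          have h1 := hω'.cauchy_conj hγre (y : ℂ)
          rw [Complex.conj_ofReal] at h1
          simp [hv, Complex.conj_eq_iff_im.1 h1.symm]
        -- Constant coefficients mean n = (1, 1), so fewer than two zeros are allowed.
        have hAT := h.atFamily {j, k} A hA.of_append (by
          intro i hi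
          rcases Finset.mem_insert.1 hi with rfl | hi
          · exact hA.last
          · rw [Finset.mem_singleton.1 hi]
            exact ⟨hkm, hkA⟩) (fun _ => 1) (fun i => if i = k then 1 else C (-v.re)) (by
          intro i _
          split_ifs
          · exact degree_one_le.trans_lt (by norm_num)
          · exact degree_C_le.trans_lt (by norm_num)) ⟨k, by simp, by simp⟩
        have h2 := hAT ((X - C y) * (X - C t)) (mul_ne_zero (X_sub_C_ne_zero y) (X_sub_C_ne_zero t))
          (by
            intro z h
            rw [map_mul, mul_eq_zero] at h
            rcases h with h | h
            · simp [sub_eq_zero] at h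
              rw [h]
              exact hz
            · simp [sub_eq_zero] at h
              rw [h]
              exact hmem' t ht)
          ⟨fun z => minorExt (tailSeq μ) (A ++ [j]) z * q z, hgan.mul hq, fun z hz' => by
            simp only
            rw [Finset.sum_pair hkj.symm, if_neg hkj.symm, if_pos rfl, eval_map_real]
            have h3 := hω'.toSupportedOn.affine_add_cauchy_sub hφc hz hz' (a := α) (b := β)
            rw [hbq z, cauchy_const_mul, cauchy_const_mul] at h3
            have h4 := hrep z hz'
            simp only [map_mul, map_sub, aeval_X, aeval_C, map_one]
            rw [h4]
            have h5 : (algebraMap ℝ ℂ) (-v.re) = -v := by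
              rw [hvre]
              simp
            rw [h5, hv]
            simp only [Complex.coe_algebraMap]
            linear_combination (-minorExt (tailSeq μ) (A ++ [j]) z) * h3⟩
        rw [natDegree_mul (X_sub_C_ne_zero y) (X_sub_C_ne_zero t), natDegree_X_sub_C,
          natDegree_X_sub_C, Finset.sum_pair hkj.symm] at h2
        omega
      refine mul_ne_zero hs0 (hω.integral_ne_zero ?_ (fun t ht => ?_) fun t ht =>
        mul_ne_zero (hg0' t ht) (hb0 t ht))
      · exact hgc.mul (continuousOn_const.sub
          (SupportedOn.continuousOn_ofReal_comp hd (hω'.continuousOn_cauchy hφy)))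
      · rw [Complex.mul_im, hgre t ht, hbre t ht]
        simp
    · intro h0
      have h1 := congrArg Complex.im h0
      simp only [hEdef, Complex.add_im, Complex.ofReal_im, zero_add,
        Complex.im_ofReal_mul, Complex.zero_im] at h1
      exact mul_ne_zero (by exact_mod_cast hs0') (hω'.im_cauchy_ne_zero hψc hψre hψ0 hzr) h1
  have e : cutSet K ((A ++ [j, k]).map Nat.succ).length = K (A.length + 1) := by simp [cutSet]
  refine (RegularMinor.of_eq (f := fun z => minorExt (tailSeq μ) (A ++ [j]) z * E z) hμ ?_ ?_ ?_ ?_ ?_).1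
  · rw [e]
    exact hgan.mul (analyticOnNhd_const.add (analyticOnNhd_const.mul (hω'.analyticOnNhd_cauchy hψc)))
  · rw [e]
    intro z hz
    simp [hEdef, hgcs z hz, hω'.cauchy_conj hψre z]
  · rw [e]
    exact fun z hz => mul_ne_zero (hg0 z hz) (hE0 z hz)
  · intro z hz
    rw [hE z hz, ← (h.regular _ hA).eq z hz]
  · rw [minorLead_map_succ_append_pair, Nat.cast_add]
    refine (h.regular _ hA).lead.mul ?_
    -- If k exceeds the length r of A, then α and κ vanish and E decays like 1/z. Otherwise k = r <
    -- j, so the slope is nonzero and E tends to κ = sα∫ g dω ≠ 0.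
    by_cases hlt : A.length < k
    · rw [if_pos hlt]
      have hα0 : α = 0 := by
        by_contra h0
        exact absurd (hα.1 h0).2 (not_le.2 hlt)
      have hκ0 : (κ : ℂ) = 0 := by
        rw [hκ, hα0]
        simp
      simp only [hEdef, hκ0, zero_add]
      exact (hω'.hasLead_cauchy hψc (hω'.integral_ne_zero hψc hψre hψ0)).const_mul hs0'
    · rw [if_neg hlt]
      have hα0 : α ≠ 0 := hα.2 ⟨by omega, by omega⟩
      have hκ0 : (κ : ℂ) ≠ 0 := by
        rw [hκ]
        have := hω.integral_ne_zero hgc hgre hg0'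
        simp only [Complex.ofReal_zero, zero_mul, sub_zero, zero_add]
        exact mul_ne_zero hs0 (mul_ne_zero (by exact_mod_cast hα0) this)
      refine ⟨κ, hκ0, ?_⟩
      simpa [hEdef] using ((hω'.tendsto_cauchy hψc).const_mul (s' : ℂ)).const_add (κ : ℂ)

end

/-! ### Quotient representations for all minors -/

section

variable {m : ℕ} {μ : ℕ → Measure ℝ} {K : ℕ → Set ℝ}

/-- Reordering S multiplies numerator and denominator by the same sign; the density also changes by
it, which the sign `s` compensates. -/
theorem HasQuotientRep.perm (hμ : NikishinChain μ K) {S S' : List ℕ} {j : ℕ}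
    (hreg : ∀ c, Columns m c → RegularMinor μ K c) (hS : Columns m (S ++ [j])) (hp : S.Perm S')
    (h : HasQuotientRep μ K m S j) : HasQuotientRep μ K m S' j := by
  obtain ⟨ω, hω, s, hs, hrep⟩ := h
  obtain ⟨ε, hε, hsign⟩ := exists_sign_listMinor_perm hp
  have hεε : (ε : ℂ) * ε = 1 := by rcases hε with rfl | rfl <;> norm_num
  have hlen := hp.length_eq
  refine ⟨ω, hlen ▸ hω, ε * s, ?_, fun k hk hkS hkj => ?_⟩
  · rcases hs with rfl | rfl <;> rcases hε with rfl | rfl <;> norm_num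
  have hkS' : k ∉ S := fun h => hkS (hp.mem_iff.1 h)
  obtain ⟨α, β, hz⟩ := hrep k hk hkS' hkj
  refine ⟨α, β, fun z hzr => ?_⟩
  have hc := hS.append_pair hk hkS' hkj
  have hc' : Columns m (S' ++ [j, k]) :=
    ⟨(hp.append_right _).nodup_iff.1 hc.1, fun x hx => hc.2 x ((hp.append_right _).mem_iff.2 hx)⟩
  have hr := hreg _ hc
  have hr' := hreg _ hc'
  have e : cutSet K (S ++ [j, k]).length = K (S.length + 1) := by simp [cutSet]
  have e' : cutSet K (S' ++ [j, k]).length = K (S.length + 1) := by simp [cutSet, hlen]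
  have hext : ∀ w ∈ offCut (K (S.length + 1)),
      minorExt μ (S ++ [j, k]) w = ε * minorExt μ (S' ++ [j, k]) w := by
    refine eqOn_of_im_ne_zero (isOpen_offCut (hμ.carried _).compact) ?_ ?_ fun w hw => ?_
    · exact e ▸ hr.analytic.continuousOn
    · exact continuousOn_const.mul (e' ▸ hr'.analytic.continuousOn)
    · rw [hr.eq w hw, hr'.eq w hw, nikishinMinor, nikishinMinor, hsign, ← mul_assoc, hεε, one_mul]
  have hcau : cauchy (fun x => minorExt μ (S ++ [j, k]) x) ω z =
      ε * cauchy (fun x => minorExt μ (S' ++ [j, k]) x) ω z := by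
    rw [← cauchy_const_mul]
    exact hω.cauchy_congr (fun x hx => hext x
      (SupportedOn.ofReal_mem_offCut_of_disjoint (hμ.disjoint _) hx)) z
  have h1 := hz z hzr
  rw [hcau] at h1
  simp only [nikishinMinor] at h1 ⊢
  rw [hsign, hsign, h1]
  push_cast
  ring

theorem minorExt_zero_cons (μ : ℕ → Measure ℝ) (A : List ℕ) :
    minorExt μ (0 :: A.map Nat.succ) = minorExt (tailSeq μ) A := by
  unfold minorExt
  congr 1
  funext z
  exact nikishinMinor_zero_cons μ A z

theorem hasQuotientRep_zero_cons {A : List ℕ} {j : ℕ} (h : HasQuotientRep (tailSeq μ) (tailSeq K) m A j) :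
    HasQuotientRep μ K (m + 1) (0 :: A.map Nat.succ) (j + 1) := by
  obtain ⟨ω, hω, s, hs, hrep⟩ := h
  refine ⟨ω, by simpa using hω, s, hs, fun k hk hkS hkj => ?_⟩
  obtain _ | k := k
  · simp at hkS
  obtain ⟨α, β, hz⟩ := hrep k (by omega) (by simpa using hkS) (by omega)
  refine ⟨α, β, fun z hzr => ?_⟩
  have e : ∀ T : List ℕ, (0 :: A.map Nat.succ) ++ T.map Nat.succ = 0 :: (A ++ T).map Nat.succ := by simp
  have h1 := hz z hzr
  rw [← nikishinMinor_zero_cons, ← nikishinMinor_zero_cons, ← minorExt_zero_cons, ← e, ← e, ← e] at h1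
  exact h1

theorem regularMinor_zero_cons (hμ : NikishinChain μ K) {A : List ℕ}
    (h : RegularMinor (tailSeq μ) (tailSeq K) A) : RegularMinor μ K (0 :: A.map Nat.succ) := by
  have e : offCut (cutSet K (0 :: A.map Nat.succ).length) ⊆ offCut (cutSet (tailSeq K) A.length) := by
    refine offCut_mono ?_
    simpa using cutSet_tail_subset K A.length
  refine (RegularMinor.of_eq (f := minorExt (tailSeq μ) A) hμ (h.analytic.mono e) (fun z hz => h.conj z (e hz))
    (fun z hz => h.ne_zero z (e hz)) (fun z hz => ?_) ?_).1
  · rw [h.eq z hz, nikishinMinor_zero_cons]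
  · have : minorLead (0 :: A.map Nat.succ) = minorLead A := by
      simp [minorLead, List.countP_map, Function.comp_def]
    rw [this]
    exact h.lead

/-- The denominator is, up to sign, a tail minor, so the quotient is the one in `HasShiftedRep`; its
slope is 0. -/
theorem hasQuotientRep_map_succ_zero (hμ : NikishinChain μ K) (h : RegularSystem m (tailSeq μ) (tailSeq K))
    {A : List ℕ} (hA : Columns m A)
    (hreg : ∀ c, Columns (m + 1) c → RegularMinor μ K c) (hX : HasShiftedRep m μ K A) :
    HasQuotientRep μ K (m + 1) (A.map Nat.succ) 0 := by
  obtain ⟨ω, hω, s, hs, hX⟩ := hX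
  obtain ⟨ε, hε, hsign⟩ := exists_sign_listMinor_perm
    (List.perm_append_singleton 0 (A.map Nat.succ)).symm
  have hεε : (ε : ℂ) * ε = 1 := by rcases hε with rfl | rfl <;> norm_num
  refine ⟨ω, by simpa using hω, s, hs, fun k hk hkS hkj => ?_⟩
  obtain _ | k := k
  · exact absurd rfl hkj
  have hkA : k ∉ A := by simpa using hkS
  obtain ⟨c, hc⟩ := hX k (by omega) hkA
  have hkc := hA.append_singleton (by omega : k < m) hkA
  have e0 : ∀ z, nikishinMinor μ (A.map Nat.succ ++ [0]) z = ε * nikishinMinor (tailSeq μ) A z := by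
    intro z
    have := hsign (nikishinMatrix μ z) []
    simp only [List.append_nil] at this
    rw [← nikishinMinor_zero_cons, nikishinMinor, nikishinMinor, this]
  have e1 : ∀ z, nikishinMinor μ (A.map Nat.succ ++ [0, k + 1]) z =
      ε * nikishinMinor (tailSeq μ) (A ++ [k]) z := by
    intro z
    have := hsign (nikishinMatrix μ z) [k + 1]
    rw [← nikishinMinor_zero_cons, nikishinMinor, nikishinMinor]
    simpa using this
  have hAk : Columns (m + 1) (A.map Nat.succ ++ [0, k + 1]) := by
    have h0 : Columns (m + 1) (A.map Nat.succ) :=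
      ⟨hA.1.map Nat.succ_injective, fun x hx => by
        obtain ⟨y, hy, rfl⟩ := List.mem_map.1 hx
        exact Nat.succ_lt_succ (hA.2 y hy)⟩
    exact (h0.append_singleton (Nat.succ_pos m) (by simp)).append_pair hk hkS (by simp)
  have hr := hreg _ hAk
  have e : cutSet K (A.map Nat.succ ++ [0, k + 1]).length = K (A.length + 1) := by simp [cutSet]
  have hext : ∀ w ∈ offCut (K (A.length + 1)),
      minorExt μ (A.map Nat.succ ++ [0, k + 1]) w = ε * minorExt (tailSeq μ) (A ++ [k]) w := by
    refine eqOn_of_im_ne_zero (isOpen_offCut (hμ.carried _).compact) ?_ ?_ fun w hw => ?_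
    · exact e ▸ hr.analytic.continuousOn
    · exact continuousOn_const.mul (h.tail_facts hkc).1.continuousOn
    · rw [hr.eq w hw, e1, (h.regular _ hkc).eq w hw]
  refine ⟨0, ε * c, fun z hz => ?_⟩
  have hcau : cauchy (fun x => minorExt μ (A.map Nat.succ ++ [0, k + 1]) x) ω z =
      ε * cauchy (fun x => minorExt (tailSeq μ) (A ++ [k]) x) ω z := by
    rw [← cauchy_const_mul]
    exact hω.cauchy_congr (fun x hx => hext x
      (SupportedOn.ofReal_mem_offCut_of_disjoint (hμ.disjoint _) hx)) z
  have h1 := hc z hz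
  simp only [List.map_append, List.map_cons, List.map_nil, Nat.succ_eq_add_one] at h1
  rw [hcau, e0]
  push_cast
  rw [h1]
  linear_combination (-nikishinMinor (tailSeq μ) A z *
    (c + s * cauchy (fun x => minorExt (tailSeq μ) (A ++ [k]) x) ω z)) * hεε

/-- The denominator is a tail minor times H, and 1/H is affine minus a Cauchy transform. Column 0
gives ±1/H. Another column gives b - E/H, with b the tail quotient; expanding E/H by a divided
difference produces a transform over the next interval that cancels the one in b. -/
theorem hasQuotientRep_map_succ_succ (hμ : NikishinChain μ K) (h : RegularSystem m (tailSeq μ) (tailSeq K))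
    {A : List ℕ} {j : ℕ} (hA : Columns m (A ++ [j]))
    (hreg : ∀ c, Columns (m + 1) c → RegularMinor μ K c) (hX : HasShiftedRep m μ K A) :
    HasQuotientRep μ K (m + 1) (A.map Nat.succ) (j + 1) := by
  have hshift : ∀ c, Columns m c → Columns (m + 1) (c.map Nat.succ) := fun c hc =>
    ⟨hc.1.map Nat.succ_injective, fun x hx => by
      obtain ⟨y, hy, rfl⟩ := List.mem_map.1 hx
      exact Nat.succ_lt_succ (hc.2 y hy)⟩
  obtain ⟨ω, ω', s, s', c, H, hω, hω', hs, hs', hHdef, hH, hHc, hH0, hHj, -, hk⟩ :=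
    exists_pair_formula hμ h hA hX fun k hk hkA =>
      hreg _ (hshift _ (hA.of_append.append_singleton hk hkA))
  have hd := hμ.disjoint A.length
  have hss : (s : ℂ) * s = 1 := by rcases hs with rfl | rfl <;> norm_num
  have hmem : ∀ x ∈ K (A.length + 1), (x : ℂ) ∈ offCut (K A.length) := fun x hx =>
    SupportedOn.ofReal_mem_offCut_of_disjoint hd.symm hx
  have hmem' : ∀ x ∈ K A.length, (x : ℂ) ∈ offCut (K (A.length + 1)) := fun x hx =>
    SupportedOn.ofReal_mem_offCut_of_disjoint hd hx
  obtain ⟨hgan, hgcs, hg0⟩ := h.tail_facts hA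
  set g : ℝ → ℂ := fun x => minorExt (tailSeq μ) (A ++ [j]) x with hg
  have hgc : ContinuousOn g (K A.length) := SupportedOn.continuousOn_ofReal_comp hd hgan.continuousOn
  have hg0' : ∀ x ∈ K A.length, g x ≠ 0 := fun x hx => hg0 x (hmem' x hx)
  obtain ⟨t, ht, hgt⟩ := Carried.exists_sign hω.ordConnected hgc
    (fun x hx => hgcs.im_eq_zero (hmem' x hx)) hg0'
  have htt : (t : ℂ) * t = 1 := by rcases ht with rfl | rfl <;> norm_num
  obtain ⟨ω₁, hω₁, hω₁int⟩ := hω.exists_withDensity hgc.norm fun x hx => norm_pos_iff.2 (hg0' x hx)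
  -- The sign that makes σH a constant plus the transform of a positive measure, as the inversion
  -- requires.
  set σ : ℝ := s * t with hσ
  have hσσ : (σ : ℂ) * σ = 1 := by
    rw [hσ]
    push_cast
    linear_combination (t * t : ℂ) * hss + htt
  have hHω₁ : ∀ z ∈ offCut (K A.length), ((σ * c : ℝ) : ℂ) + cauchy (fun _ => 1) ω₁ z = σ * H z := by
    intro z _
    have h1 : cauchy (fun _ => 1) ω₁ z = t * cauchy g ω z := by
      rw [← cauchy_const_mul]
      simp only [cauchy]
      rw [hω₁int]
      refine hω.integral_congr fun x hx => ?_
      have := hgt x hx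
      generalize ‖g x‖ = n at this ⊢
      rw [this]
      linear_combination (-(n : ℂ) / (z - x)) * htt
    rw [h1, hHdef, hσ]
    push_cast
    linear_combination (-(t : ℂ) * cauchy g ω z) * hss
  have hσ0 : (σ : ℂ) ≠ 0 := left_ne_zero_of_mul_eq_one hσσ
  obtain ⟨τ, hτ, a, b, hτz⟩ := hω₁.exists_inverse (σ * c) fun z hz => by
    rw [hHω₁ z hz]
    exact mul_ne_zero hσ0 (hH0 z hz)
  have hinv : ∀ z ∈ offCut (K A.length), (H z)⁻¹ = σ * (a * z + b - cauchy (fun _ => 1) τ z) := by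
    intro z hz
    rw [← hτz z hz, hHω₁ z hz, mul_inv, ← mul_assoc, mul_inv_cancel₀ hσ0, one_mul]
  -- The required densities are minors containing the factor g, so the measure is τ divided by |g|;
  -- the sign of g goes into `s`.
  obtain ⟨ν, hν, hνint⟩ := hτ.exists_withDensity (ρ := fun x => ‖g x‖⁻¹)
    (hgc.norm.inv₀ fun x hx => norm_ne_zero_iff.2 (hg0' x hx))
    fun x hx => inv_pos.2 (norm_pos_iff.2 (hg0' x hx))
  have hνcau : ∀ (f φ : ℝ → ℂ) (z : ℂ), (∀ x ∈ K A.length, f x = g x * φ x) →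
      s * cauchy f ν z = σ * cauchy φ τ z := by
    intro f φ z hf
    simp only [cauchy]
    rw [hνint, ← integral_const_mul, ← integral_const_mul]
    refine hτ.integral_congr fun x hx => ?_
    have h1 := hgt x hx
    have h2 : (‖g x‖ : ℂ) ≠ 0 := by simpa using hg0' x hx
    rw [hf x hx, hσ]
    generalize ‖g x‖ = n at h1 h2 ⊢
    rw [h1]
    push_cast
    field_simp
  have hcol : ∀ k < m + 1, k ∉ A.map Nat.succ → k ≠ j + 1 →
      Columns (m + 1) (A.map Nat.succ ++ [j + 1, k]) := by
    intro k hk hkS hkj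
    have := hshift _ hA
    rw [List.map_append] at this
    exact this.append_pair hk hkS hkj
  have e : ∀ k, cutSet K (A.map Nat.succ ++ [j + 1, k]).length = K (A.length + 1) := fun k => by
    simp [cutSet]
  have eS : ∀ k, A.map Nat.succ ++ [k + 1] = (A ++ [k]).map Nat.succ := fun k => by simp
  refine ⟨ν, by simpa using hν, s, hs, fun k hk' hkS hkj => ?_⟩
  have hr := hreg _ (hcol k hk' hkS hkj)
  have hran := hr.analytic
  rw [e] at hran
  obtain _ | k := k
  · obtain ⟨ε, hε, hsign⟩ := exists_sign_listMinor_perm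
      (List.perm_append_singleton 0 (A.map Nat.succ)).symm
    have hεε : (ε : ℂ) * ε = 1 := by rcases hε with rfl | rfl <;> norm_num
    have e0 : ∀ z, nikishinMinor μ (A.map Nat.succ ++ [0]) z = ε * nikishinMinor (tailSeq μ) A z := by
      intro z
      have := hsign (nikishinMatrix μ z) []
      simp only [List.append_nil] at this
      rw [← nikishinMinor_zero_cons, nikishinMinor, nikishinMinor, this]
    have e1 : ∀ z, nikishinMinor μ (A.map Nat.succ ++ [j + 1, 0]) z =
        -ε * nikishinMinor (tailSeq μ) (A ++ [j]) z := by
      intro z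
      have := hsign (nikishinMatrix μ z) [j + 1]
      rw [← nikishinMinor_zero_cons, nikishinMinor, nikishinMinor, listMinor_swap]
      simpa using this
    have hext : ∀ w ∈ offCut (K (A.length + 1)),
        minorExt μ (A.map Nat.succ ++ [j + 1, 0]) w = -ε * minorExt (tailSeq μ) (A ++ [j]) w := by
      refine eqOn_of_im_ne_zero (isOpen_offCut (hμ.carried _).compact) hran.continuousOn
        (continuousOn_const.mul hgan.continuousOn) fun w hw => ?_
      rw [hr.eq w hw, e1, (h.regular _ hA).eq w hw]
    refine ⟨ε * σ * a, ε * σ * b, fun z hz => ?_⟩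
    have hzK : z ∈ offCut (K A.length) := mem_offCut_of_im_ne_zero hz
    rw [e0, eS, hHj z hz, hνcau _ (fun _ => -ε * 1) z (fun x hx => by rw [hext x (hmem' x hx)]; ring),
      cauchy_const_mul]
    have h1 := hinv z hzK
    have h2 := mul_inv_cancel₀ (hH0 z hzK)
    rw [h1] at h2
    push_cast
    linear_combination (-ε * nikishinMinor (tailSeq μ) A z) * h2
  · have hkA : k ∉ A := by simpa using hkS
    have hkm : k < m := by omega
    have hkj' : k ≠ j := by omega
    obtain ⟨c', α, β, κ, -, -, -, -, hHk, hE⟩ := hk k hkm hkA hkj'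
    set γ : ℝ → ℂ := fun x => minorExt (tailSeq μ) (A ++ [j, k]) x with hγ
    have hAjk := h.regular _ (hA.append_pair hkm hkA hkj')
    have hγc : ContinuousOn γ (K (A.length + 1)) := h.continuousOn_minorExt hA hkm hkA hkj'
    have hd' : Disjoint (K (A.length + 1)) (cutSet (tailSeq K) (A ++ [j, k]).length) := by
      simpa [cutSet] using hμ.disjoint (A.length + 1)
    have hγre : ∀ x ∈ K (A.length + 1), (γ x).im = 0 := fun x hx =>
      hAjk.conj.im_eq_zero (SupportedOn.ofReal_mem_offCut_of_disjoint hd' hx)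
    set ψ : ℝ → ℂ := fun x => γ x * H x with hψ
    have hHcont := SupportedOn.continuousOn_ofReal_comp hd.symm hH.continuousOn
    have hψc : ContinuousOn ψ (K (A.length + 1)) := hγc.mul hHcont
    have hψre : ∀ x ∈ K (A.length + 1), (ψ x).im = 0 := fun x hx => by
      rw [hψ]
      simp [Complex.mul_im, hγre x hx, hHc.im_eq_zero (hmem x hx)]
    set E : ℂ → ℂ := fun z => κ + s' * cauchy ψ ω' z with hEdef
    have hEan : AnalyticOnNhd ℂ E (offCut (K (A.length + 1))) :=
      analyticOnNhd_const.add (analyticOnNhd_const.mul (hω'.analyticOnNhd_cauchy hψc))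
    have hext : ∀ w ∈ offCut (K (A.length + 1)),
        minorExt μ (A.map Nat.succ ++ [j + 1, k + 1]) w = minorExt (tailSeq μ) (A ++ [j]) w * E w := by
      refine eqOn_of_im_ne_zero (isOpen_offCut (hμ.carried _).compact) hran.continuousOn
        (hgan.continuousOn.mul hEan.continuousOn) fun w hw => ?_
      rw [hr.eq w hw, (h.regular _ hA).eq w hw, ← hE w hw]
      simp
    set J : ℂ := ∫ x, ψ x ∂ω' with hJ
    have hJre : J = J.re := Complex.ext rfl (by simpa using hω'.integral_im_eq_zero hψre)
    refine ⟨α - σ * κ * a, β - σ * κ * b - σ * s' * a * J.re, fun z hz => ?_⟩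
    have hzK : z ∈ offCut (K A.length) := mem_offCut_of_im_ne_zero hz
    have hzK' : z ∈ offCut (K (A.length + 1)) := mem_offCut_of_im_ne_zero hz
    rw [eS, eS, hHj z hz, hHk z hz, hνcau _ (fun x => E x) z fun x hx => hext x (hmem' x hx)]
    have hψs : ContinuousOn (fun x => s' * ψ x) (K (A.length + 1)) := continuousOn_const.mul hψc
    have hτe : E z * cauchy (fun _ => 1) τ z - cauchy (fun x => E x) τ z =
        s' * cauchy (fun y => ψ y * cauchy (fun _ => 1) τ y) ω' z := by
      have h1 := hτ.toSupportedOn.mul_cauchy_sub_cauchy_mul (a := 0) (b := κ) hω'.toSupportedOn hd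
        (continuousOn_const (c := (1 : ℂ))) hψs hzK hzK'
      rw [hτ.toSupportedOn.integral_mul_sub_cauchy hω'.toSupportedOn hd continuousOn_const hψs hzK'] at h1
      simp only [zero_mul, zero_add, one_mul, cauchy_const_mul, mul_assoc] at h1
      exact h1
    -- On the next interval τ̂ is replaced by means of 1/H. The factor H in ψ = γH then cancels,
    -- leaving the transform of γ that also occurs in the tail quotient.
    have hτy : cauchy (fun y => ψ y * cauchy (fun _ => 1) τ y) ω' z =
        (a * z + b) * cauchy ψ ω' z - a * J - σ * cauchy γ ω' z := by
      have c1 : ContinuousOn (fun x : ℝ => (x : ℂ) * ψ x) (K (A.length + 1)) :=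
        Complex.continuous_ofReal.continuousOn.mul hψc
      have c2 : ContinuousOn (fun x : ℝ => a * ((x : ℂ) * ψ x)) (K (A.length + 1)) :=
        continuousOn_const.mul c1
      have c3 : ContinuousOn (fun x : ℝ => b * ψ x) (K (A.length + 1)) := continuousOn_const.mul hψc
      have c4 : ContinuousOn (fun x : ℝ => -σ * γ x) (K (A.length + 1)) := continuousOn_const.mul hγc
      have c5 : ContinuousOn (fun x : ℝ => b * ψ x + -σ * γ x) (K (A.length + 1)) := c3.add c4
      have h1 : cauchy (fun y => ψ y * cauchy (fun _ => 1) τ y) ω' z =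
          cauchy (fun y => a * (y * ψ y) + (b * ψ y + -σ * γ y)) ω' z := by
        refine hω'.cauchy_congr (fun y hy => ?_) z
        have h2 := hinv y (hmem y hy)
        have h3 := mul_inv_cancel₀ (hH0 y (hmem y hy))
        rw [h2] at h3
        simp only [hψ]
        linear_combination (-σ * γ y) * h3 + (γ y * H y * (a * y + b - cauchy (fun _ => 1) τ y)) * hσσ
      rw [h1, hω'.cauchy_add c2 c5 hzK', hω'.cauchy_add c3 c4 hzK', cauchy_const_mul,
        cauchy_const_mul, cauchy_const_mul]
      have h4 := hω'.mul_cauchy hψc hzK'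
      linear_combination (-(a : ℂ)) * h4
    have h1 := mul_inv_cancel₀ (hH0 z hzK)
    rw [hinv z hzK] at h1
    rw [hτy] at hτe
    push_cast
    rw [← hJre]
    have hEz : E z = κ + s' * cauchy ψ ω' z := rfl
    rw [hEz] at hτe
    generalize cauchy ψ ω' z = Ψ at *
    generalize cauchy γ ω' z = Γ at *
    generalize cauchy (fun _ => 1) τ z = T at *
    generalize cauchy (fun x => E x) τ z = T' at *
    linear_combination (nikishinMinor (tailSeq μ) A z) * ((κ + s' * Ψ) * h1 +
      (H z * σ) * hτe + (-H z * s' * Γ) * hσσ)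

end

/-! ### Induction on the columns and the bound for chains of positive measures -/

section

variable {m : ℕ} {μ : ℕ → Measure ℝ} {K : ℕ → Set ℝ}

theorem Columns.perm {c c' : List ℕ} (h : Columns m c) (hp : c.Perm c') : Columns m c' :=
  ⟨hp.nodup_iff.1 h.1, fun x hx => h.2 x (hp.mem_iff.2 hx)⟩

theorem Columns.exists_map_succ {c : List ℕ} (h : Columns (m + 1) c) (h0 : 0 ∉ c) :
    ∃ A, Columns m A ∧ c = A.map Nat.succ := by
  have e : c = (c.map Nat.pred).map Nat.succ := by
    rw [List.map_map]
    conv_lhs => rw [← List.map_id c]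
    refine List.map_congr_left fun x hx => ?_
    have : x ≠ 0 := fun hx0 => h0 (hx0 ▸ hx)
    simp
    omega
  refine ⟨c.map Nat.pred, ⟨List.Nodup.of_map Nat.succ (e ▸ h.1), fun x hx => ?_⟩, e⟩
  have := h.2 (x + 1) (by rw [e]; exact List.mem_map.2 ⟨x, hx, rfl⟩)
  omega

theorem Columns.exists_zero_cons {c : List ℕ} (h : Columns (m + 1) c) (h0 : 0 ∈ c) :
    ∃ A, Columns m A ∧ (0 :: A.map Nat.succ).Perm c := by
  have hp := List.perm_cons_erase h0
  have hc := h.perm hp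
  obtain ⟨A, hA, e⟩ := Columns.exists_map_succ (c := c.erase 0)
    ⟨(List.nodup_cons.1 hc.1).2, fun x hx => hc.2 x (List.mem_cons_of_mem _ hx)⟩
    (List.nodup_cons.1 hc.1).1
  exact ⟨A, hA, by rw [← e]; exact hp.symm⟩

/-- Distinct numbers, `r + 2` of them, can be arranged so that the last two are at least `r`. -/
theorem exists_perm_append_pair {c : List ℕ} (hc : c.Nodup) {r : ℕ} (hr : c.length = r + 2) :
    ∃ A j k, c.Perm (A ++ [j, k]) ∧ r ≤ j ∧ r ≤ k := by
  have hp := List.filter_append_perm (fun x => decide (x < r)) c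
  have hP : (c.filter fun x => decide (x < r)).length ≤ r := by
    have h1 : ((c.filter fun x => decide (x < r)).toFinset).card ≤ (Finset.range r).card := by
      refine Finset.card_le_card fun x hx => ?_
      simp at hx
      exact Finset.mem_range.2 hx.2
    rwa [List.toFinset_card_of_nodup (hc.filter _), Finset.card_range] at h1
  have hlen := hp.length_eq
  rw [List.length_append, hr] at hlen
  have hmem : ∀ x ∈ c.filter (fun x => !decide (x < r)), r ≤ x := by
    intro x hx
    simpa using (List.mem_filter.1 hx).2
  revert hp hlen hmem
  generalize c.filter (fun x => !decide (x < r)) = Q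
  generalize c.filter (fun x => decide (x < r)) = P at hP
  intro hp hlen hmem
  match Q, hlen, hmem, hp with
  | [], hlen, _, _ => simp at hlen; omega
  | [_], hlen, _, _ => simp at hlen; omega
  | x :: y :: Q, _, hmem, hp =>
    refine ⟨P ++ Q, x, y, hp.symm.trans ?_, hmem x (by simp), hmem y (by simp)⟩
    rw [List.append_assoc]
    refine List.Perm.append_left P ?_
    exact List.perm_append_comm (l₁ := [x, y]) (l₂ := Q)

/-- Regularity and shifted representations need each other, so they are proved jointly by induction
on the size: representations for r columns and regularity for r + 1 give the next sizes of both. -/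
theorem shifted_facts (hμ : NikishinChain μ K) (h : RegularSystem m (tailSeq μ) (tailSeq K)) (r : ℕ) :
    (∀ A, Columns m A → A.length = r → HasShiftedRep m μ K A) ∧
      ∀ c, Columns m c → c.length ≤ r + 1 → RegularMinor μ K (c.map Nat.succ) := by
  induction r with
  | zero =>
    refine ⟨fun A _ hA => ?_, fun c hc hlen => ?_⟩
    · rw [List.length_eq_zero_iff.1 hA]
      exact hasShiftedRep_nil hμ m
    · match c, hc, hlen with
      | [], _, _ => exact regularMinor_nil hμ
      | [k], hc, _ => exact regularMinor_singleton hμ h (hc.2 k (by simp))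
  | succ r ih =>
    obtain ⟨ihX, ihR⟩ := ih
    refine ⟨fun A hA hlen => ?_, fun c hc hlen => ?_⟩
    · obtain ⟨B, j, rfl⟩ : ∃ B j, A = B ++ [j] := by
        have hne : A ≠ [] := by
          rintro rfl
          simp at hlen
        exact ⟨A.dropLast, A.getLast hne, (List.dropLast_append_getLast hne).symm⟩
      have hB : B.length = r := by simpa using hlen
      refine hasShiftedRep_append hμ h hA (ihX B hA.of_append hB) fun k hk hkB => ?_
      exact ihR _ (hA.of_append.append_singleton hk hkB) (by simp [hB])
    · by_cases hle : c.length ≤ r + 1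
      · exact ihR c hc hle
      -- By pigeonhole at least two of the r + 2 distinct columns are ≥ r. Placing them last meets
      -- the hypotheses of `regularMinor_pair`; reordering costs only a sign.
      obtain ⟨A, j, k, hp, hj, hk⟩ := exists_perm_append_pair hc.1 (r := r) (by omega)
      have hAjk := hc.perm hp
      have hlenA : A.length = r := by
        have := hp.length_eq
        simp at this
        omega
      have hAjk' : Columns m ((A ++ [j]) ++ [k]) := by simpa using hAjk
      have hk' := hAjk'.last
      simp only [List.mem_append, List.mem_singleton, not_or] at hk'
      have hAj := hAjk'.of_append
      refine RegularMinor.perm hμ ?_ (hp.symm.map Nat.succ)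
      exact regularMinor_pair hμ h hAj (ihX A hAj.of_append hlenA)
        (fun i hi hiA => ihR _ (hAj.of_append.append_singleton hi hiA) (by simp [hlenA]))
        hk'.1 hk'.2.1 hk'.2.2 (hlenA ▸ hj) (hlenA ▸ hk)

theorem regularSystem (hμ : NikishinChain μ K) (m : ℕ) : RegularSystem m μ K := by
  induction m generalizing μ K with
  | zero =>
    refine ⟨hμ, fun c hc => ?_, fun S j hS => absurd (hS.2 j (by simp)) (Nat.not_lt_zero j)⟩
    match c, hc with
    | [], _ => exact regularMinor_nil hμ
    | x :: c, hc => exact absurd (hc.2 x (by simp)) (Nat.not_lt_zero x)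
  | succ m ih =>
    have h := ih hμ.tail
    have hreg : ∀ c, Columns (m + 1) c → RegularMinor μ K c := by
      intro c hc
      by_cases h0 : 0 ∈ c
      · obtain ⟨A, hA, hp⟩ := hc.exists_zero_cons h0
        exact (regularMinor_zero_cons hμ (h.regular A hA)).perm hμ hp
      · obtain ⟨A, hA, rfl⟩ := hc.exists_map_succ h0
        exact (shifted_facts hμ h A.length).2 A hA (Nat.le_succ _)
    refine ⟨hμ, hreg, fun S j hS => ?_⟩
    have hS' := hS.of_append
    by_cases h0 : 0 ∈ S
    · obtain ⟨A, hA, hp⟩ := hS'.exists_zero_cons h0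
      obtain _ | j := j
      · exact absurd h0 hS.last.2
      have hc := hS.perm (hp.symm.append_right _)
      refine HasQuotientRep.perm hμ hreg hc hp (hasQuotientRep_zero_cons (h.rep A j ?_))
      refine hA.append_singleton (by have := hS.last.1; omega) fun hj => ?_
      exact hc.last.2 (List.mem_cons_of_mem _ (List.mem_map.2 ⟨j, hj, rfl⟩))
    · obtain ⟨A, hA, rfl⟩ := hS'.exists_map_succ h0
      have hX := (shifted_facts hμ h A.length).1 A hA rfl
      obtain _ | j := j
      · exact hasQuotientRep_map_succ_zero hμ h hA hreg hX
      · refine hasQuotientRep_map_succ_succ hμ h (hA.append_singleton ?_ fun hj => ?_) hreg hX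
        · have := hS.last.1
          omega
        · exact hS.last.2 (List.mem_map.2 ⟨j, hj, rfl⟩)

/-- The Nikishin system of a chain of measures: linear forms with polynomial coefficients have few
zeros. -/
theorem fewZeros_nikishinFun (hμ : NikishinChain μ K) (J : Finset ℕ) :
    ATFamily (offCut (K 0)) J (nikishinFun μ) := by
  intro n p hp hp0 w hw hwU hd
  -- Enough columns to contain all of `J`; the empty list of fixed columns gives the functions
  -- themselves as minors of size one.
  refine (regularSystem hμ (J.sup id + 1)).atFamily J [] ⟨List.nodup_nil, by simp⟩
    (fun k hk => ⟨Nat.lt_succ_of_le (Finset.le_sup (f := id) hk), by simp⟩) n p hp hp0 w hw hwU ?_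
  obtain ⟨g, hg, hfg⟩ := hd
  refine ⟨g, hg, fun z hz => ?_⟩
  rw [← hfg z hz]
  exact Finset.sum_congr rfl fun k _ => by
    simp only [List.nil_append]
    rw [minorExt_singleton hμ k hz]

theorem sum_analyticOrderAt_nikishin_lt (hμ : NikishinChain μ K) (J : Finset ℕ) {n : ℕ → ℕ} {p : ℕ → ℝ[X]}
    (hp : ∀ k ∈ J, (p k).degree < n k) (hp0 : ∃ k ∈ J, p k ≠ 0) :
    AnalyticOnNhd ℂ (fun z => ∑ k ∈ J, aeval z (p k) * nikishinFun μ k z) (offCut (K 0)) ∧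
    ∀ T : Finset ℂ, (T : Set ℂ) ⊆ offCut (K 0) →
      ∑ z ∈ T, analyticOrderAt (fun z => ∑ k ∈ J, aeval z (p k) * nikishinFun μ k z) z <
        ((∑ k ∈ J, n k : ℕ) : ℕ∞) := by
  have hU := isOpen_symm_offCut (hμ.carried 0).compact
  have han : AnalyticOnNhd ℂ (fun z => ∑ k ∈ J, aeval z (p k) * nikishinFun μ k z) (offCut (K 0)) :=
    Finset.analyticOnNhd_fun_sum _ fun k _ =>
      (AnalyticOnNhd.aeval_real (p k)).mul (analyticOnNhd_nikishinFun hμ k).1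
  refine ⟨han, (fewZeros_nikishinFun hμ J n p hp hp0).sum_analyticOrderAt_lt hU.1 hU.2 han fun z hz => ?_⟩
  simp only [map_sum, map_mul]
  exact Finset.sum_congr rfl fun k _ => by
    rw [aeval_conj_real, (analyticOnNhd_nikishinFun hμ k).2 z hz]

end

/-! ### From signed measures to a chain of positive measures -/

/-- The signed measure `s` is the real multiple `ε ν` of the measure `ν`. -/
def IsMultiple (s : SignedMeasure ℝ) (ε : ℝ) (ν : Measure ℝ) : Prop :=
  ∃ _ : IsFiniteMeasure ν, s = ε • ν.toSignedMeasure

namespace IsMultiple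

variable {s : SignedMeasure ℝ} {ε : ℝ} {ν : Measure ℝ}

theorem integral_eq (h : IsMultiple s ε ν) {E : Type*} [NormedAddCommGroup E] [NormedSpace ℝ E]
    (f : ℝ → E) :
    s.integral f (ContinuousLinearMap.lsmul ℝ ℝ).flip = ε • ∫ x, f x ∂ν := by
  obtain ⟨_, rfl⟩ := h
  rw [VectorMeasure.integral_smul_vectorMeasure, VectorMeasure.integral_toSignedMeasure]

theorem withDensity (h : IsMultiple s ε ν) {K : Set ℝ} (hν : SupportedOn ν K) {ρ : ℝ → ℝ}
    (hρ : ContinuousOn ρ K) {t : ℝ} (ht : ∀ x ∈ K, ρ x = t * |ρ x|) :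
    ∃ ν' : Measure ℝ, SupportedOn ν' K ∧
      IsMultiple (s.withDensity ρ (ContinuousLinearMap.lsmul ℝ ℝ).flip) (ε * t) ν' ∧
      ∀ f : ℝ → ℂ, ∫ x, f x ∂ν' = ∫ x, ((|ρ x| : ℝ) : ℂ) * f x ∂ν := by
  obtain ⟨ν', hν', hint, -⟩ := hν.exists_withDensity hρ.abs fun x _ => abs_nonneg (ρ x)
  refine ⟨ν', hν', ?_, hint⟩
  have := hν'.finite
  refine ⟨this, ?_⟩
  obtain ⟨_, rfl⟩ := h
  have hρi : Integrable ρ ν := hν.integrable hρ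
  ext A hA
  have h1 : (ε • ν.toSignedMeasure).Integrable ρ := by
    rw [VectorMeasure.Integrable, VectorMeasure.variation_smul, Measure.variation_toSignedMeasure]
    exact hρi.smul_measure_nnreal
  rw [VectorMeasure.withDensity_apply h1, VectorMeasure.restrict_smul,
    VectorMeasure.integral_smul_vectorMeasure, VectorMeasure.setIntegral_toSignedMeasure hA]
  rw [_root_.smul_apply, Measure.toSignedMeasure_apply_measurable hA, smul_eq_mul, smul_eq_mul, mul_assoc]
  congr 1
  have h2 : ν'.real A = ∫ x in A, |ρ x| ∂ν := by
    have h3 := hint (A.indicator fun _ => 1)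
    rw [integral_indicator hA] at h3
    simp only [integral_const, MeasurableSet.univ, Measure.real, Measure.restrict_apply, Set.univ_inter,
      Complex.real_smul, mul_one] at h3
    have h4 : (fun x => ((|ρ x| : ℝ) : ℂ) * A.indicator (fun _ => 1) x) =
        A.indicator fun x => ((|ρ x| : ℝ) : ℂ) := by
      ext x
      by_cases hx : x ∈ A <;> simp [hx]
    rw [h4, integral_indicator hA, integral_complex_ofReal] at h3
    exact_mod_cast h3
  rw [h2, ← integral_const_mul]
  refine integral_congr_ae (ae_restrict_of_ae ?_)
  filter_upwards [hν.ae_mem] with x hx using ht x hx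

theorem cauchyTransform_eq (h : IsMultiple s ε ν) (z : ℂ) :
    cauchyTransform s z = ε * cauchy (fun _ => 1) ν z := by
  rw [cauchyTransform, h.integral_eq]
  simp [cauchy]

theorem realCauchyTransform_eq (h : IsMultiple s ε ν) (y : ℝ) :
    (realCauchyTransform s y : ℂ) = ε * cauchy (fun _ => 1) ν y := by
  rw [realCauchyTransform, h.integral_eq, smul_eq_mul, Complex.ofReal_mul, ← integral_complex_ofReal]
  simp [cauchy]

end IsMultiple

theorem IsMarkovMeasure.exists_isMultiple {s : SignedMeasure ℝ} (h : IsMarkovMeasure s) :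
    ∃ ε : ℝ, (ε = 1 ∨ ε = -1) ∧ IsMultiple s ε s.variation := by
  rcases h.constant_sign with h0 | h0
  · have h1 := SignedMeasure.toMeasureOfZeroLE_toSignedMeasure s
      ((VectorMeasure.le_restrict_univ_iff_le _ _).2 h0)
    have h2 := Measure.variation_toSignedMeasure
      (μ := s.toMeasureOfZeroLE Set.univ MeasurableSet.univ ((VectorMeasure.le_restrict_univ_iff_le _ _).2 h0))
    rw [h1] at h2
    refine ⟨1, Or.inl rfl, ?_⟩
    rw [h2]
    exact ⟨inferInstance, by rw [h1, one_smul]⟩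
  · have h1 := SignedMeasure.toMeasureOfLEZero_toSignedMeasure s
      ((VectorMeasure.le_restrict_univ_iff_le _ _).2 h0)
    have h2 := Measure.variation_toSignedMeasure
      (μ := s.toMeasureOfLEZero Set.univ MeasurableSet.univ ((VectorMeasure.le_restrict_univ_iff_le _ _).2 h0))
    rw [h1, VectorMeasure.variation_neg] at h2
    refine ⟨-1, Or.inr rfl, ?_⟩
    rw [h2]
    exact ⟨inferInstance, by rw [h1]; simp⟩

theorem isCompact_convexHull_real {S : Set ℝ} (hS : IsCompact S) (hne : S.Nonempty) :
    IsCompact (convexHull ℝ S) := by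
  have hle : sInf S ≤ sSup S := csInf_le_csSup hne hS.bddBelow hS.bddAbove
  have heq : convexHull ℝ S = Set.Icc (sInf S) (sSup S) := by
    refine Set.Subset.antisymm (convexHull_min ?_ (convex_Icc _ _)) ?_
    · exact fun x hx => ⟨csInf_le hS.bddBelow hx, le_csSup hS.bddAbove hx⟩
    · rw [← segment_eq_Icc hle]
      exact (convex_convexHull ℝ S).segment_subset (subset_convexHull ℝ S (hS.sInf_mem hne))
        (subset_convexHull ℝ S (hS.sSup_mem hne))
  rw [heq]
  exact isCompact_Icc

theorem IsMarkovMeasure.carried {s : SignedMeasure ℝ} (h : IsMarkovMeasure s) :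
    Carried s.variation (suppHull s) := by
  obtain ⟨ε, -, hfin, -⟩ := h.exists_isMultiple
  refine ⟨⟨isCompact_convexHull_real h.compact_support h.infinite_support.nonempty, hfin, ?_⟩, (convex_convexHull ℝ _).ordConnected, fun S hS => ?_⟩
  · exact measure_mono_null (Set.compl_subset_compl.2 (subset_convexHull ℝ _)) Measure.measure_compl_support
  · refine h.infinite_support (S.finite_toSet.subset ?_)
    exact Measure.support_subset_of_isClosed S.finite_toSet.isClosed (by rwa [mem_ae_iff])

theorem carried_Icc (a : ℝ) : Carried (volume.restrict (Set.Icc a (a + 1))) (Set.Icc a (a + 1)) := by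
  refine ⟨⟨isCompact_Icc, ⟨by simp⟩, by simp⟩, Set.ordConnected_Icc, fun S hS => ?_⟩
  have h1 : (volume.restrict (Set.Icc a (a + 1))) (S : Set ℝ) = 0 :=
    S.finite_toSet.measure_zero _
  have h2 := measure_union_null h1 hS
  rw [Set.union_compl_self] at h2
  simp at h2

theorem GeneratesNikishin.exists_chain {m : ℕ} {σ : Fin m → SignedMeasure ℝ} (h : GeneratesNikishin σ) :
    ∃ (μ : ℕ → Measure ℝ) (K : ℕ → Set ℝ), NikishinChain μ K ∧
      ∀ i : Fin m, K i = suppHull (σ i) ∧ ∃ ε : ℝ, (ε = 1 ∨ ε = -1) ∧ IsMultiple (σ i) ε (μ i) := by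
  obtain ⟨R, hR⟩ : ∃ R : ℝ, ∀ i : Fin m, ∀ x ∈ suppHull (σ i), x < R := by
    have h1 : IsCompact (⋃ i : Fin m, suppHull (σ i)) := isCompact_iUnion fun i => (h.markov i).carried.compact
    obtain ⟨R, hR⟩ := h1.bddAbove
    exact ⟨R + 1, fun i x hx => (hR (Set.mem_iUnion.2 ⟨i, hx⟩)).trans_lt (lt_add_one R)⟩
  -- The chain must be infinite, so it is continued by Lebesgue measure on intervals to the right of
  -- all given ones. Spacing 2 against length 1 keeps them disjoint.
  set I : ℕ → Set ℝ := fun i => Set.Icc (R + 2 * i) (R + 2 * i + 1) with hI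
  refine ⟨fun i => if hi : i < m then (σ ⟨i, hi⟩).variation else volume.restrict (I i),
    fun i => if hi : i < m then suppHull (σ ⟨i, hi⟩) else I i, ⟨fun i => ?_, fun i => ?_⟩, fun i => ?_⟩
  · by_cases hi : i < m
    · simp only [hi, dif_pos]
      exact (h.markov _).carried
    · simp only [hi, dif_neg, not_false_eq_true]
      exact carried_Icc _
  · by_cases hi : i + 1 < m
    · have hi' : i < m := by omega
      simp only [hi, hi', dif_pos]
      exact h.disjoint_consecutive _ _ rfl
    · simp only [hi, dif_neg, not_false_eq_true]
      refine Set.disjoint_left.2 fun x hx hx' => ?_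
      have h1 : R + 2 * ((i + 1 : ℕ) : ℝ) ≤ x := hx'.1
      push_cast at h1
      by_cases hi' : i < m
      · simp only [hi', dif_pos] at hx
        have := hR _ x hx
        have h2 : (0 : ℝ) ≤ i := Nat.cast_nonneg i
        linarith
      · simp only [hi', dif_neg, not_false_eq_true] at hx
        have h2 : x ≤ R + 2 * i + 1 := hx.2
        linarith
  · simp only [i.2, dif_pos, true_and]
    exact (h.markov i).exists_isMultiple

/-- In each product the weight is, up to sign, a function of the tail chain. It has no zeros on K₀,
so it has constant sign there and the product is again a signed multiple of a positive measure. -/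
theorem exists_isMultiple_nikishinSystem {m : ℕ} {σ : Fin m → SignedMeasure ℝ} {μ : ℕ → Measure ℝ}
    {K : ℕ → Set ℝ} (hμ : NikishinChain μ K)
    (hσ : ∀ i : Fin m, ∃ ε : ℝ, (ε = 1 ∨ ε = -1) ∧ IsMultiple (σ i) ε (μ i)) (k : Fin m) :
    ∃ ε : ℝ, (ε = 1 ∨ ε = -1) ∧ ∃ ν : Measure ℝ, IsMultiple (nikishinSystem σ k) ε ν ∧
      ∃ t : ℝ, (t = 1 ∨ t = -1) ∧
        ∀ f : ℝ → ℂ, ∫ x, f x ∂ν = t * ∫ x, nikishinFun (tailSeq μ) k x * f x ∂(μ 0) := by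
  induction m generalizing μ K with
  | zero => exact k.elim0
  | succ m ih =>
    obtain ⟨ε, hε, h0⟩ := hσ 0
    refine Fin.cases ?_ (fun k => ?_) k
    · exact ⟨ε, hε, μ 0, h0, 1, Or.inl rfl, fun f => by simp [nikishinFun]⟩
    · obtain ⟨ε', hε', ν, hν, t, ht, hint⟩ := ih (σ := Fin.tail σ) hμ.tail (fun i => hσ i.succ) k
      have hd := hμ.disjoint 0
      set N := nikishinFun (tailSeq μ) (k + 1) with hN
      have hNan := analyticOnNhd_nikishinFun hμ.tail (k + 1)
      set ρ := realCauchyTransform (nikishinSystem (Fin.tail σ) k) with hρ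
      have hρN : ∀ y : ℝ, (ρ y : ℂ) = (ε' * t : ℝ) * N y := by
        intro y
        rw [hρ, hν.realCauchyTransform_eq, cauchy, hint]
        simp only [mul_one_div]
        push_cast
        rw [mul_assoc]
        rfl
      have hmem : ∀ y ∈ K 0, (y : ℂ) ∈ offCut (K 1) := fun y hy =>
        SupportedOn.ofReal_mem_offCut_of_disjoint hd hy
      have hN0 : ∀ y ∈ K 0, N y ≠ 0 := fun y hy => by
        have h1 := (regularSystem hμ.tail (k + 2)).regular [k + 1] ⟨by simp, by simp⟩
        rw [hN, ← minorExt_singleton hμ.tail (k + 1) (hmem y hy)]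
        exact h1.ne_zero _ (hmem y hy)
      have hNc : ContinuousOn (fun y : ℝ => N y) (K 0) :=
        SupportedOn.continuousOn_ofReal_comp hd hNan.1.continuousOn
      obtain ⟨r, hr, hNr⟩ := Carried.exists_sign (hμ.carried 0).ordConnected hNc
        (fun y hy => hNan.2.im_eq_zero (hmem y hy)) hN0
      have hε't : ε' * t = 1 ∨ ε' * t = -1 := by
        rcases hε' with rfl | rfl <;> rcases ht with rfl | rfl <;> norm_num
      have hnorm : ∀ y : ℝ, |ρ y| = ‖N y‖ := by
        intro y
        rw [← Real.norm_eq_abs, ← Complex.norm_real, hρN, norm_mul]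
        rcases hε't with h | h <;> rw [h] <;> simp
      have hρc : ContinuousOn ρ (K 0) := by
        have : ρ = fun y : ℝ => ((ε' * t : ℝ) * N y : ℂ).re := by
          ext y
          rw [← hρN, Complex.ofReal_re]
        rw [this]
        exact Complex.continuous_re.comp_continuousOn (continuousOn_const.mul hNc)
      obtain ⟨ν', hν', hmul, hint'⟩ := h0.withDensity (hμ.carried 0).toSupportedOn hρc (t := ε' * t * r)
        fun y hy => by
          have h1 := hρN y
          rw [hNr y hy] at h1
          rw [hnorm, mul_assoc]
          exact_mod_cast h1
      have hrr : r * r = 1 := by rcases hr with rfl | rfl <;> norm_num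
      refine ⟨ε * (ε' * t * r), ?_, ν', hmul, r, hr, fun f => ?_⟩
      · rcases hε with rfl | rfl <;> rcases hε't with h | h <;> rw [h] <;> rcases hr with rfl | rfl <;>
          norm_num
      · rw [hint', ← integral_const_mul]
        refine (hμ.carried 0).integral_congr fun y hy => ?_
        rw [hnorm]
        have h1 := hNr y hy
        have h2 : (r : ℂ) * r = 1 := by exact_mod_cast hrr
        simp only [Fin.val_succ]
        rw [← hN]
        generalize ‖N y‖ = n at h1 ⊢
        rw [h1]
        linear_combination (-(n : ℂ) * f y) * h2

/-- The Cauchy transforms of a Nikishin system are, up to signs, the functions of the chain. -/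
theorem exists_sign_cauchyTransform {m : ℕ} {σ : Fin m → SignedMeasure ℝ} {μ : ℕ → Measure ℝ}
    {K : ℕ → Set ℝ} (hμ : NikishinChain μ K)
    (hσ : ∀ i : Fin m, ∃ ε : ℝ, (ε = 1 ∨ ε = -1) ∧ IsMultiple (σ i) ε (μ i)) (k : Fin m) :
    ∃ δ : ℝ, δ ≠ 0 ∧ (∀ z, cauchyTransform (nikishinSystem σ k) z = δ * nikishinFun μ (k + 1) z) ∧
      ∀ y : ℝ, (realCauchyTransform (nikishinSystem σ k) y : ℂ) = δ * nikishinFun μ (k + 1) y := by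
  obtain ⟨ε, hε, ν, hν, t, ht, hint⟩ := exists_isMultiple_nikishinSystem hμ hσ k
  have key : ∀ z, (ε : ℂ) * cauchy (fun _ => 1) ν z = (ε * t : ℝ) * nikishinFun μ (k + 1) z := by
    intro z
    rw [cauchy, hint]
    simp only [mul_one_div]
    push_cast
    rw [mul_assoc]
    rfl
  refine ⟨ε * t, ?_, fun z => (hν.cauchyTransform_eq z).trans (key z), fun y =>
    (hν.realCauchyTransform_eq y).trans (key y)⟩
  rcases hε with rfl | rfl <;> rcases ht with rfl | rfl <;> norm_num

theorem linearForm_hasFewerZerosThan {m : ℕ} {σ : Fin m → SignedMeasure ℝ} {μ : ℕ → Measure ℝ}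
    {K : ℕ → Set ℝ} (hμ : NikishinChain μ K)
    (hσ : ∀ i : Fin m, ∃ ε : ℝ, (ε = 1 ∨ ε = -1) ∧ IsMultiple (σ i) ε (μ i)) (n : Fin (m + 1) → ℕ)
    (p : Fin (m + 1) → ℝ[X]) (hp : ∀ k, (p k).degree < n k) (hp0 : p ≠ 0) :
    HasFewerZerosThan (linearForm (nikishinSystem σ) p) (offCut (K 0)) (∑ k, n k) := by
  choose δ hδ hcauchy _ using exists_sign_cauchyTransform hμ hσ
  set d : Fin (m + 1) → ℝ := Fin.cons 1 δ with hd
  have hd0 : ∀ k, d k ≠ 0 := fun k => by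
    refine Fin.cases ?_ (fun k => ?_) k
    · simp [hd]
    · simpa [hd] using hδ k
  set n' : ℕ → ℕ := fun i => if hi : i < m + 1 then n ⟨i, hi⟩ else 0 with hn'
  -- The nonzero factors relating the two systems pass into the coefficients, leaving degrees and
  -- nonvanishing unchanged.
  set P : ℕ → ℝ[X] := fun i => if hi : i < m + 1 then C (d ⟨i, hi⟩) * p ⟨i, hi⟩ else 0 with hP
  have hPk : ∀ k : Fin (m + 1), P k = C (d k) * p k := fun k => dif_pos k.2
  have hnk : ∀ k : Fin (m + 1), n' k = n k := fun k => dif_pos k.2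
  have hform : linearForm (nikishinSystem σ) p = fun z => ∑ k ∈ Finset.range (m + 1),
      aeval z (P k) * nikishinFun μ k z := by
    funext z
    rw [Finset.sum_range, Fin.sum_univ_succ, linearForm]
    congr 1
    · rw [hPk]
      simp [hd, nikishinFun]
    · refine Finset.sum_congr rfl fun k _ => ?_
      rw [hPk, hcauchy]
      simp [hd]
      ring
  have hsum : ∑ k, n k = ∑ k ∈ Finset.range (m + 1), n' k := by
    rw [Finset.sum_range]
    simp only [hnk]
  rw [hform, hsum]
  refine sum_analyticOrderAt_nikishin_lt hμ _ (fun k hk => ?_) ?_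
  · have := hPk ⟨k, Finset.mem_range.1 hk⟩
    have h2 := hnk ⟨k, Finset.mem_range.1 hk⟩
    simp only at this h2
    rw [this, h2, degree_C_mul (hd0 _)]
    exact hp _
  · obtain ⟨k, hk⟩ := Function.ne_iff.1 hp0
    exact ⟨k, Finset.mem_range.2 k.2, by rw [hPk]; exact mul_ne_zero (C_ne_zero.2 (hd0 k)) hk⟩

/-- Each zero has order at least one, so `N` distinct real zeros would exceed the bound with
multiplicities. -/
theorem HasFewerZerosThan.encard_lt {f : ℂ → ℂ} {U : Set ℂ} {N : ℕ} (h : HasFewerZerosThan f U N)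
    {S : Set ℝ} (hSU : ∀ x ∈ S, (x : ℂ) ∈ U) (hS : ∀ x ∈ S, f x = 0) : S.encard < N := by
  classical
  by_contra hcon
  push Not at hcon
  obtain ⟨T, hTS, hT⟩ := Set.exists_subset_encard_eq hcon
  have hfin : T.Finite := Set.finite_of_encard_eq_coe hT
  have h1 := h.2 (hfin.toFinset.image Complex.ofReal) fun z hz => by
    obtain ⟨x, hx, rfl⟩ := Finset.mem_image.1 (Finset.mem_coe.1 hz)
    exact hSU x (hTS (hfin.mem_toFinset.1 hx))
  rw [Finset.sum_image fun _ _ _ _ h => Complex.ofReal_injective h] at h1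
  refine absurd h1 (not_lt.2 ?_)
  calc (N : ℕ∞) = ∑ x ∈ hfin.toFinset, 1 := by
        rw [← hT, hfin.encard_eq_coe_toFinset_card]
        simp
    _ ≤ _ := Finset.sum_le_sum fun x hx => by
        have hx' := hTS (hfin.mem_toFinset.1 hx)
        rw [Order.one_le_iff_pos, pos_iff_ne_zero]
        exact (h.1 x (hSU x hx')).analyticOrderAt_ne_zero.2 (hS x hx')

theorem theorem1 (m : ℕ) (hm : 0 < m) (σ : Fin m → MeasureTheory.SignedMeasure ℝ)
    (hσ : GeneratesNikishin σ) :
    (∀ Δ : Set ℝ, Δ.OrdConnected → Disjoint Δ (suppHull (σ ⟨0, hm⟩)) →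
      IsATSystem
        (Fin.cons (fun _ => 1) (fun k => realCauchyTransform (nikishinSystem σ k)) :
          Fin (m + 1) → ℝ → ℝ) Δ) ∧
    (∀ n : Fin (m + 1) → ℕ, ∀ p : Fin (m + 1) → Polynomial ℝ,
      (∀ k, (p k).degree < n k) → p ≠ 0 →
        HasFewerZerosThan (linearForm (nikishinSystem σ) p)
          (Complex.ofReal '' suppHull (σ ⟨0, hm⟩))ᶜ (∑ k, n k)) := by
  obtain ⟨μ, K, hμ, hK⟩ := hσ.exists_chain
  have hmul := fun i => (hK i).2
  have hK0 : suppHull (σ ⟨0, hm⟩) = K 0 := (hK ⟨0, hm⟩).1.symm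
  rw [hK0]
  have key := linearForm_hasFewerZerosThan hμ hmul
  refine ⟨fun Δ _ hΔ n => ⟨fun k => ?_, fun p hp hp0 => ?_⟩, key⟩
  · refine Fin.cases ?_ (fun k => ?_) k
    · simpa using continuousOn_const
    · obtain ⟨δ, -, -, hreal⟩ := exists_sign_cauchyTransform hμ hmul k
      have : realCauchyTransform (nikishinSystem σ k) =
          fun y : ℝ => ((δ : ℂ) * nikishinFun μ (k + 1) y).re := by
        ext y
        rw [← hreal, Complex.ofReal_re]
      simp only [Fin.cons_succ]
      rw [this]
      exact Complex.continuous_re.comp_continuousOn (continuousOn_const.mul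
        (SupportedOn.continuousOn_ofReal_comp hΔ (analyticOnNhd_nikishinFun hμ (k + 1)).1.continuousOn))
  · refine (key n p hp hp0).encard_lt (fun x hx => SupportedOn.ofReal_mem_offCut_of_disjoint hΔ hx.1)
      fun x hx => ?_
    have h0 := congrArg Complex.ofReal hx.2
    rw [Fin.sum_univ_succ] at h0
    simp only [Fin.cons_zero, Fin.cons_succ, mul_one, Complex.ofReal_add, Complex.ofReal_sum,
      Complex.ofReal_mul, Complex.ofReal_zero] at h0
    rw [linearForm, ← h0, aeval_ofReal]
    congr 1
    refine Finset.sum_congr rfl fun k _ => ?_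
    obtain ⟨δ, -, hz, hreal⟩ := exists_sign_cauchyTransform hμ hmul k
    rw [aeval_ofReal, hz, hreal]
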